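/- Fix an integer $m\ge 2$. Let $\mathbb A=\{\sigma_0,\dots,\sigma_{m-1}\}\cup\{\rho_0,\dots,\rho_{m-1}\}$ be the alphabet of the $2m$ distinct states belonging to a pair of residue classes $\sigma,\rho\subseteq\mathbb Z_{\ge 0}$ modulo $m$ (it depends on $m$ only). For a string $x\in\mathbb A^n$ let $\vec\sigma(x)\in\{0,1\}^n$ be the vector whose $i$-th entry is $1$ if $x[i]$ is one of the $\sigma_c$ and $0$ if it is one of the $\rho_c$, and let $\vec w(x)\in\{0,\dots,m-1\}^n$ be the vector whose $i$-th entry is the index $c$ of $x[i]\in\{\sigma_c,\rho_c\}$. A language $L\subseteq\mathbb A^n$ is called sparse if $\vec\sigma(x)\cdot\vec w(y)\equiv\vec\sigma(y)\cdot\vec w(x)\pmod m$ for all $x,y\in L$. Two strings $x,y\in\mathbb A^n$ can be combined if $\vec\sigma(x)=\vec\sigma(y)$; then $x\oplus y\in\mathbb A^n$ is the string with $\vec\sigma(x\oplus y)=\vec\sigma(x)$ and $\vec w(x\oplus y)\equiv\vec w(x)+\vec w(y)\pmod m$ entrywise. For $L_1,L_2\subseteq\mathbb A^n$ let $L_1\oplus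 L_2$ be the set of all $x\oplus y$ with $x\in L_1$ and $y\in L_2$ that can be combined. Then there is an algorithm that, given $n\ge 0$ and two sparse languages $L_1,L_2\subseteq\mathbb A^n$ (each as a list of its strings without repetitions) such that $L_1\oplus L_2$ is also sparse, computes $L_1\oplus L_2$ (as a list of its strings without repetitions) in time $m^n\cdot n^{O(1)}$. Precisely: there is an absolute constant $c$ such that for every $m\ge2$ there are a constant $C$ and a program for a random access machine that solves this task for all such $n,L_1,L_2$ in time at most $C\cdot m^n\cdot(n+1)^c$, where time is measured by the logarithmic cost criterion (every instruction is charged according to the bit lengths of the numbers and memory addresses it handles). -/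

import Mathlib

/-! ## States, strings and languages -/

/-- The alphabet of states for two residue classes modulo `m`: the `σ`-states
`σ_0, …, σ_{m-1}` and the `ρ`-states `ρ_0, …, ρ_{m-1}`. -/
inductive PortalState (m : ℕ) : Type where
  | sigma (c : Fin m) : PortalState m
  | rho (c : Fin m) : PortalState m

namespace PortalState

variable {m : ℕ}

/-- `1` on `σ`-states, `0` on `ρ`-states. -/
def sigBit : PortalState m → ℕ
  | sigma _ => 1
  | rho _ => 0

/-- The index `c` of `σ_c` or `ρ_c`. -/
def weight : PortalState m → ℕ
  | sigma c => c
  | rho c => c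

/-- Combination of two states; `none` is the symbol `⊥`. The sum in `Fin m` is the sum
of the indices reduced modulo `m`. -/
def combine : PortalState m → PortalState m → Option (PortalState m)
  | sigma a, sigma b => some (sigma (a + b))
  | rho a, rho b => some (rho (a + b))
  | _, _ => none

end PortalState

/-- A string of length `n` over the alphabet of states. -/
abbrev StateString (m n : ℕ) : Type := Fin n → PortalState m

namespace StateString

variable {m n : ℕ}

/-- The `σ`-vector of a string. -/
def sigVec (x : StateString m n) : Fin n → ℕ := fun i => (x i).sigBit

/-- The weight-vector of a string. -/
def weightVec (x : StateString m n) : Fin n → ℕ := fun i => (x i).weight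

/-- The combination `x ⊕ y`, a string over the states together with `⊥`. -/
def combine (x y : StateString m n) : Fin n → Option (PortalState m) :=
  fun i => (x i).combine (y i)

end StateString

/-- A language `L` is sparse if `σ(x) · w(y) ≡ σ(y) · w(x) (mod m)` for all `x, y ∈ L`. -/
def IsSparse {m n : ℕ} (L : Set (StateString m n)) : Prop :=
  ∀ x ∈ L, ∀ y ∈ L,
    (∑ i, x.sigVec i * y.weightVec i) ≡ (∑ i, y.sigVec i * x.weightVec i) [MOD m]

/-- The combination `L₁ ⊕ L₂`: all `x ⊕ y` with `x ∈ L₁`, `y ∈ L₂` in which no `⊥` occurs. -/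
def combineLang {m n : ℕ} (L₁ L₂ : Set (StateString m n)) : Set (StateString m n) :=
  {z | ∃ x ∈ L₁, ∃ y ∈ L₂, x.combine y = fun i => some (z i)}

/-! ## Random access machines with logarithmic cost -/

namespace RAM

/-- Binary operations on natural numbers (`sub` is truncated, `div` and `mod` are division
with remainder). -/
inductive Op : Type where
  | add | sub | mul | div | mod

/-- The value of a binary operation. -/
def Op.eval : Op → ℕ → ℕ → ℕ
  | add, a, b => a + b
  | sub, a, b => a - b
  | mul, a, b => a * b
  | div, a, b => a / b
  | mod, a, b => a % b

/-- The cost of a binary operation in terms of the bit lengths of its operands: linear for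
`add` and `sub`, and that of the schoolbook methods for `mul`, `div` and `mod`. -/
def Op.cost : Op → ℕ → ℕ → ℕ
  | add, a, b | sub, a, b => 1 + a.size + b.size
  | mul, a, b | div, a, b | mod, a, b => (1 + a.size) * (1 + b.size)

/-- Instructions. A register is named by a fixed number; memory is addressed by the
contents of registers. Jump targets are positions in the program. -/
inductive Instr : Type where
  /-- `r_i := v` -/
  | const (i v : ℕ)
  /-- `r_i := r_j ∘ r_k` -/
  | op (o : Op) (i j k : ℕ)
  /-- `r_i := mem[r_j]` -/
  | load (i j : ℕ)
  /-- `mem[r_i] := r_j` -/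
  | store (i j : ℕ)
  /-- continue at position `t` -/
  | jump (t : ℕ)
  /-- continue at position `t` if `r_i = 0` -/
  | jumpZero (i t : ℕ)
  /-- `r_i :=` the next number of the input (`0` if there is none) -/
  | read (i : ℕ)
  /-- append `r_i` to the output -/
  | write (i : ℕ)

/-- A program is a finite list of instructions. -/
abbrev Program : Type := List Instr

/-- A configuration: program counter, registers, memory, the unread part of the input and
the output written so far. -/
structure Config : Type where
  pc : ℕ
  reg : ℕ → ℕ
  mem : ℕ → ℕ
  input : List ℕ
  output : List ℕ

/-- The initial configuration: all registers and memory cells are `0`. -/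
def Config.init (input : List ℕ) : Config where
  pc := 0
  reg := fun _ => 0
  mem := fun _ => 0
  input := input
  output := []

/-- The effect of one instruction. -/
def Instr.exec : Instr → Config → Config
  | const i v, s => { s with pc := s.pc + 1, reg := Function.update s.reg i v }
  | op o i j k, s =>
      { s with pc := s.pc + 1, reg := Function.update s.reg i (o.eval (s.reg j) (s.reg k)) }
  | load i j, s =>
      { s with pc := s.pc + 1, reg := Function.update s.reg i (s.mem (s.reg j)) }
  | store i j, s =>
      { s with pc := s.pc + 1, mem := Function.update s.mem (s.reg i) (s.reg j) }
  | jump t, s => { s with pc := t }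
  | jumpZero i t, s => { s with pc := if s.reg i = 0 then t else s.pc + 1 }
  | read i, s =>
      { s with
        pc := s.pc + 1
        reg := Function.update s.reg i (s.input.headD 0)
        input := s.input.tail }
  | write i, s => { s with pc := s.pc + 1, output := s.output ++ [s.reg i] }

/-- The logarithmic cost of one instruction: every number and every memory address that is
handled is charged with its bit length. -/
def Instr.cost : Instr → Config → ℕ
  | const _ v, _ => 1 + v.size
  | op o _ j k, s => o.cost (s.reg j) (s.reg k)
  | load _ j, s => 1 + (s.reg j).size + (s.mem (s.reg j)).size
  | store i j, s => 1 + (s.reg i).size + (s.reg j).size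
  | jump _, _ => 1
  | jumpZero i _, s => 1 + (s.reg i).size
  | read _, s => 1 + (s.input.headD 0).size
  | write i, s => 1 + (s.reg i).size

/-- `Runs P s t s'`: started in `s`, the program `P` halts in `s'` after time `t`. The
machine halts when the program counter leaves the program. -/
inductive Runs (P : Program) : Config → ℕ → Config → Prop where
  | halt (s : Config) (h : P[s.pc]? = none) : Runs P s 0 s
  | step (s s' : Config) (I : Instr) (t : ℕ) (h : P[s.pc]? = some I)
      (hrun : Runs P (I.exec s) t s') : Runs P s (I.cost s + t) s'

/-- On the given input, `P` halts with the given output after time at most `T`. -/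
def OutputsInTime (P : Program) (input output : List ℕ) (T : ℕ) : Prop :=
  ∃ t ≤ T, ∃ s', Runs P (Config.init input) t s' ∧ s'.output = output

end RAM

/-! ## Representation of languages on the machine -/

/-- A string is represented by the pairs `σ`-bit, weight of its states. -/
def encodeString {m n : ℕ} (x : StateString m n) : List ℕ :=
  (List.ofFn x).flatMap fun a => [a.sigBit, a.weight]

/-- A list of strings is represented by its strings, each preceded by `1`, and a final `0`. -/
def encodeStrings {m n : ℕ} (l : List (StateString m n)) : List ℕ :=
  (l.flatMap fun x => 1 :: encodeString x) ++ [0]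

/-- The list `l` contains every string of `L` exactly once, and no other string. -/
def Enumerates {m n : ℕ} (l : List (StateString m n)) (L : Set (StateString m n)) : Prop :=
  l.Nodup ∧ ∀ x, x ∈ l ↔ x ∈ L

/-! ## A structured language and its compilation to the machine -/

set_option linter.unusedSimpArgs false

namespace Imp

/-! Only strings of `L₁` whose σ-vector also occurs in `L₂` can take part in a combination; call
their set `A = common L₁ L₂`. View the σ-vectors of `A` as a set of paths in a binary tree and let
`S` be the set of levels at which some node has both children (`Branch`). Two vectors of `A` that
agree on `S` are equal, because their first difference would lie in `S` (`bit_eq_of_branch`).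
Dually, a weight vector modulo `m` that is orthogonal to all σ-vectors of `A` and vanishes off `S`
is zero, by elimination from the last position backwards (`eq_zero_of_branch`). Sparsity supplies
the orthogonality: `σ(t)·w(x) = σ(x)·w(t)` depends on `x` only through its σ-vector, so weights of
strings with equal σ-vectors differ by something orthogonal to every `σ(t)` (`IsSparse.orthogonal`).
Hence `n` digits to the base `m`, the bits on `S` and the weights off `S`, determine a string. This
bounds the languages by `m ^ n` strings, and it also shows that a combination is determined by its
bits on `S` and its weight sums off `S` (`Joins.unique`).

So the combinations are found by a convolution on an array of size `m ^ n`: pointwise on the digits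
in `S`, cyclic modulo `m` on the others. A Fourier transform along the digits off `S`, a pointwise
product and a second forward transform compute it up to a power of `m` and a reversal of sign
(`transf_mul_transf`). The entry at an index counts the pairs of strings with that index; it does
not show the weights on `S`. Therefore the convolution is repeated for each of the `2n` coordinates
of a combination, with each string weighted by `ω` to the power of its coordinate. All pairs at one
index have the same combination, so this entry is the count times `ω ^ c`, where `c` is the wanted
coordinate (`passValue_eq_iff`).

The ring must have an `m`-th root of unity `ω` with `ω ^ s - 1` invertible for `m ∤ s`, and the
counts, at most `4 m ^ (3n)` after scaling, must not vanish in it. A fixed prime `p ≡ 1` modulo `m`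
and the modulus `p ^ (3n+2)` meet both demands, with `ω = g ^ p ^ (3n+2)` the lift of an element `g`
of order `m` modulo `p` (`exists_prime_root`). Only `p` and `g`, which depend on `m` alone, enter
the program.

For the machine, the algorithm is written in a small structured language. `reach_cmd` compiles it
and charges each unit step a constant times the square of the bit length of the numbers involved.
These have `O(n)` bits, and the algorithm takes `O(m ^ n · n ^ 2)` unit steps (`tri_joinProgram`,
`bounded_joinTime`). -/

/-- Program variables. -/
inductive Var : Type where
  | n | pow | modulus | root | two | acc | side | flag | cnt | code | bit | wt | i | j | k | c
  | dig | half | pass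
  deriving DecidableEq

/-- Names of arrays. -/
inductive Arr : Type where
  | place | unit | bits | attr | side | code | seen | common | branch | key | buf | base | res
  deriving DecidableEq

/-- States of the structured language. -/
structure St : Type where
  var : Var → ℕ
  arr : Arr → ℕ → ℕ
  inp : List ℕ
  out : List ℕ

namespace St

def setVar (s : St) (x : Var) (v : ℕ) : St := { s with var := Function.update s.var x v }

def setArr (s : St) (a : Arr) (i v : ℕ) : St :=
  { s with arr := Function.update s.arr a (Function.update (s.arr a) i v) }

/-- All stored and all unread values are at most `L`. -/
def Bdd (L : ℕ) (s : St) : Prop :=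
  (∀ x, s.var x ≤ L) ∧ (∀ a i, s.arr a i ≤ L) ∧ ∀ v ∈ s.inp, v ≤ L

end St

/-- Expressions. -/
inductive Expr : Type where
  | lit (v : ℕ)
  | var (x : Var)
  | op (o : RAM.Op) (e₁ e₂ : Expr)
  | get (a : Arr) (e : Expr)

namespace Expr

instance : Coe Var Expr := ⟨var⟩
instance (v : ℕ) : OfNat Expr v := ⟨lit v⟩
instance : Add Expr := ⟨op .add⟩
instance : Sub Expr := ⟨op .sub⟩
instance : Mul Expr := ⟨op .mul⟩
instance : Div Expr := ⟨op .div⟩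
instance : Mod Expr := ⟨op .mod⟩

def eval (s : St) : Expr → ℕ
  | lit v => v
  | var x => s.var x
  | op o e₁ e₂ => o.eval (e₁.eval s) (e₂.eval s)
  | get a e => s.arr a (e.eval s)

@[simp] theorem eval_lit (s : St) (v : ℕ) : (lit v).eval s = v := rfl
@[simp] theorem eval_ofNat (s : St) (v : ℕ) [v.AtLeastTwo] :
    (ofNat(v) : Expr).eval s = OfNat.ofNat v := rfl
@[simp] theorem eval_zero (s : St) : (0 : Expr).eval s = 0 := rfl
@[simp] theorem eval_one (s : St) : (1 : Expr).eval s = 1 := rfl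
@[simp] theorem eval_var (s : St) (x : Var) : (var x).eval s = s.var x := rfl
@[simp] theorem eval_get (s : St) (a : Arr) (e : Expr) :
    (get a e).eval s = s.arr a (e.eval s) := rfl
@[simp] theorem eval_add (s : St) (e f : Expr) : (e + f).eval s = e.eval s + f.eval s := rfl
@[simp] theorem eval_sub (s : St) (e f : Expr) : (e - f).eval s = e.eval s - f.eval s := rfl
@[simp] theorem eval_mul (s : St) (e f : Expr) : (e * f).eval s = e.eval s * f.eval s := rfl
@[simp] theorem eval_div (s : St) (e f : Expr) : (e / f).eval s = e.eval s / f.eval s := rfl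
@[simp] theorem eval_mod (s : St) (e f : Expr) : (e % f).eval s = e.eval s % f.eval s := rfl

/-- The values that occur in the evaluation of an expression are at most `L ^ deg`. -/
def deg : Expr → ℕ
  | lit _ => 1
  | var _ => 1
  | op _ e₁ e₂ => e₁.deg + e₂.deg
  | get _ e => e.deg + 2

/-- A bound on the literals of an expression. -/
def litBound : Expr → ℕ
  | lit v => v
  | var _ => 0
  | op _ e₁ e₂ => e₁.litBound + e₂.litBound
  | get _ e => e.litBound

/-- Code that evaluates an expression to register `d`, using no register below `d`. -/
def comp : Expr → ℕ → List RAM.Instr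
  | lit v, d => [.const d v]
  | var x, d => [.const d 0, .op .add d x.ctorIdx d]
  | op o e₁ e₂, d => e₁.comp d ++ (e₂.comp (d + 1) ++ [.op o d d (d + 1)])
  | get a e, d => e.comp d ++
      -- The arrays are interleaved in memory: cell `i` of array `a` sits at address `16 * i +
      -- a.ctorIdx`, so all of them can grow without bound.
      [.const (d + 1) 16, .op .mul d d (d + 1), .const (d + 1) a.ctorIdx,
        .op .add d d (d + 1), .load d d]

end Expr

/-- Commands. -/
inductive Cmd : Type where
  | skip
  | assign (x : Var) (e : Expr)
  | store (a : Arr) (i e : Expr)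
  | read (x : Var)
  | write (e : Expr)
  | seq (c₁ c₂ : Cmd)
  | ite (e : Expr) (c₁ c₂ : Cmd)
  | loop (e : Expr) (c : Cmd)

/-- `Ev L c s t s'`: from `s` the command `c` leads to `s'` in `t` unit steps, and all values
that are stored on the way are at most `L`. -/
inductive Ev (L : ℕ) : Cmd → St → ℕ → St → Prop where
  | skip (s : St) : Ev L .skip s 0 s
  | assign (s : St) (x : Var) (e : Expr) (h : e.eval s ≤ L) :
      Ev L (.assign x e) s 1 (s.setVar x (e.eval s))
  | store (s : St) (a : Arr) (i e : Expr) (h : e.eval s ≤ L) :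
      Ev L (.store a i e) s 1 (s.setArr a (i.eval s) (e.eval s))
  | read (s : St) (x : Var) :
      Ev L (.read x) s 1 { s.setVar x (s.inp.headD 0) with inp := s.inp.tail }
  | write (s : St) (e : Expr) : Ev L (.write e) s 1 { s with out := s.out ++ [e.eval s] }
  | seq {s s' s'' : St} {c₁ c₂ : Cmd} {t₁ t₂ : ℕ} (h₁ : Ev L c₁ s t₁ s')
      (h₂ : Ev L c₂ s' t₂ s'') : Ev L (.seq c₁ c₂) s (t₁ + t₂) s''
  | iteTrue {s s' : St} {e : Expr} {c₁ c₂ : Cmd} {t : ℕ} (he : e.eval s ≠ 0)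
      (h : Ev L c₁ s t s') : Ev L (.ite e c₁ c₂) s (t + 1) s'
  | iteFalse {s s' : St} {e : Expr} {c₁ c₂ : Cmd} {t : ℕ} (he : e.eval s = 0)
      (h : Ev L c₂ s t s') : Ev L (.ite e c₁ c₂) s (t + 1) s'
  | loopEnd {s : St} {e : Expr} {c : Cmd} (he : e.eval s = 0) : Ev L (.loop e c) s 1 s
  | loopStep {s s' s'' : St} {e : Expr} {c : Cmd} {t t' : ℕ} (he : e.eval s ≠ 0)
      (h : Ev L c s t s') (h' : Ev L (.loop e c) s' t' s'') :
      Ev L (.loop e c) s (t + t' + 1) s''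

namespace Cmd

def deg : Cmd → ℕ
  | skip => 0
  | assign _ e => e.deg
  | store _ i e => i.deg + e.deg + 2
  | read _ => 1
  | write e => e.deg
  | seq c₁ c₂ => c₁.deg + c₂.deg
  | ite e c₁ c₂ => e.deg + c₁.deg + c₂.deg
  | loop e c => e.deg + c.deg

def litBound : Cmd → ℕ
  | skip => 0
  | assign _ e => e.litBound
  | store _ i e => i.litBound + e.litBound
  | read _ => 0
  | write e => e.litBound
  | seq c₁ c₂ => c₁.litBound + c₂.litBound
  | ite e c₁ c₂ => e.litBound + c₁.litBound + c₂.litBound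
  | loop e c => e.litBound + c.litBound

/-- The first register that is used for temporary values. -/
abbrev tmp : ℕ := 20

/-- The length of the code of a command. -/
def len : Cmd → ℕ
  | skip => 0
  | assign _ e => (e.comp tmp).length + 2
  | store _ i e => (i.comp tmp).length + ((e.comp (tmp + 1)).length + 5)
  | read _ => 1
  | write e => (e.comp tmp).length + 1
  | seq c₁ c₂ => c₁.len + c₂.len
  | ite e c₁ c₂ => (e.comp tmp).length + (1 + (c₁.len + (1 + c₂.len)))
  | loop e c => (e.comp tmp).length + (1 + (c.len + 1))

/-- The code of a command that is placed at position `p`. -/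
def comp : Cmd → ℕ → List RAM.Instr
  | skip, _ => []
  | assign x e, _ => e.comp tmp ++ [.const (tmp + 1) 0, .op .add x.ctorIdx tmp (tmp + 1)]
  | store a i e, _ => i.comp tmp ++ (e.comp (tmp + 1) ++
      [.const (tmp + 2) 16, .op .mul tmp tmp (tmp + 2), .const (tmp + 2) a.ctorIdx,
        .op .add tmp tmp (tmp + 2), .store tmp (tmp + 1)])
  | read x, _ => [.read x.ctorIdx]
  | write e, _ => e.comp tmp ++ [.write tmp]
  | seq c₁ c₂, p => c₁.comp p ++ c₂.comp (p + c₁.len)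
  | ite e c₁ c₂, p =>
      let q := p + (e.comp tmp).length
      e.comp tmp ++ (.jumpZero tmp (q + 1 + c₁.len + 1) :: (c₁.comp (q + 1) ++
        (.jump (q + 1 + c₁.len + 1 + c₂.len) :: c₂.comp (q + 1 + c₁.len + 1))))
  | loop e c, p =>
      let q := p + (e.comp tmp).length
      e.comp tmp ++ (.jumpZero tmp (q + 1 + c.len + 1) :: (c.comp (q + 1) ++ [.jump p]))

/-- The position affects jump targets but not the length, so `comp` can use `len` to compute forward
targets before the code there is laid out. -/
theorem length_comp (c : Cmd) (p : ℕ) : (c.comp p).length = c.len := by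
  induction c generalizing p with
  | skip => rfl
  | assign x e => simp [comp, len]
  | store a i e => simp [comp, len]
  | read x => rfl
  | write e => simp [comp, len]
  | seq c₁ c₂ h₁ h₂ => simp [comp, len, h₁, h₂]
  | ite e c₁ c₂ h₁ h₂ => simp [comp, len, h₁, h₂]; omega
  | loop e c h => simp [comp, len, h]; omega

end Cmd

/-! ### Runs of machine code -/

open RAM

/-- `Reach P σ T σ'`: from `σ` the machine reaches `σ'` in time at most `T`. -/
def Reach (P : Program) (σ : Config) (T : ℕ) (σ' : Config) : Prop :=
  ∀ t σ'', Runs P σ' t σ'' → ∃ t' ≤ T, Runs P σ (t' + t) σ''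

theorem Reach.refl (P : Program) (σ : Config) (T : ℕ) : Reach P σ T σ :=
  fun t σ'' h => ⟨0, Nat.zero_le _, by simpa using h⟩

theorem Reach.trans {P : Program} {σ σ' σ'' : Config} {T T' : ℕ} (h : Reach P σ T σ')
    (h' : Reach P σ' T' σ'') : Reach P σ (T + T') σ'' := by
  intro t τ hr
  obtain ⟨t₁, h₁, hr₁⟩ := h' t τ hr
  obtain ⟨t₂, h₂, hr₂⟩ := h _ τ hr₁
  exact ⟨t₂ + t₁, by omega, by rwa [add_assoc]⟩

theorem Reach.mono {P : Program} {σ σ' : Config} {T T' : ℕ} (h : Reach P σ T σ')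
    (hT : T ≤ T') : Reach P σ T' σ' := by
  intro t τ hr
  obtain ⟨t₁, h₁, hr₁⟩ := h t τ hr
  exact ⟨t₁, by omega, hr₁⟩

theorem Reach.single {P : Program} {σ : Config} {I : Instr} {T : ℕ}
    (h : P[σ.pc]? = some I) (hT : I.cost σ ≤ T) : Reach P σ T (I.exec σ) :=
  fun _ _ hr => ⟨_, hT, .step _ _ I _ h hr⟩

/-- The code `c` stands in `P` at position `p`. -/
def CodeAt (P : Program) (p : ℕ) (l : List Instr) : Prop :=
  ∀ i < l.length, P[p + i]? = l[i]?

theorem codeAt_append {P : Program} {p : ℕ} {c c' : List Instr} :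
    CodeAt P p (c ++ c') ↔ CodeAt P p c ∧ CodeAt P (p + c.length) c' := by
  constructor
  · intro h
    refine ⟨fun i hi => ?_, fun i hi => ?_⟩
    · rw [h i (by simp; omega), List.getElem?_append_left hi]
    · have := h (c.length + i) (by simp; omega)
      rw [add_assoc, this, List.getElem?_append_right (by omega)]
      simp
  · rintro ⟨h, h'⟩ i hi
    by_cases hc : i < c.length
    · rw [h i hc, List.getElem?_append_left hc]
    · have := h' (i - c.length) (by simp at hi; omega)
      rw [List.getElem?_append_right (by omega), ← this]
      congr 1; omega

theorem codeAt_cons {P : Program} {p : ℕ} {I : Instr} {c : List Instr} :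
    CodeAt P p (I :: c) ↔ P[p]? = some I ∧ CodeAt P (p + 1) c := by
  rw [← List.singleton_append, codeAt_append]
  simp [CodeAt]

/-- Machine configuration `σ` represents the state `s`. -/
structure Rep (s : St) (σ : Config) : Prop where
  reg : ∀ x : Var, σ.reg x.ctorIdx = s.var x
  mem : ∀ (a : Arr) i, σ.mem (i * 16 + a.ctorIdx) = s.arr a i
  inp : σ.input = s.inp
  out : σ.output = s.out

theorem Var.ctorIdx_lt (x : Var) : x.ctorIdx < Cmd.tmp := by cases x <;> decide
theorem Arr.ctorIdx_lt (a : Arr) : a.ctorIdx < 16 := by cases a <;> decide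
theorem Var.ctorIdx_inj {x y : Var} (h : x.ctorIdx = y.ctorIdx) : x = y := by
  cases x <;> cases y <;> first | rfl | cases h
theorem Arr.ctorIdx_inj {x y : Arr} (h : x.ctorIdx = y.ctorIdx) : x = y := by
  cases x <;> cases y <;> first | rfl | cases h

theorem size_add_size_le {a b X : ℕ} (ha : a ≤ X) (hb : b ≤ X) :
    1 + a.size + b.size ≤ (1 + X.size) * (1 + X.size) := by
  have := Nat.size_le_size ha
  have := Nat.size_le_size hb
  nlinarith

theorem size_mul_size_le {a b X : ℕ} (ha : a ≤ X) (hb : b ≤ X) :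
    (1 + a.size) * (1 + b.size) ≤ (1 + X.size) * (1 + X.size) := by
  have := Nat.size_le_size ha
  have := Nat.size_le_size hb
  gcongr

theorem Op.cost_le (o : Op) {a b X : ℕ} (ha : a ≤ X) (hb : b ≤ X) :
    o.cost a b ≤ (1 + X.size) * (1 + X.size) := by
  cases o
  · exact size_add_size_le ha hb
  · exact size_add_size_le ha hb
  all_goals exact size_mul_size_le ha hb

theorem size_succ_le {a X : ℕ} (ha : a ≤ X) :
    1 + a.size ≤ (1 + X.size) * (1 + X.size) := by
  simpa using size_add_size_le ha (Nat.zero_le X)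

theorem Expr.one_le_deg (e : Expr) : 1 ≤ e.deg := by
  induction e with
  | lit => exact le_rfl
  | var => exact le_rfl
  | op o e₁ e₂ h₁ h₂ => simp only [deg]; omega
  | get a e h => simp only [deg]; omega

/-- Interleaving multiplies by 16 and adds less than 16, which two further factors `L ≥ 16` absorb.
This is the `+ 2` in the degree of an array access. -/
theorem addr_le {L i d : ℕ} (hL : 16 ≤ L) (hi : i ≤ L ^ d) (a : Arr) :
    i * 16 + a.ctorIdx ≤ L ^ (d + 2) := by
  have := a.ctorIdx_lt
  have h1 : 1 ≤ L ^ d := Nat.one_le_pow _ _ (by omega)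
  have : L ^ (d + 2) = L ^ d * (L * L) := by ring
  have : 16 * 16 ≤ L * L := Nat.mul_le_mul hL hL
  nlinarith

/-- Degrees add under every operation: products are the extreme case, and a sum of two numbers
bounded by powers that are at least 2 is at most the product of the bounds. Intermediate values may
thus exceed `L`, but only polynomially. -/
theorem Expr.eval_le {L : ℕ} (hL : 16 ≤ L) {s : St} (hs : s.Bdd L) (e : Expr)
    (he : e.litBound ≤ L) : e.eval s ≤ L ^ e.deg := by
  induction e with
  | lit v => simpa [deg, litBound] using he
  | var x => simpa [deg] using hs.1 x
  | op o e₁ e₂ h₁ h₂ =>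
    simp only [litBound] at he
    have h₁ := h₁ (by omega)
    have h₂ := h₂ (by omega)
    have hp : ∀ e : Expr, 2 ≤ L ^ e.deg := fun e =>
      (show 2 ≤ L by omega).trans (Nat.le_self_pow (by have := e.one_le_deg; omega) L)
    have g₁ := hp e₁
    have g₂ := hp e₂
    simp only [eval, deg, pow_add]
    have : L ^ e₁.deg ≤ L ^ e₁.deg * L ^ e₂.deg := Nat.le_mul_of_pos_right _ (by omega)
    cases o
    · simp only [Op.eval]; nlinarith
    · simp only [Op.eval]; omega
    · exact Nat.mul_le_mul h₁ h₂
    · exact (Nat.div_le_self _ _).trans (h₁.trans this)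
    · exact (Nat.mod_le _ _).trans (h₁.trans this)
  | get a e h => exact (hs.2.1 _ _).trans (Nat.le_self_pow (by simp [deg]) L)

/-- Cost of one machine instruction on values up to `X`. -/
abbrev unitCost (X : ℕ) : ℕ := (1 + X.size) * (1 + X.size)

/-- Registers from `d` upwards serve as an evaluation stack. Registers below `d`, among them all
program variables and pending operands, are preserved; that is what the induction for binary
operations needs. -/
theorem reach_expr {P : Program} {L X : ℕ} (hL : 16 ≤ L) {s : St} (hs : s.Bdd L) (e : Expr)
    (he : e.litBound ≤ L) (hX : L ^ e.deg ≤ X) (d : ℕ) (hd : Cmd.tmp ≤ d) (σ : Config)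
    (hσ : Rep s σ) (hc : CodeAt P σ.pc (e.comp d)) :
    ∃ σ', Reach P σ ((e.comp d).length * unitCost X) σ' ∧ Rep s σ' ∧
      σ'.pc = σ.pc + (e.comp d).length ∧ σ'.reg d = e.eval s ∧
      ∀ r < d, σ'.reg r = σ.reg r := by
  induction e generalizing d σ with
  | lit v =>
    simp only [Expr.comp, codeAt_cons] at hc
    refine ⟨_, (Reach.single hc.1 ?_), ⟨fun x => ?_, hσ.mem, hσ.inp, hσ.out⟩, rfl, ?_, ?_⟩
    · simp only [Instr.cost, Expr.comp, List.length_singleton, one_mul]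
      exact size_succ_le (le_trans he (le_trans (by simp [Expr.deg]) hX))
    · have := x.ctorIdx_lt
      simp [Instr.exec, Function.update_apply, show x.ctorIdx ≠ d by omega, hσ.reg]
    · simp [Instr.exec]
    · intro r hr
      simp [Instr.exec, Function.update_apply, show r ≠ d by omega]
  | var x =>
    simp only [Expr.comp, codeAt_cons] at hc
    have hx := x.ctorIdx_lt
    refine ⟨_, ((Reach.single (T := unitCost X) hc.1 ?_).trans
      (Reach.single (T := unitCost X) hc.2.1 ?_)).mono ?_,
      ⟨fun y => ?_, hσ.mem, hσ.inp, hσ.out⟩, rfl, ?_, ?_⟩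
    · exact size_succ_le (Nat.zero_le _)
    · refine Op.cost_le (.add) (X := X) ?_ ?_
      · simp [Instr.exec, Function.update_apply, show x.ctorIdx ≠ d by omega, hσ.reg]
        exact (hs.1 x).trans (le_trans (by simp [Expr.deg]) hX)
      · simp [Instr.exec]
    · simp only [Expr.comp, List.length_cons, List.length_nil]; omega
    · have := y.ctorIdx_lt
      simp [Instr.exec, Function.update_apply, show y.ctorIdx ≠ d by omega, hσ.reg]
    · simp [Instr.exec, Function.update_apply, show x.ctorIdx ≠ d by omega, hσ.reg, Op.eval]
    · intro r hr
      simp [Instr.exec, Function.update_apply, show r ≠ d by omega]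
  | op o e₁ e₂ h₁ h₂ =>
    simp only [Expr.comp, codeAt_append, codeAt_cons] at hc
    simp only [Expr.litBound] at he
    have hp : ∀ k, 1 ≤ L ^ k := fun k => Nat.one_le_pow _ _ (by omega)
    have hX₁ : L ^ e₁.deg ≤ X :=
      (Nat.pow_le_pow_right (by omega) (by simp [Expr.deg])).trans hX
    have hX₂ : L ^ e₂.deg ≤ X :=
      (Nat.pow_le_pow_right (by omega) (by simp [Expr.deg])).trans hX
    obtain ⟨σ₁, r₁, R₁, p₁, v₁, k₁⟩ := h₁ (by omega) hX₁ d hd σ hσ hc.1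
    obtain ⟨σ₂, r₂, R₂, p₂, v₂, k₂⟩ := h₂ (by omega) hX₂ (d + 1) (by omega) σ₁ R₁
      (by rw [p₁]; exact hc.2.1)
    have v₁' : σ₂.reg d = e₁.eval s := by rw [k₂ d (by omega), v₁]
    have hI : P[σ₂.pc]? = some (Instr.op o d d (d + 1)) := by rw [p₂, p₁]; exact hc.2.2.1
    refine ⟨_, ((r₁.trans r₂).trans (Reach.single (T := unitCost X) hI ?_)).mono ?_,
      ⟨fun y => ?_, R₂.mem, R₂.inp, R₂.out⟩, ?_, ?_, ?_⟩
    · refine Op.cost_le o (X := X) ?_ ?_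
      · rw [v₁']; exact (e₁.eval_le hL hs (by omega)).trans hX₁
      · rw [v₂]; exact (e₂.eval_le hL hs (by omega)).trans hX₂
    · simp only [Expr.comp, List.length_append, List.length_cons, List.length_nil]
      apply le_of_eq; ring
    · have := y.ctorIdx_lt
      simp [Instr.exec, Function.update_apply, show y.ctorIdx ≠ d by omega, R₂.reg]
    · simp [Instr.exec, p₂, p₁, Expr.comp]; omega
    · simp [Instr.exec, v₁', v₂, Expr.eval]
    · intro r hr
      simp [Instr.exec, Function.update_apply, show r ≠ d by omega, k₂ r (by omega), k₁ r hr]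
  | get a e h =>
    simp only [Expr.comp, codeAt_append, codeAt_cons] at hc
    simp only [Expr.litBound] at he
    have hX₁ : L ^ e.deg ≤ X :=
      (Nat.pow_le_pow_right (by omega) (by simp [Expr.deg])).trans hX
    obtain ⟨σ₁, r₁, R₁, p₁, v₁, k₁⟩ := h (by omega) hX₁ d hd σ hσ hc.1
    obtain ⟨hc0, hc1, hc2, hc3, hc4, hc5, -⟩ := hc
    rw [← p₁] at hc1 hc2 hc3 hc4 hc5
    have hv := e.eval_le hL hs he
    have hadr : e.eval s * 16 + a.ctorIdx ≤ X := (addr_le hL hv a).trans hX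
    have ha := a.ctorIdx_lt
    have hLX : L ≤ X := le_trans (Nat.le_self_pow (by simp [Expr.deg]) L) hX
    refine ⟨_, (r₁.trans ((Reach.single (T := unitCost X) (I := .const (d + 1) 16) hc1 ?_).trans
      ((Reach.single (T := unitCost X) (I := .op .mul d d (d + 1)) hc2 ?_).trans
      ((Reach.single (T := unitCost X) (I := .const (d + 1) a.ctorIdx) hc3 ?_).trans
      ((Reach.single (T := unitCost X) (I := .op .add d d (d + 1)) hc4 ?_).trans
      (Reach.single (T := unitCost X) (I := .load d d) hc5 ?_)))))).mono ?_,
      ⟨fun y => ?_, R₁.mem, R₁.inp, R₁.out⟩, ?_, ?_, ?_⟩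
    · exact size_succ_le (by omega)
    · refine Op.cost_le .mul (X := X) ?_ ?_ <;>
        simp [Instr.exec, Function.update_apply, v₁] <;> omega
    · exact size_succ_le (by omega)
    · refine Op.cost_le .add (X := X) ?_ ?_ <;> simp [Instr.exec, Function.update_apply, v₁, Op.eval] <;> omega
    · simp [Instr.exec, Function.update_apply, v₁, Op.eval, Instr.cost, R₁.mem]
      exact size_add_size_le hadr ((hs.2.1 _ _).trans hLX)
    · simp only [Expr.comp, List.length_append, List.length_cons, List.length_nil]
      apply le_of_eq; ring
    · have := y.ctorIdx_lt
      simp [Instr.exec, Function.update_apply, show y.ctorIdx ≠ d by omega,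
        show y.ctorIdx ≠ d + 1 by omega, R₁.reg]
    · simp [Instr.exec, p₁, Expr.comp]; omega
    · simp [Instr.exec, v₁, Expr.eval, Op.eval, R₁.mem]
    · intro r hr
      simp [Instr.exec, Function.update_apply, show r ≠ d by omega, show r ≠ d + 1 by omega,
        k₁ r hr]

theorem Ev.bdd {L : ℕ} {c : Cmd} {s s' : St} {t : ℕ} (h : Ev L c s t s') (hs : s.Bdd L) :
    s'.Bdd L := by
  induction h with
  | skip => exact hs
  | assign s x e h =>
    refine ⟨fun y => ?_, hs.2⟩
    simp only [St.setVar, Function.update_apply]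
    split
    · exact h
    · exact hs.1 y
  | store s a i e h =>
    refine ⟨hs.1, fun b k => ?_, hs.2.2⟩
    simp only [St.setArr, Function.update_apply]
    split
    · simp only [Function.update_apply]
      split
      · exact h
      · exact hs.2.1 a k
    · exact hs.2.1 b k
  | read s x =>
    refine ⟨fun y => ?_, hs.2.1, fun v hv => hs.2.2 v (List.mem_of_mem_tail hv)⟩
    simp only [St.setVar, Function.update_apply]
    split
    · rcases hi : s.inp with _ | ⟨v, l⟩
      · simp
      · exact hs.2.2 v (by simp [hi])
    · exact hs.1 y
  | write => exact hs
  | seq _ _ h₁ h₂ => exact h₂ (h₁ hs)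
  | iteTrue _ _ h => exact h hs
  | iteFalse _ _ h => exact h hs
  | loopEnd => exact hs
  | loopStep _ _ _ h₁ h₂ => exact h₂ (h₁ hs)

/-- One unit step executes a straight piece of the code, hence at most `G` instructions, each
handling numbers up to `X`. The number `G` is a constant of the program, so only `unitCost X`
depends on the input. -/
theorem reach_cmd {P : Program} {L X G : ℕ} (hL : 16 ≤ L) {c : Cmd} {s s' : St} {t : ℕ}
    (h : Ev L c s t s') (hs : s.Bdd L) (hlit : c.litBound ≤ L) (hX : L ^ c.deg ≤ X)
    (hG : c.len ≤ G) (σ : Config) (hσ : Rep s σ) (hc : CodeAt P σ.pc (c.comp σ.pc)) :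
    ∃ σ', Reach P σ (t * (G * unitCost X)) σ' ∧ Rep s' σ' ∧ σ'.pc = σ.pc + c.len := by
  have mono : ∀ {a b : ℕ}, a ≤ b → L ^ b ≤ X → L ^ a ≤ X := fun h h' =>
    (Nat.pow_le_pow_right (by omega) h).trans h'
  induction h generalizing σ with
  | skip s => exact ⟨σ, .refl _ _ _, hσ, rfl⟩
  | assign s x e h =>
    simp only [Cmd.comp, codeAt_append, codeAt_cons] at hc
    simp only [Cmd.litBound] at hlit
    simp only [Cmd.deg] at hX
    obtain ⟨σ₁, r₁, R₁, p₁, v₁, k₁⟩ := reach_expr hL hs e hlit hX Cmd.tmp le_rfl σ hσ hc.1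
    obtain ⟨-, hc1, hc2, -⟩ := hc
    rw [← p₁] at hc1 hc2
    have hx := x.ctorIdx_lt
    refine ⟨_, (r₁.trans ((Reach.single (T := unitCost X) (I := .const (Cmd.tmp + 1) 0)
      hc1 ?_).trans (Reach.single (T := unitCost X)
        (I := .op .add x.ctorIdx Cmd.tmp (Cmd.tmp + 1)) hc2 ?_))).mono ?_,
      ⟨fun y => ?_, R₁.mem, R₁.inp, R₁.out⟩, ?_⟩
    · exact size_succ_le (by omega)
    · refine Op.cost_le .add (X := X) ?_ ?_
      · simp [Instr.exec, Function.update_apply, v₁]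
        exact e.eval_le hL hs hlit |>.trans hX
      · simp [Instr.exec]
    · simp only [Cmd.len] at hG
      calc _ = ((e.comp Cmd.tmp).length + 2) * unitCost X := by ring
        _ ≤ _ := by rw [one_mul]; gcongr
    · have hy := y.ctorIdx_lt
      by_cases hxy : y = x
      · subst hxy
        simp [Instr.exec, St.setVar, Op.eval, v₁]
      · have : y.ctorIdx ≠ x.ctorIdx := fun h => hxy (Var.ctorIdx_inj h)
        simp [Instr.exec, St.setVar, hxy, this, R₁.reg,
          show y.ctorIdx ≠ Cmd.tmp + 1 by omega]
    · simp [Instr.exec, p₁, Cmd.len]; omega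
  | store s a i e h =>
    simp only [Cmd.comp, codeAt_append, codeAt_cons] at hc
    simp only [Cmd.litBound] at hlit
    simp only [Cmd.deg] at hX
    obtain ⟨σ₁, r₁, R₁, p₁, v₁, k₁⟩ := reach_expr hL hs i (by omega) (mono (by omega) hX)
      Cmd.tmp le_rfl σ hσ hc.1
    obtain ⟨σ₂, r₂, R₂, p₂, v₂, k₂⟩ := reach_expr hL hs e (by omega) (mono (by omega) hX)
      (Cmd.tmp + 1) (by omega) σ₁ R₁ (by rw [p₁]; exact hc.2.1)
    have v₁' : σ₂.reg Cmd.tmp = i.eval s := by rw [k₂ _ (by omega), v₁]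
    obtain ⟨-, -, hc1, hc2, hc3, hc4, hc5, -⟩ := hc
    rw [← p₁, ← p₂] at hc1 hc2 hc3 hc4 hc5
    have hv := i.eval_le hL hs (by omega)
    have hadr : i.eval s * 16 + a.ctorIdx ≤ X := (addr_le hL hv a).trans (mono (by omega) hX)
    have hev : e.eval s ≤ X := (e.eval_le hL hs (by omega)).trans (mono (by omega) hX)
    have ha := a.ctorIdx_lt
    have hLX : L ≤ X := by
      have := mono (show 1 ≤ i.deg + e.deg + 2 by omega) hX
      simpa using this
    refine ⟨_, (r₁.trans (r₂.trans
      ((Reach.single (T := unitCost X) (I := .const (Cmd.tmp + 2) 16) hc1 ?_).trans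
      ((Reach.single (T := unitCost X) (I := .op .mul Cmd.tmp Cmd.tmp (Cmd.tmp + 2)) hc2 ?_).trans
      ((Reach.single (T := unitCost X) (I := .const (Cmd.tmp + 2) a.ctorIdx) hc3 ?_).trans
      ((Reach.single (T := unitCost X) (I := .op .add Cmd.tmp Cmd.tmp (Cmd.tmp + 2)) hc4 ?_).trans
      (Reach.single (T := unitCost X) (I := .store Cmd.tmp (Cmd.tmp + 1)) hc5 ?_))))))).mono ?_,
      ⟨fun y => ?_, fun b k => ?_, R₂.inp, R₂.out⟩, ?_⟩
    · exact size_succ_le (by omega)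
    · refine Op.cost_le .mul (X := X) ?_ ?_ <;>
        simp [Instr.exec, Function.update_apply, v₁'] <;> omega
    · exact size_succ_le (by omega)
    · refine Op.cost_le .add (X := X) ?_ ?_ <;>
        simp [Instr.exec, Function.update_apply, v₁', Op.eval] <;> omega
    · simp [Instr.exec, Function.update_apply, v₁', v₂, Op.eval, Instr.cost]
      exact size_add_size_le hadr hev
    · simp only [Cmd.len] at hG
      calc _ = ((i.comp Cmd.tmp).length + ((e.comp (Cmd.tmp + 1)).length + 5)) * unitCost X := by
            ring
        _ ≤ _ := by rw [one_mul]; gcongr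
    · have hy := y.ctorIdx_lt
      simp [Instr.exec, Function.update_apply, show y.ctorIdx ≠ Cmd.tmp by omega,
        show y.ctorIdx ≠ Cmd.tmp + 2 by omega, R₂.reg, St.setArr]
    · have hb := b.ctorIdx_lt
      simp only [Instr.exec, Function.update_self, v₁', v₂, Op.eval, St.setArr, ne_eq,
        Function.update_apply, R₂.mem]
      by_cases hab : b = a
      · subst hab
        by_cases hk : k = i.eval s
        · simp [hk, v₁', v₂]
        · simp [hk, v₁', R₂.mem]
      · have : b.ctorIdx ≠ a.ctorIdx := fun h => hab (Arr.ctorIdx_inj h)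
        simp [hab, R₂.mem]
        omega
    · simp [Instr.exec, p₁, p₂, Cmd.len]; omega
  | read s x =>
    simp only [Cmd.comp, codeAt_cons] at hc
    have hx := x.ctorIdx_lt
    have hLX : L ≤ X := by simpa [Cmd.deg] using hX
    refine ⟨_, (Reach.single hc.1 (T := unitCost X) ?_).mono ?_,
      ⟨fun y => ?_, hσ.mem, ?_, hσ.out⟩, rfl⟩
    · rw [Instr.cost, hσ.inp]
      refine size_succ_le ?_
      rcases hi : s.inp with _ | ⟨v, l⟩
      · simp
      · exact (hs.2.2 v (by simp [hi])).trans hLX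
    · simp only [Cmd.len] at hG
      nlinarith
    · by_cases hxy : y = x
      · subst hxy
        simp [Instr.exec, St.setVar, hσ.inp]
      · have : y.ctorIdx ≠ x.ctorIdx := fun h => hxy (Var.ctorIdx_inj h)
        simp [Instr.exec, St.setVar, hxy, this, hσ.reg]
    · simp [Instr.exec, hσ.inp]
  | write s e =>
    simp only [Cmd.comp, codeAt_append, codeAt_cons] at hc
    simp only [Cmd.litBound] at hlit
    simp only [Cmd.deg] at hX
    obtain ⟨σ₁, r₁, R₁, p₁, v₁, k₁⟩ := reach_expr hL hs e hlit hX Cmd.tmp le_rfl σ hσ hc.1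
    obtain ⟨-, hc1, -⟩ := hc
    rw [← p₁] at hc1
    refine ⟨_, (r₁.trans (Reach.single (T := unitCost X) hc1 ?_)).mono ?_,
      ⟨R₁.reg, R₁.mem, R₁.inp, ?_⟩, ?_⟩
    · rw [Instr.cost, v₁]
      exact size_succ_le ((e.eval_le hL hs hlit).trans hX)
    · simp only [Cmd.len] at hG
      calc _ = ((e.comp Cmd.tmp).length + 1) * unitCost X := by ring
        _ ≤ _ := by rw [one_mul]; gcongr
    · simp [Instr.exec, R₁.out, v₁]
    · simp [Instr.exec, p₁, Cmd.len]; omega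
  | @seq s s₁ s₂ c₁ c₂ t₁ t₂ g₁ g₂ h₁ h₂ =>
    simp only [Cmd.comp, codeAt_append, Cmd.length_comp] at hc
    simp only [Cmd.litBound] at hlit
    simp only [Cmd.deg] at hX
    simp only [Cmd.len] at hG
    obtain ⟨σ₁, r₁, R₁, p₁⟩ := h₁ hs (by omega) (mono (by omega) hX) (by omega) σ hσ hc.1
    obtain ⟨σ₂, r₂, R₂, p₂⟩ := h₂ (g₁.bdd hs) (by omega) (mono (by omega) hX) (by omega) σ₁ R₁
      (by rw [p₁]; exact hc.2)
    exact ⟨σ₂, (r₁.trans r₂).mono (by rw [add_mul]), R₂, by rw [p₂, p₁, Cmd.len, add_assoc]⟩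
  | @iteTrue s s₁ e c₁ c₂ t he g h =>
    simp only [Cmd.comp, codeAt_append, codeAt_cons, Cmd.length_comp] at hc
    simp only [Cmd.litBound] at hlit
    simp only [Cmd.deg] at hX
    simp only [Cmd.len] at hG
    have hXe := mono (show e.deg ≤ e.deg + c₁.deg + c₂.deg by omega) hX
    obtain ⟨σ₁, r₁, R₁, p₁, v₁, k₁⟩ := reach_expr hL hs e (by omega) hXe
      Cmd.tmp le_rfl σ hσ hc.1
    obtain ⟨-, hc1, hc2, hc3, hc4⟩ := hc
    rw [← p₁] at hc1 hc2 hc3 hc4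
    have hj := Reach.single (T := unitCost X) hc1
      (by rw [Instr.cost, v₁]; exact size_succ_le ((e.eval_le hL hs (by omega)).trans hXe))
    simp only [Instr.exec, v₁, if_neg he] at hj
    obtain ⟨σ₂, r₂, R₂, p₂⟩ := h hs (by omega) (mono (by omega) hX) (by omega)
      { σ₁ with pc := σ₁.pc + 1 } ⟨R₁.reg, R₁.mem, R₁.inp, R₁.out⟩ hc2
    simp only at p₂
    have hI := (congrArg (P[·]?) p₂).trans hc3
    refine ⟨_, (r₁.trans (hj.trans (r₂.trans (Reach.single (T := unitCost X) hI
      (size_succ_le (Nat.zero_le _)))))).mono ?_, ⟨R₂.reg, R₂.mem, R₂.inp, R₂.out⟩, ?_⟩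
    · calc _ = ((e.comp Cmd.tmp).length + 2) * unitCost X + t * (G * unitCost X) := by ring
        _ ≤ G * unitCost X + t * (G * unitCost X) := by gcongr; omega
        _ = _ := by ring
    · simp only [Instr.exec, Cmd.len, p₁]; omega
  | @iteFalse s s₁ e c₁ c₂ t he g h =>
    simp only [Cmd.comp, codeAt_append, codeAt_cons, Cmd.length_comp] at hc
    simp only [Cmd.litBound] at hlit
    simp only [Cmd.deg] at hX
    simp only [Cmd.len] at hG
    have hXe := mono (show e.deg ≤ e.deg + c₁.deg + c₂.deg by omega) hX
    obtain ⟨σ₁, r₁, R₁, p₁, v₁, k₁⟩ := reach_expr hL hs e (by omega) hXe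
      Cmd.tmp le_rfl σ hσ hc.1
    obtain ⟨-, hc1, hc2, hc3, hc4⟩ := hc
    rw [← p₁] at hc1 hc2 hc3 hc4
    have hj := Reach.single (T := unitCost X) hc1
      (by rw [Instr.cost, v₁]; exact size_succ_le ((e.eval_le hL hs (by omega)).trans hXe))
    simp only [Instr.exec, v₁, if_pos he] at hj
    obtain ⟨σ₂, r₂, R₂, p₂⟩ := h hs (by omega) (mono (by omega) hX) (by omega)
      { σ₁ with pc := σ₁.pc + 1 + c₁.len + 1 } ⟨R₁.reg, R₁.mem, R₁.inp, R₁.out⟩ hc4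
    simp only at p₂
    refine ⟨_, (r₁.trans (hj.trans r₂)).mono ?_, R₂, ?_⟩
    · calc _ = ((e.comp Cmd.tmp).length + 1) * unitCost X + t * (G * unitCost X) := by ring
        _ ≤ G * unitCost X + t * (G * unitCost X) := by gcongr; omega
        _ = _ := by ring
    · simp only [Cmd.len, p₁, p₂]; omega
  | @loopEnd s e c he =>
    simp only [Cmd.comp, codeAt_append, codeAt_cons, Cmd.length_comp] at hc
    simp only [Cmd.litBound] at hlit
    simp only [Cmd.deg] at hX
    simp only [Cmd.len] at hG
    have hXe := mono (show e.deg ≤ e.deg + c.deg by omega) hX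
    obtain ⟨σ₁, r₁, R₁, p₁, v₁, k₁⟩ := reach_expr hL hs e (by omega) hXe
      Cmd.tmp le_rfl σ hσ hc.1
    obtain ⟨-, hc1, hc2, hc3⟩ := hc
    rw [← p₁] at hc1
    have hj := Reach.single (T := unitCost X) hc1
      (by rw [Instr.cost, v₁]; exact size_succ_le ((e.eval_le hL hs (by omega)).trans hXe))
    simp only [Instr.exec, v₁, if_pos he] at hj
    refine ⟨_, (r₁.trans hj).mono ?_, ⟨R₁.reg, R₁.mem, R₁.inp, R₁.out⟩, ?_⟩
    · calc _ = ((e.comp Cmd.tmp).length + 1) * unitCost X := by ring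
        _ ≤ _ := by rw [one_mul]; gcongr; omega
    · simp only [Cmd.len]; omega
  | @loopStep s s₁ s₂ e c t t' he g g' h h' =>
    have hc' := hc
    have hlit' := hlit
    have hX' := hX
    simp only [Cmd.comp, codeAt_append, codeAt_cons, Cmd.length_comp] at hc
    simp only [Cmd.litBound] at hlit
    simp only [Cmd.deg] at hX
    have hG' := hG
    simp only [Cmd.len] at hG
    have hXe := mono (show e.deg ≤ e.deg + c.deg by omega) hX
    obtain ⟨σ₁, r₁, R₁, p₁, v₁, k₁⟩ := reach_expr hL hs e (by omega) hXe
      Cmd.tmp le_rfl σ hσ hc.1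
    obtain ⟨-, hc1, hc2, hc3, -⟩ := hc
    rw [← p₁] at hc1 hc2 hc3
    have hj := Reach.single (T := unitCost X) hc1
      (by rw [Instr.cost, v₁]; exact size_succ_le ((e.eval_le hL hs (by omega)).trans hXe))
    simp only [Instr.exec, v₁, if_neg he] at hj
    obtain ⟨σ₂, r₂, R₂, p₂⟩ := h hs (by omega) (mono (by omega) hX) (by omega)
      { σ₁ with pc := σ₁.pc + 1 } ⟨R₁.reg, R₁.mem, R₁.inp, R₁.out⟩ hc2
    simp only at p₂
    have hI := (congrArg (P[·]?) p₂).trans hc3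
    obtain ⟨σ₃, r₃, R₃, p₃⟩ := h' (g.bdd hs) hlit' hX' hG'
      { σ₂ with pc := σ.pc } ⟨R₂.reg, R₂.mem, R₂.inp, R₂.out⟩ hc'
    refine ⟨σ₃, (r₁.trans (hj.trans (r₂.trans ((Reach.single (T := unitCost X) hI
      (size_succ_le (Nat.zero_le _))).trans r₃)))).mono ?_, R₃, p₃⟩
    -- The test, the conditional jump and the jump back are all part of the loop's own code, so the
    -- one unit step charged per round pays for them.
    calc _ = ((e.comp Cmd.tmp).length + 2) * unitCost X + t * (G * unitCost X)
          + t' * (G * unitCost X) := by ring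
      _ ≤ G * unitCost X + t * (G * unitCost X) + t' * (G * unitCost X) := by gcongr; omega
      _ = _ := by ring

/-- The initial state of the structured language. -/
def St.init (input : List ℕ) : St where
  var := fun _ => 0
  arr := fun _ _ => 0
  inp := input
  out := []

theorem outputsInTime_of_ev {L : ℕ} (hL : 16 ≤ L) {c : Cmd} {input : List ℕ} {t T : ℕ} {s' : St}
    (h : Ev L c (.init input) t s') (hin : ∀ v ∈ input, v ≤ L) (hlit : c.litBound ≤ L)
    (hT : t * (c.len * unitCost (L ^ c.deg)) ≤ T) :
    OutputsInTime (c.comp 0) input s'.out T := by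
  obtain ⟨σ, r, R, p⟩ := reach_cmd (P := c.comp 0) hL h
    ⟨fun _ => Nat.zero_le _, fun _ _ => Nat.zero_le _, hin⟩ hlit le_rfl le_rfl (Config.init input)
    ⟨fun _ => rfl, fun _ _ => rfl, rfl, rfl⟩ (fun i _ => by simp [Config.init])
  -- The code ends exactly where the command ends, so the machine halts there.
  obtain ⟨t', ht', hr⟩ := r 0 σ (.halt _ (by
    rw [p, List.getElem?_eq_none_iff, Cmd.length_comp]; simp [Config.init]))
  exact ⟨t' + 0, by omega, σ, hr, R.out⟩

end Imp

/-! ## Program logic for the structured language -/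

namespace Imp

infixr:60 " ⨾ " => Cmd.seq

@[simp] theorem St.setVar_var (s : St) (x y : Var) (v : ℕ) :
    (s.setVar x v).var y = if y = x then v else s.var y := by
  simp [St.setVar, Function.update_apply]
@[simp] theorem St.setVar_arr (s : St) (x : Var) (v : ℕ) : (s.setVar x v).arr = s.arr := rfl
@[simp] theorem St.setVar_inp (s : St) (x : Var) (v : ℕ) : (s.setVar x v).inp = s.inp := rfl
@[simp] theorem St.setVar_out (s : St) (x : Var) (v : ℕ) : (s.setVar x v).out = s.out := rfl
@[simp] theorem St.setArr_arr (s : St) (a b : Arr) (i v : ℕ) :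
    (s.setArr a i v).arr b = if b = a then Function.update (s.arr a) i v else s.arr b := by
  simp [St.setArr, Function.update_apply]
@[simp] theorem St.setArr_var (s : St) (a : Arr) (i v : ℕ) : (s.setArr a i v).var = s.var := rfl
@[simp] theorem St.setArr_inp (s : St) (a : Arr) (i v : ℕ) : (s.setArr a i v).inp = s.inp := rfl
@[simp] theorem St.setArr_out (s : St) (a : Arr) (i v : ℕ) : (s.setArr a i v).out = s.out := rfl

namespace Cmd

/-- `for x < e do c` -/
def forTo (x : Var) (e : Expr) (c : Cmd) : Cmd :=
  assign x 0 ⨾ loop (e - x) (c ⨾ assign x ((x : Expr) + 1))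

def setsVar : Cmd → Var → Bool
  | assign x _, y => decide (y = x)
  | read x, y => decide (y = x)
  | seq c₁ c₂, y => c₁.setsVar y || c₂.setsVar y
  | ite _ c₁ c₂, y => c₁.setsVar y || c₂.setsVar y
  | loop _ c, y => c.setsVar y
  | _, _ => false

def setsArr : Cmd → Arr → Bool
  | store a _ _, b => decide (b = a)
  | seq c₁ c₂, y => c₁.setsArr y || c₂.setsArr y
  | ite _ c₁ c₂, y => c₁.setsArr y || c₂.setsArr y
  | loop _ c, y => c.setsArr y
  | _, _ => false

def reads : Cmd → Bool
  | read _ => true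
  | seq c₁ c₂ => c₁.reads || c₂.reads
  | ite _ c₁ c₂ => c₁.reads || c₂.reads
  | loop _ c => c.reads
  | _ => false

def writes : Cmd → Bool
  | write _ => true
  | seq c₁ c₂ => c₁.writes || c₂.writes
  | ite _ c₁ c₂ => c₁.writes || c₂.writes
  | loop _ c => c.writes
  | _ => false

end Cmd

/-- The states `s` and `s'` agree on everything that `c` does not mention as a target. -/
structure Frame (c : Cmd) (s s' : St) : Prop where
  var : ∀ x, c.setsVar x = false → s'.var x = s.var x
  arr : ∀ a, c.setsArr a = false → s'.arr a = s.arr a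
  inp : c.reads = false → s'.inp = s.inp
  out : c.writes = false → s'.out = s.out

theorem Frame.refl (c : Cmd) (s : St) : Frame c s s :=
  ⟨fun _ _ => rfl, fun _ _ => rfl, fun _ => rfl, fun _ => rfl⟩

theorem Frame.trans {c : Cmd} {s s' s'' : St} (h : Frame c s s') (h' : Frame c s' s'') :
    Frame c s s'' :=
  ⟨fun x hx => (h'.var x hx).trans (h.var x hx), fun x hx => (h'.arr x hx).trans (h.arr x hx),
    fun hx => (h'.inp hx).trans (h.inp hx), fun hx => (h'.out hx).trans (h.out hx)⟩

theorem Frame.weaken {c c' : Cmd} {s s' : St} (h : Frame c s s')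
    (hv : ∀ x, c'.setsVar x = false → c.setsVar x = false)
    (ha : ∀ x, c'.setsArr x = false → c.setsArr x = false)
    (hr : c'.reads = false → c.reads = false) (hw : c'.writes = false → c.writes = false) :
    Frame c' s s' :=
  ⟨fun x hx => h.var x (hv x hx), fun x hx => h.arr x (ha x hx), fun hx => h.inp (hr hx),
    fun hx => h.out (hw hx)⟩

/-- The sets of targets are computed from the syntax, so for a concrete command what stays unchanged
is decided by `rfl`, and loop invariants need only mention what changes. -/
theorem Ev.frame {L : ℕ} {c : Cmd} {s s' : St} {t : ℕ} (h : Ev L c s t s') : Frame c s s' := by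
  induction h with
  | skip s => exact .refl _ _
  | assign s x e h =>
    refine ⟨fun y hy => ?_, fun _ _ => rfl, fun _ => rfl, fun _ => rfl⟩
    simp only [Cmd.setsVar, decide_eq_false_iff_not] at hy
    simp [hy]
  | store s a i e h =>
    refine ⟨fun _ _ => rfl, fun y hy => ?_, fun _ => rfl, fun _ => rfl⟩
    simp only [Cmd.setsArr, decide_eq_false_iff_not] at hy
    simp [hy]
  | read s x =>
    refine ⟨fun y hy => ?_, fun _ _ => rfl, by simp [Cmd.reads], fun _ => rfl⟩
    simp only [Cmd.setsVar, decide_eq_false_iff_not] at hy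
    simp [St.setVar, hy]
  | write s e => exact ⟨fun _ _ => rfl, fun _ _ => rfl, fun _ => rfl, by simp [Cmd.writes]⟩
  | seq _ _ h₁ h₂ =>
    refine .trans (h₁.weaken ?_ ?_ ?_ ?_) (h₂.weaken ?_ ?_ ?_ ?_) <;>
      simp +contextual [Cmd.setsVar, Cmd.setsArr, Cmd.reads, Cmd.writes]
  | iteTrue _ _ h₁ =>
    refine h₁.weaken ?_ ?_ ?_ ?_ <;>
      simp +contextual [Cmd.setsVar, Cmd.setsArr, Cmd.reads, Cmd.writes]
  | iteFalse _ _ h₁ =>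
    refine h₁.weaken ?_ ?_ ?_ ?_ <;>
      simp +contextual [Cmd.setsVar, Cmd.setsArr, Cmd.reads, Cmd.writes]
  | loopEnd => exact .refl _ _
  | loopStep _ _ _ h₁ h₂ =>
    refine .trans (h₁.weaken ?_ ?_ ?_ ?_) h₂ <;>
      simp +contextual [Cmd.setsVar, Cmd.setsArr, Cmd.reads, Cmd.writes]

/-- From `s` the command `c` runs for at most `T` unit steps, with stored values up to `L`, to a
state that satisfies `Q`. -/
def Tri (L : ℕ) (c : Cmd) (s : St) (T : ℕ) (Q : St → Prop) : Prop :=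
  ∃ t ≤ T, ∃ s', Ev L c s t s' ∧ Q s'

namespace Tri

variable {L T T' T₁ T₂ : ℕ} {s : St} {c c₁ c₂ : Cmd} {Q Q' : St → Prop} {e : Expr}

theorem mono (h : Tri L c s T Q) (hT : T ≤ T') (hQ : ∀ s', Q s' → Q' s') : Tri L c s T' Q' := by
  obtain ⟨t, ht, s', h, hq⟩ := h
  exact ⟨t, by omega, s', h, hQ _ hq⟩

theorem mono_time (h : Tri L c s T Q) (hT : T ≤ T') : Tri L c s T' Q := h.mono hT fun _ h => h

theorem frame (h : Tri L c s T Q) : Tri L c s T fun s' => Frame c s s' ∧ Q s' := by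
  obtain ⟨t, ht, s', h, hq⟩ := h
  exact ⟨t, ht, s', h, h.frame, hq⟩

theorem skip (h : Q s) : Tri L .skip s T Q := ⟨0, Nat.zero_le _, s, .skip s, h⟩

theorem assign {x : Var} (hv : e.eval s ≤ L) (h : Q (s.setVar x (e.eval s))) :
    Tri L (.assign x e) s (T + 1) Q := ⟨1, by omega, _, .assign s x e hv, h⟩

theorem store {a : Arr} {i : Expr} (hv : e.eval s ≤ L)
    (h : Q (s.setArr a (i.eval s) (e.eval s))) :
    Tri L (.store a i e) s (T + 1) Q := ⟨1, by omega, _, .store s a i e hv, h⟩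

theorem read {x : Var} {v : ℕ} {l : List ℕ} (hi : s.inp = v :: l)
    (h : Q { s.setVar x v with inp := l }) : Tri L (.read x) s (T + 1) Q :=
  ⟨1, by omega, _, .read s x, by simpa [hi] using h⟩

theorem write (h : Q { s with out := s.out ++ [e.eval s] }) : Tri L (.write e) s (T + 1) Q :=
  ⟨1, by omega, _, .write s e, h⟩

theorem seq (h : Tri L c₁ s T₁ fun s' => Tri L c₂ s' T₂ Q) : Tri L (c₁ ⨾ c₂) s (T₁ + T₂) Q := by
  obtain ⟨t₁, ht₁, s₁, h₁, t₂, ht₂, s₂, h₂, hq⟩ := h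
  exact ⟨t₁ + t₂, by omega, s₂, .seq h₁ h₂, hq⟩

theorem andThen (h₁ : Tri L c₁ s T₁ Q') (h₂ : ∀ s', Q' s' → Tri L c₂ s' T₂ Q) :
    Tri L (c₁ ⨾ c₂) s (T₁ + T₂) Q := seq (h₁.mono le_rfl h₂)

theorem assign_seq {x : Var} (hv : e.eval s ≤ L) (h : Tri L c (s.setVar x (e.eval s)) T Q) :
    Tri L (.assign x e ⨾ c) s (T + 1) Q :=
  (seq (assign (T := 0) hv h)).mono_time (by omega)

theorem store_seq {a : Arr} {i : Expr} (hv : e.eval s ≤ L)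
    (h : Tri L c (s.setArr a (i.eval s) (e.eval s)) T Q) :
    Tri L (.store a i e ⨾ c) s (T + 1) Q :=
  (seq (store (T := 0) hv h)).mono_time (by omega)

theorem read_seq {x : Var} {v : ℕ} {l : List ℕ} (hi : s.inp = v :: l)
    (h : Tri L c { s.setVar x v with inp := l } T Q) : Tri L (.read x ⨾ c) s (T + 1) Q :=
  (seq (read (T := 0) hi h)).mono_time (by omega)

theorem write_seq (h : Tri L c { s with out := s.out ++ [e.eval s] } T Q) :
    Tri L (.write e ⨾ c) s (T + 1) Q :=
  (seq (write (T := 0) h)).mono_time (by omega)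

theorem ite (h₁ : e.eval s ≠ 0 → Tri L c₁ s T Q) (h₂ : e.eval s = 0 → Tri L c₂ s T Q) :
    Tri L (.ite e c₁ c₂) s (T + 1) Q := by
  by_cases h : e.eval s = 0
  · obtain ⟨t, ht, s', he, hq⟩ := h₂ h
    exact ⟨t + 1, by omega, s', .iteFalse h he, hq⟩
  · obtain ⟨t, ht, s', he, hq⟩ := h₁ h
    exact ⟨t + 1, by omega, s', .iteTrue h he, hq⟩

theorem loopEnd (he : e.eval s = 0) (h : Q s) : Tri L (.loop e c) s (T + 1) Q :=
  ⟨1, by omega, s, .loopEnd he, h⟩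

theorem loopStep (he : e.eval s ≠ 0) (h : Tri L c s T fun s' => Tri L (.loop e c) s' T' Q) :
    Tri L (.loop e c) s (T + T' + 1) Q := by
  obtain ⟨t₁, ht₁, s₁, h₁, t₂, ht₂, s₂, h₂, hq⟩ := h
  exact ⟨t₁ + t₂ + 1, by omega, s₂, .loopStep he h₁ h₂, hq⟩

/-- The invariant carries the counter as a parameter and must not depend on the variable that holds
it (`hJ`). The bound `e` is evaluated again in each round, so it must equal `K` in every state that
the loop can produce. A round costs its body, the increment and the test; the final `+ 2` is the
initial assignment and the last test. -/
theorem forTo {x : Var} {K : ℕ} (J : ℕ → St → Prop) (hx : c.setsVar x = false)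
    (hK : K ≤ L) (he : ∀ s', Frame (.forTo x e c) s s' → e.eval s' = K)
    (hJ : ∀ i s' v, J i s' → J i (s'.setVar x v)) (h0 : J 0 s)
    (hstep : ∀ i < K, ∀ s', Frame (.forTo x e c) s s' → s'.var x = i → J i s' →
      Tri L c s' T (J (i + 1))) :
    Tri L (.forTo x e c) s (K * (T + 2) + 2)
      fun s' => Frame (.forTo x e c) s s' ∧ J K s' := by
  have main : ∀ d i s', i + d = K → Frame (.forTo x e c) s s' → s'.var x = i → J i s' →
      Tri L (.loop (e - x) (c ⨾ .assign x ((x : Expr) + 1))) s' (d * (T + 2) + 1) (J K) := by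
    intro d
    induction d with
    | zero =>
      intro i s' hi hf hv hj
      obtain rfl : i = K := by omega
      exact loopEnd (by simp [he s' hf, hv]) hj
    | succ d ih =>
      intro i s' hi hf hv hj
      refine (loopStep (T := T + 1) (T' := d * (T + 2) + 1) ?_ ?_).mono_time ?_
      · simp [he s' hf, hv]; omega
      · refine seq ((hstep i (by omega) s' hf hv hj).frame.mono le_rfl ?_)
        rintro s'' ⟨hf', hj'⟩
        have hv' : s''.var x = i := (hf'.var x hx).trans hv
        refine assign (T := 0) (by simp [hv']; omega)
          (ih (i + 1) _ (by omega) (hf.trans ?_) ?_ (hJ _ _ _ hj'))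
        · have h2 : Frame (.forTo x e c) s'' (s''.setVar x ((x + 1 : Expr).eval s'')) :=
            ⟨fun y hy => by
              simp [Cmd.forTo, Cmd.setsVar] at hy
              simp [hy], fun _ _ => rfl, fun _ => rfl, fun _ => rfl⟩
          refine .trans (hf'.weaken ?_ ?_ ?_ ?_) h2 <;>
            simp +contextual [Cmd.forTo, Cmd.setsVar, Cmd.setsArr, Cmd.reads, Cmd.writes]
        · simp [hv']
      · apply le_of_eq; ring
  refine (assign_seq (Nat.zero_le _) (main K 0 _ (by omega) ?_ (by simp) (hJ _ _ _ h0))).frame.mono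
    le_rfl fun _ h => h
  exact ⟨fun y hy => by
    simp [Cmd.forTo, Cmd.setsVar] at hy
    simp [hy], fun _ _ => rfl, fun _ => rfl, fun _ => rfl⟩

end Tri

end Imp

/-! ## Fourier transform along a set of digits -/

namespace Portal

open Finset

/-- Digit `j` of `κ` to the base `m`. -/
def dig (m κ j : ℕ) : ℕ := κ / m ^ j % m

theorem dig_lt {m : ℕ} (hm : 0 < m) (κ j : ℕ) : dig m κ j < m := Nat.mod_lt _ hm

theorem dig_congr {m a b i j : ℕ} (h : a % m ^ i = b % m ^ i) (hj : j < i) :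
    dig m a j = dig m b j := by
  have key : ∀ a, dig m a j = a % m ^ i / m ^ j % m := fun a => by
    obtain ⟨k, rfl⟩ : ∃ k, i = j + 1 + k := ⟨i - (j + 1), by omega⟩
    rw [dig, show m ^ (j + 1 + k) = m ^ j * (m * m ^ k) by ring, Nat.mod_mul_right_div_self,
      Nat.mod_mul_right_mod]
  rw [key a, key b, h]

theorem div_pow_eq (m κ i : ℕ) : κ / m ^ i = m * (κ / m ^ (i + 1)) + dig m κ i := by
  rw [dig, pow_succ, ← Nat.div_div_eq_div_mul, Nat.div_add_mod]

/-- Replace digit `i` of `κ` by `c`. -/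
def setDig (m κ i c : ℕ) : ℕ := κ + c * m ^ i - dig m κ i * m ^ i

/-- Addition precedes subtraction in `setDig`, so nothing is truncated; here the result is split
into the digits above `i`, digit `i` and those below. -/
theorem setDig_eq (m κ i c : ℕ) :
    setDig m κ i c = m ^ i * (m * (κ / m ^ (i + 1)) + c) + κ % m ^ i := by
  have h := Nat.div_add_mod κ (m ^ i)
  rw [div_pow_eq] at h
  rw [setDig]
  conv_lhs => rw [← h]
  rw [Nat.sub_eq_iff_eq_add]
  · have : dig m (m ^ i * (m * (κ / m ^ (i + 1)) + dig m κ i) + κ % m ^ i) i = dig m κ i := by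
      rw [h]
    rw [this]; ring
  · have : dig m (m ^ i * (m * (κ / m ^ (i + 1)) + dig m κ i) + κ % m ^ i) i = dig m κ i := by
      rw [h]
    rw [this]
    nlinarith [Nat.zero_le (m ^ i * (m * (κ / m ^ (i + 1)))), Nat.zero_le (κ % m ^ i),
      Nat.zero_le (c * m ^ i)]

theorem setDig_div {m : ℕ} (hm : 0 < m) (κ i c : ℕ) :
    setDig m κ i c / m ^ i = m * (κ / m ^ (i + 1)) + c := by
  rw [setDig_eq, Nat.mul_add_div (pow_pos hm i),
    Nat.div_eq_of_lt (Nat.mod_lt _ (pow_pos hm i)), add_zero]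

theorem setDig_mod (m κ i c : ℕ) : setDig m κ i c % m ^ i = κ % m ^ i := by
  rw [setDig_eq, Nat.mul_add_mod, Nat.mod_mod]

/-- The quotient by `m ^ (i + 1)` is untouched, and it alone decides the inequality. The case `h =
2` keeps the transform inside the two halves of its buffer. -/
theorem setDig_lt {m : ℕ} (hm : 0 < m) {κ i c n h : ℕ} (hi : i < n) (hc : c < m)
    (hκ : κ < h * m ^ n) : setDig m κ i c < h * m ^ n := by
  have h1 : setDig m κ i c / m ^ (i + 1) = κ / m ^ (i + 1) := by
    rw [pow_succ, ← Nat.div_div_eq_div_mul, setDig_div hm, Nat.mul_add_div hm,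
      Nat.div_eq_of_lt hc, add_zero, pow_succ]
  obtain ⟨k, rfl⟩ : ∃ k, n = i + 1 + k := ⟨n - (i + 1), by omega⟩
  have h2 : h * m ^ (i + 1 + k) = h * m ^ k * m ^ (i + 1) := by ring
  rw [h2, ← Nat.div_lt_iff_lt_mul (pow_pos hm _)] at hκ ⊢
  rwa [h1]

variable {R : Type*} [CommRing R] (m : ℕ) (S : ℕ → Prop) [DecidablePred S] (ω : R)

/-- The kernel of the transform at digit `j`. -/
def kern (j a b : ℕ) : R := if S j then (if a = b then 1 else 0) else ω ^ (a * b)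

/-- The transform of `f` along the digits below `i` outside `S`. -/
def transf (f : ℕ → R) : ℕ → ℕ → R
  | 0, κ => f κ
  | i + 1, κ =>
    if S i then transf f i κ
    else ∑ c ∈ range m, transf f i (setDig m κ i c) * ω ^ (c * dig m κ i)

variable {m S ω}

/-- By linearity it suffices to follow point masses. After `i` digits, a mass at `q t` is spread
with a product of kernels over the digits below `i`, while the digits from `i` upwards still have to
agree. -/
theorem transf_eq_sum (hm : 0 < m) {ι : Type*} {I : Finset ι} {q : ι → ℕ} {v : ι → R}
    {f : ℕ → R} (hf : ∀ κ, f κ = ∑ t ∈ I, if q t = κ then v t else 0) (i κ : ℕ) :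
    transf m S ω f i κ = ∑ t ∈ I, if q t / m ^ i = κ / m ^ i then
      v t * ∏ j ∈ range i, kern S ω j (dig m (q t) j) (dig m κ j) else 0 := by
  induction i generalizing κ with
  | zero => simp [transf, hf]
  | succ i ih =>
    rw [transf]
    split_ifs with hS
    · rw [ih]
      refine sum_congr rfl fun t _ => ?_
      have e1 := div_pow_eq m (q t) i
      have e2 := div_pow_eq m κ i
      have iff : q t / m ^ i = κ / m ^ i ↔
          q t / m ^ (i + 1) = κ / m ^ (i + 1) ∧ dig m (q t) i = dig m κ i := by
        constructor
        · intro h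
          refine ⟨?_, by rw [dig, dig, h]⟩
          rw [pow_succ, ← Nat.div_div_eq_div_mul, ← Nat.div_div_eq_div_mul, h]
        · rintro ⟨h1, h2⟩
          rw [e1, e2, h1, h2]
      simp only [iff, prod_range_succ, kern, hS, if_true]
      split_ifs <;> simp_all
    · simp only [ih, sum_mul]
      rw [sum_comm]
      refine sum_congr rfl fun t _ => ?_
      have e1 := div_pow_eq m (q t) i
      have hd := dig_lt hm (q t) i
      -- A mass at `q t` is met only when digit `i` is replaced by the digit of `q t`.
      rw [sum_eq_single_of_mem (dig m (q t) i) (mem_range.2 hd)]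
      · rw [setDig_div hm, e1, prod_range_succ, kern, if_neg hS]
        have hpr : ∏ j ∈ range i, kern S ω j (dig m (q t) j)
            (dig m (setDig m κ i (dig m (q t) i)) j) =
            ∏ j ∈ range i, kern S ω j (dig m (q t) j) (dig m κ j) :=
          prod_congr rfl fun j hj => by
            rw [dig_congr (setDig_mod m κ i _) (mem_range.1 hj)]
        rw [hpr]
        simp only [add_left_inj, mul_eq_mul_left_iff, hm.ne', or_false]
        split_ifs <;> ring
      · intro c hc hne
        rw [setDig_div hm, e1, if_neg, zero_mul]
        intro h
        apply hne
        have := congrArg (· % m) h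
        simp only [Nat.mul_add_mod, Nat.mod_eq_of_lt hd, Nat.mod_eq_of_lt (mem_range.1 hc)] at this
        exact this.symm

theorem sum_range_mul_add (a b : ℕ) (g : ℕ → R) :
    ∑ x ∈ range (a * b), g x = ∑ c ∈ range b, ∑ x ∈ range a, g (a * c + x) := by
  induction b with
  | zero => simp
  | succ b ih => rw [Nat.mul_succ, sum_range_add, ih, sum_range_succ]

/-- The digits of a number below `m ^ n` range independently; the induction splits off the leading
one. -/
theorem sum_prod_dig (hm : 0 < m) (n : ℕ) (ψ : ℕ → ℕ → R) :
    ∑ x ∈ range (m ^ n), ∏ j ∈ range n, ψ j (dig m x j) =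
      ∏ j ∈ range n, ∑ c ∈ range m, ψ j c := by
  induction n with
  | zero => simp
  | succ n ih =>
    rw [pow_succ, sum_range_mul_add, prod_range_succ, ← ih, mul_comm, sum_mul]
    refine sum_congr rfl fun c hc => ?_
    rw [mul_sum]
    refine sum_congr rfl fun x hx => ?_
    rw [mem_range] at hc hx
    rw [prod_range_succ, mul_comm]
    congr 1
    · rw [dig, Nat.mul_add_div (pow_pos hm n), Nat.div_eq_of_lt hx, add_zero, Nat.mod_eq_of_lt hc]
    · refine prod_congr rfl fun j hj => ?_
      rw [dig_congr (i := n) (Nat.mul_add_mod _ _ _ |>.trans rfl) (mem_range.1 hj)]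

/-- The digits of `a`, `b` and `κ` fit together: equal on `S`, of sum `0` elsewhere. -/
def Compat (m n : ℕ) (S : ℕ → Prop) (a b κ : ℕ) : Prop :=
  ∀ j < n, (S j → dig m a j = dig m κ j ∧ dig m b j = dig m κ j) ∧
    (¬ S j → m ∣ dig m a j + dig m b j + dig m κ j)

-- This is orthogonality, digit by digit. On `S` the kernels are Kronecker deltas that force
-- equality; off `S` the sum is `∑ ω ^ (c * (a + b + κ))`, which is `m` or `0`. Using `ω` also for
-- the way back, and not its inverse, is why the three digits add up to zero in `Compat`.
open Classical in
theorem sum_kern_mul (hm : 0 < m)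
    (hω : ∀ s, ∑ c ∈ range m, ω ^ (c * s) = if m ∣ s then (m : R) else 0)
    (n a b κ : ℕ) :
    ∑ x ∈ range (m ^ n), ∏ j ∈ range n, (kern S ω j (dig m a j) (dig m x j) *
      kern S ω j (dig m b j) (dig m x j) * kern S ω j (dig m x j) (dig m κ j)) =
    if Compat m n S a b κ then (m : R) ^ #{j ∈ range n | ¬ S j} else 0 := by
  rw [sum_prod_dig hm n fun j c => kern S ω j (dig m a j) c * kern S ω j (dig m b j) c *
    kern S ω j c (dig m κ j)]
  have factor : ∀ j, ∑ c ∈ range m, kern S ω j (dig m a j) c * kern S ω j (dig m b j) c *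
      kern S ω j c (dig m κ j) =
      if (S j → dig m a j = dig m κ j ∧ dig m b j = dig m κ j) ∧
        (¬ S j → m ∣ dig m a j + dig m b j + dig m κ j) then (if S j then 1 else (m : R)) else 0 := by
    intro j
    by_cases hS : S j
    · simp only [kern, hS, if_true, not_true, false_imp_iff, true_imp_iff, and_true]
      rw [sum_eq_single_of_mem (dig m κ j) (mem_range.2 (dig_lt hm _ _))]
      · split_ifs <;> simp_all
      · intro c _ hc
        simp [hc]
    · simp only [kern, hS, if_false, not_false_eq_true, false_imp_iff, true_imp_iff, true_and]
      rw [← hω]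
      refine sum_congr rfl fun c _ => ?_
      rw [← pow_add, ← pow_add]
      ring_nf
  rw [prod_congr rfl fun j _ => factor j]
  by_cases h : Compat m n S a b κ
  · rw [if_pos h, prod_congr rfl fun j hj => if_pos (h j (mem_range.1 hj)), prod_ite]
    simp
  · rw [if_neg h]
    simp only [Compat, not_forall] at h
    obtain ⟨j, hj, h⟩ := h
    exact prod_eq_zero (mem_range.2 hj) (if_neg h)

open Classical in
/-- Transforming, multiplying the two halves and transforming again yields the convolution. -/
theorem transf_mul_transf (hm : 0 < m)
    (hω : ∀ s, ∑ c ∈ range m, ω ^ (c * s) = if m ∣ s then (m : R) else 0)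
    {n : ℕ} {ι : Type*} {I : Finset ι} {q : ι → ℕ} {v : ι → R} {f g : ℕ → R}
    (hf : ∀ κ, f κ = ∑ t ∈ I, if q t = κ then v t else 0)
    (hg : ∀ κ < m ^ n, g κ = transf m S ω f n κ * transf m S ω f n (m ^ n + κ))
    (hg0 : ∀ κ, 2 * m ^ n ≤ κ → g κ = 0) {κ : ℕ} (hκ : κ < m ^ n) :
    transf m S ω g n κ = (m : R) ^ #{j ∈ range n | ¬ S j} *
      ∑ t ∈ I, ∑ u ∈ I, if q t / m ^ n = 0 ∧ q u / m ^ n = 1 ∧ Compat m n S (q t) (q u) κ then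
        v t * v u else 0 := by
  have hM : 0 < m ^ n := pow_pos hm n
  -- The product is again written as a sum of point masses, so that `transf_eq_sum` applies to the
  -- second transform.
  have hg' : ∀ κ, g κ = ∑ x ∈ range (m ^ n * 2), if x = κ then g x else 0 := by
    intro κ
    rw [sum_ite_eq' (range (m ^ n * 2)) κ g]
    split_ifs with h
    · rfl
    · exact hg0 κ (by rw [mem_range] at h; omega)
  rw [transf_eq_sum hm hg', sum_range_mul_add]
  -- The digits from `n` upwards are never transformed, so an index below `m ^ n` receives only from
  -- the lower half.
  rw [sum_eq_single_of_mem 0 (by simp)]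
  rotate_left
  · intro c _ hc
    refine sum_eq_zero fun x hx => if_neg ?_
    rw [Nat.mul_add_div hM, Nat.div_eq_of_lt hκ, Nat.div_eq_of_lt (mem_range.1 hx)]
    omega
  have inner : ∀ x ∈ range (m ^ n),
      (if (m ^ n * 0 + x) / m ^ n = κ / m ^ n then g (m ^ n * 0 + x) *
        ∏ j ∈ range n, kern S ω j (dig m (m ^ n * 0 + x) j) (dig m κ j) else 0) =
      ∑ t ∈ I, ∑ u ∈ I, (if q t / m ^ n = 0 ∧ q u / m ^ n = 1 then v t * v u else 0) *
        ∏ j ∈ range n, (kern S ω j (dig m (q t) j) (dig m x j) *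
          kern S ω j (dig m (q u) j) (dig m x j) * kern S ω j (dig m x j) (dig m κ j)) := by
    intro x hx
    rw [mem_range] at hx
    rw [mul_zero, zero_add, Nat.div_eq_of_lt hx, Nat.div_eq_of_lt hκ, if_pos rfl, hg x hx,
      transf_eq_sum hm hf, transf_eq_sum hm hf, sum_mul_sum, sum_mul]
    refine sum_congr rfl fun t _ => ?_
    rw [sum_mul]
    refine sum_congr rfl fun u _ => ?_
    have h1 : (m ^ n + x) / m ^ n = 1 := by
      rw [Nat.add_div_left _ hM, Nat.div_eq_of_lt hx]
    have h2 : ∏ j ∈ range n, kern S ω j (dig m (q u) j) (dig m (m ^ n + x) j) =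
        ∏ j ∈ range n, kern S ω j (dig m (q u) j) (dig m x j) :=
      prod_congr rfl fun j hj => by
        rw [dig_congr (i := n) (Nat.add_mod_left _ _) (mem_range.1 hj)]
    rw [h1, h2, Nat.div_eq_of_lt hx, prod_mul_distrib, prod_mul_distrib]
    by_cases ht : q t / m ^ n = 0 <;> by_cases hu : q u / m ^ n = 1 <;> simp [ht, hu]
    ring
  rw [sum_congr rfl inner, sum_comm, mul_sum]
  refine sum_congr rfl fun t _ => ?_
  rw [sum_comm, mul_sum]
  refine sum_congr rfl fun u _ => ?_
  rw [← mul_sum, sum_kern_mul hm hω]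
  have split : ∀ {A B C : Prop} {x y : R} [Decidable (A ∧ B)] [Decidable C]
      [Decidable (A ∧ B ∧ C)], (if A ∧ B then x else 0) * (if C then y else 0) =
        y * if A ∧ B ∧ C then x else 0 := by
    intro A B C x y _ _ _
    by_cases hA : A <;> by_cases hB : B <;> by_cases hC : C <;> simp [hA, hB, hC, mul_comm]
  exact split

end Portal

/-! ## Roots of unity modulo prime powers -/

namespace Portal

open Finset

/-- For every `m ≥ 1` there are a prime `p > m` and a number `g` whose powers `g ^ p ^ K` are
primitive `m`-th roots of unity modulo `p ^ K` in a strong sense. -/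
theorem exists_prime_root {m : ℕ} (hm : 2 ≤ m) : ∃ p g : ℕ, p.Prime ∧ m < p ∧ g < p ∧ ∀ K : ℕ,
    ((g : ZMod (p ^ K)) ^ p ^ K) ^ m = 1 ∧
    ∀ s, ¬ m ∣ s → IsUnit (((g : ZMod (p ^ K)) ^ p ^ K) ^ s - 1) := by
  -- Since `m` divides `p - 1`, the cyclic group of units modulo `p` has an element of order `m`.
  obtain ⟨p, hp, hmp, hpm⟩ := Nat.exists_prime_gt_modEq_one m (show m ≠ 0 by omega)
  have : Fact p.Prime := ⟨hp⟩
  obtain ⟨u, hu⟩ : ∃ u : (ZMod p)ˣ, orderOf u = m := by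
    obtain ⟨u, hu⟩ := IsCyclic.exists_ofOrder_eq_natCard (α := (ZMod p)ˣ)
    rw [Nat.card_eq_fintype_card, ZMod.card_units_eq_totient, Nat.totient_prime hp] at hu
    have hd : m ∣ p - 1 := (Nat.modEq_iff_dvd' hp.one_le).1 hpm.symm
    obtain ⟨k, hk⟩ := hd
    have h0 := hp.two_le
    have hk0 : k ≠ 0 := by rintro rfl; omega
    refine ⟨u ^ k, ?_⟩
    rw [orderOf_pow_of_dvd hk0 (by rw [hu, hk]; exact dvd_mul_left _ _), hu, hk,
      Nat.mul_div_cancel _ (Nat.pos_of_ne_zero hk0)]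
  refine ⟨p, (u : ZMod p).val, hp, hmp, ZMod.val_lt _, fun K => ⟨?_, fun s hs => ?_⟩⟩
  · have h1 : (p : ℤ) ∣ ((u : ZMod p).val : ℤ) ^ m - 1 := by
      rw [← ZMod.intCast_zmod_eq_zero_iff_dvd]
      push_cast
      rw [ZMod.natCast_zmod_val, ← Units.val_pow_eq_pow_val, ← hu, pow_orderOf_eq_one]
      simp
    -- Raising to the power `p ^ K` lifts the congruence `g ^ m ≡ 1` modulo `p` to one modulo `p ^
    -- (K + 1)`.
    have h2 := dvd_sub_pow_of_dvd_sub h1 K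
    rw [one_pow] at h2
    have h3 := (pow_dvd_pow (p : ℤ) K.le_succ).trans h2
    have h4 : ((p ^ K : ℕ) : ℤ) ∣ (((u : ZMod p).val : ℤ) ^ m) ^ p ^ K - 1 := by
      push_cast; exact h3
    rw [← ZMod.intCast_zmod_eq_zero_iff_dvd] at h4
    push_cast at h4
    rw [← pow_mul, mul_comm, pow_mul]
    exact sub_eq_zero.1 h4
  · have h1 : ((((u : ZMod p).val : ℤ) ^ p ^ K) ^ s - 1 : ℤ) =
        (((u : ZMod p).val : ℤ) ^ p ^ K) ^ s - 1 := rfl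
    -- Modulo `p` the power `p ^ K` is the identity, so the lifted root still has order `m` there; a
    -- number prime to `p` is a unit modulo `p ^ K`.
    have h2 : ¬ (p : ℤ) ∣ (((u : ZMod p).val : ℤ) ^ p ^ K) ^ s - 1 := by
      rw [← ZMod.intCast_zmod_eq_zero_iff_dvd]
      push_cast
      rw [ZMod.natCast_zmod_val, ZMod.pow_card_pow, sub_eq_zero]
      intro h
      apply hs
      rw [← hu]
      exact orderOf_dvd_of_pow_eq_one (Units.ext (by simpa using h))
    have h3 : IsUnit (((((u : ZMod p).val : ℤ) ^ p ^ K) ^ s - 1 : ℤ) : ZMod (p ^ K)) := by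
      rw [ZMod.coe_int_isUnit_iff_isCoprime]
      push_cast
      refine IsCoprime.pow_left ?_
      exact (Prime.coprime_iff_not_dvd (Nat.prime_iff_prime_int.1 hp)).2 h2
    push_cast at h3
    exact h3

/-- The geometric sum is annihilated by `ω ^ s - 1`. The ring may have zero divisors, so this has to
be a unit and not just nonzero. -/
theorem sum_root_pow {R : Type*} [CommRing R] {m : ℕ} {ω : R} (h1 : ω ^ m = 1)
    (hu : ∀ s, ¬ m ∣ s → IsUnit (ω ^ s - 1)) (s : ℕ) :
    ∑ c ∈ range m, ω ^ (c * s) = if m ∣ s then (m : R) else 0 := by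
  split_ifs with h
  · obtain ⟨k, rfl⟩ := h
    have : ∀ c, ω ^ (c * (m * k)) = 1 := fun c => by
      rw [show c * (m * k) = m * (c * k) by ring, pow_mul, h1, one_pow]
    simp [this]
  · have : (∑ c ∈ range m, (ω ^ s) ^ c) * (ω ^ s - 1) = 0 := by
      rw [geom_sum_mul, ← pow_mul, mul_comm, pow_mul, h1, one_pow, sub_self]
    simp only [mul_comm _ s, pow_mul]
    exact (hu s h).mul_left_eq_zero.1 this

/-! ## Sparse languages -/

/-- The number with the digits `e 0, …, e (n-1)` to the base `m`. -/
def ofDig (m : ℕ) (e : ℕ → ℕ) (n : ℕ) : ℕ := ∑ j ∈ range n, m ^ j * e j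

theorem ofDig_lt {m : ℕ} {e : ℕ → ℕ} {n : ℕ} (he : ∀ j < n, e j < m) : ofDig m e n < m ^ n := by
  induction n with
  | zero => simp [ofDig]
  | succ n ih =>
    have h1 := ih fun j hj => he j (by omega)
    have h2 := he n (by omega)
    rw [ofDig] at h1 ⊢
    rw [sum_range_succ, pow_succ]
    calc _ < m ^ n + m ^ n * e n := by omega
      _ = m ^ n * (e n + 1) := by ring
      _ ≤ _ := Nat.mul_le_mul_left _ h2

theorem dig_ofDig_add {m : ℕ} (hm : 0 < m) {e : ℕ → ℕ} {n : ℕ} (he : ∀ j < n, e j < m) (k : ℕ)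
    {j : ℕ} (hj : j < n) : dig m (ofDig m e n + m ^ n * k) j = e j := by
  induction n generalizing k with
  | zero => omega
  | succ n ih =>
    have h0 : ofDig m e (n + 1) + m ^ (n + 1) * k = ofDig m e n + m ^ n * (e n + m * k) := by
      rw [ofDig, ofDig, sum_range_succ, pow_succ]; ring
    rw [h0]
    have he' : ∀ j < n, e j < m := fun j hj => he j (by omega)
    by_cases hjn : j = n
    · subst hjn
      rw [dig, Nat.add_mul_div_left _ _ (pow_pos hm j), Nat.div_eq_of_lt (ofDig_lt he'), zero_add,
        Nat.add_mul_mod_self_left, Nat.mod_eq_of_lt (he j hj)]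
    · exact ih he' _ (by omega)

theorem eq_of_dig_eq {m : ℕ} {a b n : ℕ} (ha : a < m ^ n) (hb : b < m ^ n)
    (h : ∀ j < n, dig m a j = dig m b j) : a = b := by
  have key : ∀ i ≤ n, a / m ^ (n - i) = b / m ^ (n - i) := by
    intro i
    induction i with
    | zero => intro; rw [Nat.sub_zero, Nat.div_eq_of_lt ha, Nat.div_eq_of_lt hb]
    | succ i ih =>
      intro hi
      have := ih (by omega)
      rw [show n - i = n - (i + 1) + 1 by omega] at this
      rw [div_pow_eq m a, div_pow_eq m b, this, h _ (by omega)]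
  simpa using key n le_rfl

variable {m n : ℕ}

/-- The `σ`-bit at position `j`. -/
def bit (x : StateString m n) (j : ℕ) : ℕ := if h : j < n then (x ⟨j, h⟩).sigBit else 0

/-- The weight at position `j`. -/
def wt (x : StateString m n) (j : ℕ) : ℕ := if h : j < n then (x ⟨j, h⟩).weight else 0

theorem sigBit_le_one (a : PortalState m) : a.sigBit ≤ 1 := by cases a <;> simp [PortalState.sigBit]

theorem weight_lt (a : PortalState m) : a.weight < m := by cases a <;> simp [PortalState.weight]

theorem bit_le_one (x : StateString m n) (j : ℕ) : bit x j ≤ 1 := by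
  rw [bit]; split
  · exact sigBit_le_one _
  · omega

theorem wt_lt (hm : 0 < m) (x : StateString m n) (j : ℕ) : wt x j < m := by
  rw [wt]; split
  · exact weight_lt _
  · exact hm

theorem ext_of_bit_wt {x y : StateString m n} (hb : ∀ j < n, bit x j = bit y j)
    (hw : ∀ j < n, wt x j = wt y j) : x = y := by
  funext i
  have h1 := hb i i.2
  have h2 := hw i i.2
  simp only [bit, wt, i.2, dite_true, Fin.eta] at h1 h2
  revert h1 h2
  cases x i <;> cases y i <;> simp [PortalState.sigBit, PortalState.weight, Fin.ext_iff]

theorem combine_eq_some_iff (x y z : StateString m n) :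
    (x.combine y = fun i => some (z i)) ↔ ∀ j < n, bit x j = bit y j ∧ bit z j = bit x j ∧
      wt z j = (wt x j + wt y j) % m := by
  have key : ∀ a b c : PortalState m, a.combine b = some c ↔ a.sigBit = b.sigBit ∧
      c.sigBit = a.sigBit ∧ c.weight = (a.weight + b.weight) % m := by
    intro a b c
    cases a <;> cases b <;> cases c <;>
      simp [PortalState.combine, PortalState.sigBit, PortalState.weight, Fin.ext_iff, Fin.val_add,
        eq_comm]
  rw [funext_iff]
  constructor
  · intro h j hj
    have := (key _ _ _).1 (h ⟨j, hj⟩)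
    simpa [bit, wt, hj] using this
  · intro h i
    have := h i i.2
    simp only [bit, wt, i.2, dite_true, Fin.eta] at this
    exact (key _ _ _).2 this

theorem exists_combine {x y : StateString m n} (h : ∀ j < n, bit x j = bit y j) :
    ∃ z : StateString m n, x.combine y = fun i => some (z i) := by
  have : ∀ i, ∃ z, (x i).combine (y i) = some z := by
    intro i
    have h1 := h i i.2
    simp only [bit, i.2, dite_true, Fin.eta] at h1
    revert h1
    cases x i <;> cases y i <;> simp [PortalState.sigBit, PortalState.combine]
  choose z hz using this
  exact ⟨z, funext hz⟩

theorem _root_.IsSparse.sum_eq {L : Set (StateString m n)} (hL : IsSparse L) {x y : StateString m n}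
    (hx : x ∈ L) (hy : y ∈ L) :
    ∑ j ∈ range n, (bit x j : ZMod m) * wt y j = ∑ j ∈ range n, (bit y j : ZMod m) * wt x j := by
  have h := hL x hx y hy
  rw [← ZMod.natCast_eq_natCast_iff] at h
  push_cast at h
  simpa [sum_range, bit, wt, StateString.sigVec, StateString.weightVec] using h

/-- Position `j` is branching in `A`: two strings of `A` have the same bits before `j` and
different bits at `j`. -/
def Branch (A : Set (StateString m n)) (j : ℕ) : Prop :=
  ∃ x ∈ A, ∃ y ∈ A, (∀ i < j, bit x i = bit y i) ∧ bit x j = 0 ∧ bit y j = 1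

/-- At the first difference, the two strings themselves would witness that the position is
branching. -/
theorem bit_eq_of_branch {A : Set (StateString m n)} {x y : StateString m n} (hx : x ∈ A)
    (hy : y ∈ A) (h : ∀ j < n, Branch A j → bit x j = bit y j) : ∀ j < n, bit x j = bit y j := by
  intro j
  induction j using Nat.strong_induction_on with
  | _ j ih =>
    intro hj
    have h0 : ∀ i < j, bit x i = bit y i := fun i hi => ih i hi (by omega)
    have hx1 := bit_le_one x j
    have hy1 := bit_le_one y j
    by_contra hne
    apply hne
    apply h j hj
    by_cases hx0 : bit x j = 0
    · exact ⟨x, hx, y, hy, h0, hx0, by omega⟩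
    · exact ⟨y, hy, x, hx, fun i hi => (h0 i hi).symm, by omega, by omega⟩

/-- A vector orthogonal to the bits of `A` is determined by its non-branching positions. -/
theorem eq_zero_of_branch {A : Set (StateString m n)} {d : ℕ → ZMod m}
    (hA : ∀ x ∈ A, ∑ j ∈ range n, (bit x j : ZMod m) * d j = 0)
    (hd : ∀ j < n, ¬ Branch A j → d j = 0) : ∀ j < n, d j = 0 := by
  -- Elimination from the last position. At a branching position, subtract the equations of the two
  -- witnesses: entries before `j` cancel since the bits agree, entries after `j` vanish by
  -- induction, and `d j` remains.
  have key : ∀ k, ∀ j < n, n ≤ j + k → d j = 0 := by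
    intro k
    induction k with
    | zero => intro j hj hk; omega
    | succ k ih =>
      intro j hj hk
      by_cases hB : Branch A j
      · obtain ⟨x, hx, y, hy, hlt, hx0, hy1⟩ := hB
        have h := congrArg₂ (· - ·) (hA y hy) (hA x hx)
        simp only [← sum_sub_distrib, ← sub_mul, sub_zero] at h
        rw [sum_eq_single_of_mem j (mem_range.2 hj)] at h
        · simpa [hx0, hy1] using h
        · intro i hi hij
          rw [mem_range] at hi
          rcases lt_or_gt_of_ne hij with hij | hij
          · rw [hlt i hij, sub_self, zero_mul]
          · rw [ih i hi (by omega), mul_zero]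
      · exact hd j hj hB
  intro j hj
  exact key n j hj (by omega)

/-- By sparsity `σ(t)·w(x) = σ(x)·w(t)`, and the right side does not change when `x` is replaced by
a string with the same bits. -/
theorem _root_.IsSparse.orthogonal {L : Set (StateString m n)} (hL : IsSparse L)
    {x x' t : StateString m n} (hx : x ∈ L) (hx' : x' ∈ L) (ht : t ∈ L)
    (hb : ∀ j < n, bit x j = bit x' j) :
    ∑ j ∈ range n, (bit t j : ZMod m) * ((wt x j : ZMod m) - wt x' j) = 0 := by
  simp only [mul_sub, sum_sub_distrib, hL.sum_eq ht hx, hL.sum_eq ht hx']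
  rw [sub_eq_zero]
  refine sum_congr rfl fun j hj => ?_
  rw [hb j (mem_range.1 hj)]

open Classical in
/-- The digits by which a string is represented: bits at branching positions, weights elsewhere. -/
noncomputable def keyDig (A : Set (StateString m n)) (x : StateString m n) (j : ℕ) : ℕ :=
  if Branch A j then bit x j else wt x j

theorem keyDig_lt (hm : 2 ≤ m) (A : Set (StateString m n)) (x : StateString m n) (j : ℕ) :
    keyDig A x j < m := by
  rw [keyDig]
  split
  · exact (bit_le_one x j).trans_lt hm
  · exact wt_lt (by omega) x j

/-- A sparse language has at most `m ^ n` strings. -/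
theorem _root_.IsSparse.length_le (hm : 2 ≤ m) {L : Set (StateString m n)} (hL : IsSparse L)
    {l : List (StateString m n)} (hl : Enumerates l L) : l.length ≤ m ^ n := by
  classical
  -- The key taken with respect to `L` itself is injective on `L`: it fixes the bits by
  -- `bit_eq_of_branch` and then the weights by `eq_zero_of_branch`.
  have hinj : Set.InjOn (fun x => ofDig m (keyDig L x) n) l.toFinset := by
    intro x hx y hy hxy
    simp only [List.coe_toFinset, Set.mem_ofPred_eq, hl.2] at hx hy
    have hk : ∀ j < n, keyDig L x j = keyDig L y j := fun j hj => by
      have hx := dig_ofDig_add (by omega) (fun j _ => keyDig_lt hm L x j) 0 hj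
      have hy := dig_ofDig_add (by omega) (fun j _ => keyDig_lt hm L y j) 0 hj
      rw [← hx, ← hy]
      simp only at hxy
      rw [hxy]
    have hb := bit_eq_of_branch hx hy fun j hj hB => by
      have := hk j hj
      rwa [keyDig, keyDig, if_pos hB, if_pos hB] at this
    have hw := eq_zero_of_branch (A := L) (d := fun j => (wt x j : ZMod m) - wt y j)
      (fun t ht => hL.orthogonal hx hy ht hb) fun j hj hB => by
        have := hk j hj
        rw [keyDig, keyDig, if_neg hB, if_neg hB] at this
        rw [this, sub_self]
    refine ext_of_bit_wt hb fun j hj => ?_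
    have := sub_eq_zero.1 (hw j hj)
    rw [ZMod.natCast_eq_natCast_iff] at this
    exact this.eq_of_lt_of_lt (wt_lt (by omega) _ _) (wt_lt (by omega) _ _)
  have := card_le_card_of_injOn (t := range (m ^ n)) _ (fun x _ => by
    simp only [coe_range, Set.mem_Iio]
    exact ofDig_lt fun j _ => keyDig_lt hm L x j) hinj
  rwa [card_range, List.toFinset_card_of_nodup hl.1] at this

/-- The strings of `L₁` whose bits are those of a string of `L₂`. -/
def common (L₁ L₂ : Set (StateString m n)) : Set (StateString m n) :=
  {x | x ∈ L₁ ∧ ∃ y ∈ L₂, ∀ j < n, bit x j = bit y j}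

/-- The index `κ` is that of the combination of `x` and `y`. -/
def Joins (S : ℕ → Prop) (κ : ℕ) (x y : StateString m n) : Prop :=
  ∀ j < n, (S j → bit x j = dig m κ j ∧ bit y j = dig m κ j) ∧
    (¬ S j → m ∣ wt x j + wt y j + dig m κ j)

variable {L₁ L₂ : Set (StateString m n)}

/-- Branching refers to strings of `L₁`, so `y` is replaced by a string `w` of `L₁` with the same
bits. Hence comparison on the branching positions already decides whether two strings can be
combined. -/
theorem Joins.bit_eq {κ : ℕ} {x y : StateString m n} (h : Joins (Branch (common L₁ L₂)) κ x y)
    (hx : x ∈ common L₁ L₂) (hy : y ∈ common L₂ L₁) : ∀ j < n, bit x j = bit y j := by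
  obtain ⟨hy, w, hw, hb⟩ := hy
  have := bit_eq_of_branch hx (⟨hw, y, hy, fun j hj => (hb j hj).symm⟩ : w ∈ common L₁ L₂)
    fun j hj hB => by rw [((h j hj).1 hB).1, ← hb j hj, ((h j hj).1 hB).2]
  intro j hj
  rw [this j hj, hb j hj]

/-- The two weight sums agree off the branching positions, and their difference is orthogonal to all
common σ-vectors, so it is zero. One array entry per index therefore suffices. -/
theorem Joins.unique (h₁ : IsSparse L₁) (h₂ : IsSparse L₂) {κ : ℕ} {x y x' y' : StateString m n}
    (h : Joins (Branch (common L₁ L₂)) κ x y) (hx : x ∈ common L₁ L₂) (hy : y ∈ common L₂ L₁)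
    (h' : Joins (Branch (common L₁ L₂)) κ x' y') (hx' : x' ∈ common L₁ L₂)
    (hy' : y' ∈ common L₂ L₁) {j : ℕ} (hj : j < n) :
    bit x j = bit x' j ∧ (wt x j + wt y j) % m = (wt x' j + wt y' j) % m := by
  have hb := bit_eq_of_branch hx hx' fun j hj hB => by
    rw [((h j hj).1 hB).1, ((h' j hj).1 hB).1]
  refine ⟨hb j hj, ?_⟩
  have e := h.bit_eq hx hy
  have e' := h'.bit_eq hx' hy'
  have hw := eq_zero_of_branch (A := common L₁ L₂)
    (d := fun j => ((wt x j : ZMod m) - wt x' j) + ((wt y j : ZMod m) - wt y' j)) ?_ ?_ j hj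
  · have h3 : ((wt x j + wt y j : ℕ) : ZMod m) = (wt x' j + wt y' j : ℕ) := by
      push_cast
      linear_combination hw
    exact (ZMod.natCast_eq_natCast_iff _ _ _).1 h3
  · rintro t ⟨ht, u, hu, htu⟩
    simp only [mul_add, sum_add_distrib]
    rw [h₁.orthogonal hx.1 hx'.1 ht hb, zero_add]
    -- For the part of the difference from `L₂`, the test string `t` is exchanged for its partner
    -- `u` in `L₂`, which has the same bits.
    rw [← h₂.orthogonal hy.1 hy'.1 hu fun j hj => by rw [← e j hj, hb j hj, e' j hj]]
    exact sum_congr rfl fun j hj => by rw [htu j (mem_range.1 hj)]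
  · intro j hj hB
    have a := (ZMod.natCast_eq_zero_iff _ _).2 ((h j hj).2 hB)
    have b := (ZMod.natCast_eq_zero_iff _ _).2 ((h' j hj).2 hB)
    push_cast at a b
    linear_combination a - b

theorem exists_joins (hm : 2 ≤ m) (S : ℕ → Prop) {x y : StateString m n}
    (h : ∀ j < n, bit x j = bit y j) : ∃ κ < m ^ n, Joins S κ x y := by
  classical
  -- Off `S` the digit is minus the sum of the weights; the outer reduction turns `m` into `0`.
  let e : ℕ → ℕ := fun j => if S j then bit x j else (m - (wt x j + wt y j) % m) % m
  have he : ∀ j < n, e j < m := fun j _ => by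
    simp only [e]
    split
    · exact (bit_le_one x j).trans_lt hm
    · exact Nat.mod_lt _ (by omega)
  refine ⟨ofDig m e n, ofDig_lt he, fun j hj => ?_⟩
  have hd := dig_ofDig_add (by omega) he 0 hj
  rw [mul_zero, add_zero] at hd
  rw [hd]
  constructor
  · intro hS
    simp only [e, hS, if_true, h j hj, and_self]
  · intro hS
    simp only [e, hS, if_false]
    have := Nat.mod_lt (wt x j + wt y j) (show 0 < m by omega)
    rw [Nat.dvd_iff_mod_eq_zero, Nat.add_mod_mod, ← Nat.mod_add_mod,
      Nat.add_sub_cancel' this.le, Nat.mod_self]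

/-- A combination determines every digit of its index. This keeps the output free of repetitions. -/
theorem Joins.index_unique {S : ℕ → Prop} {κ κ' : ℕ} (hm : 0 < m) (hκ : κ < m ^ n)
    (hκ' : κ' < m ^ n)
    {x y x' y' : StateString m n} (h : Joins S κ x y) (h' : Joins S κ' x' y')
    (hb : ∀ j < n, bit x j = bit x' j)
    (hw : ∀ j < n, (wt x j + wt y j) % m = (wt x' j + wt y' j) % m) : κ = κ' := by
  refine eq_of_dig_eq hκ hκ' fun j hj => ?_
  by_cases hS : S j
  · rw [← ((h j hj).1 hS).1, ← ((h' j hj).1 hS).1, hb j hj]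
  · have a := (ZMod.natCast_eq_zero_iff _ _).2 ((h j hj).2 hS)
    have b := (ZMod.natCast_eq_zero_iff _ _).2 ((h' j hj).2 hS)
    have c := (ZMod.natCast_eq_natCast_iff _ _ _).2 (hw j hj)
    have : (dig m κ j : ZMod m) = dig m κ' j := by
      push_cast at a b c
      linear_combination a - b - c
    rw [ZMod.natCast_eq_natCast_iff] at this
    exact this.eq_of_lt_of_lt (dig_lt hm _ _) (dig_lt hm _ _)

end Portal

/-! ## The program -/

namespace Imp

open Imp.Expr Imp.Cmd Portal Finset

section Program

variable (m p g : ℕ)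

/-- Reads `n` and computes `m ^ n`, `2 ^ n`, the modulus, and powers of the root of unity. -/
def setup : Cmd :=
  read .n ⨾ assign .pow 1 ⨾ assign .two 1 ⨾ assign .modulus (lit (p ^ 2)) ⨾
  forTo .i (var .n) (
    store .place (var .i) (var .pow) ⨾ assign .pow (var .pow * lit m) ⨾
    assign .two (var .two * 2) ⨾ assign .modulus (var .modulus * lit (p ^ 3))) ⨾
  assign .root (lit g) ⨾
  forTo .i (3 * var .n + 2) (
    assign .acc 1 ⨾
    forTo .j (lit p) (assign .acc (var .acc * var .root % var .modulus)) ⨾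
    assign .root (var .acc)) ⨾
  assign .acc 1 ⨾
  forTo .i (lit m) (
    store .unit (var .i) (var .acc) ⨾ assign .acc (var .acc * var .root % var .modulus))

/-- Reads one string and enters it in the tables. -/
def readString : Cmd :=
  assign .code 1 ⨾
  forTo .j (var .n) (
    read .bit ⨾ read .wt ⨾
    store .bits (var .cnt * var .n + var .j) (var .bit) ⨾
    -- Attributes of partners get added. Only the first language contributes the bit, so the sum is
    -- the common bit and not its double.
    store .attr (var .cnt * (2 * var .n + 1) + (2 * var .j + 1)) (var .bit * (1 - var .side)) ⨾
    store .attr (var .cnt * (2 * var .n + 1) + (2 * var .j + 2)) (var .wt) ⨾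
    assign .code (var .code * 2 + var .bit)) ⨾
  store .side (var .cnt) (var .side) ⨾ store .code (var .cnt) (var .code) ⨾
  store .seen (var .code * 2 + var .side) 1 ⨾ assign .cnt (var .cnt + 1)

/-- Reads both languages. -/
def readAll : Cmd :=
  forTo .side 2 (read .flag ⨾ loop (var .flag) (readString ⨾ read .flag))

/-- Computes the common `σ`-vectors and their branching positions. -/
def branching : Cmd :=
  forTo .k (var .two) (
    store .common (var .two + var .k)
      (get .seen ((var .two + var .k) * 2) * get .seen ((var .two + var .k) * 2 + 1))) ⨾
  assign .half (var .two) ⨾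
  forTo .j (var .n) (
    assign .half (var .half / 2) ⨾
    forTo .k (var .half) (
      assign .bit (get .common ((var .half + var .k) * 2)) ⨾
      assign .wt (get .common ((var .half + var .k) * 2 + 1)) ⨾
      -- `bit` and `wt` hold the flags of the two children. On 0/1 values this expression is their
      -- disjunction, and the product tested next is their conjunction.
      store .common (var .half + var .k) (var .bit + var .wt - var .bit * var .wt) ⨾
      ite (var .bit * var .wt) (store .branch (var .n - 1 - var .j) 1) skip))

/-- Computes the keys of all strings. -/
def keys : Cmd :=
  forTo .k (var .cnt) (
    assign .acc 0 ⨾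
    forTo .j (var .n) (
      ite (get .branch (var .j))
        (assign .acc (var .acc + get .place (var .j) * get .bits (var .k * var .n + var .j)))
        (assign .acc (var .acc + get .place (var .j) *
          get .attr (var .k * (2 * var .n + 1) + (2 * var .j + 2))))) ⨾
    store .key (var .k) (var .acc + var .pow * get .side (var .k)))

/-- The transform along the non-branching digits. -/
def transform : Cmd :=
  forTo .i (var .n) (
    forTo .k (2 * var .pow) (
      ite (get .branch (var .i))
        (store .buf ((var .i + 1) * (2 * var .pow) + var .k)
          (get .buf (var .i * (2 * var .pow) + var .k)))
        (assign .dig (var .k / get .place (var .i) % lit m) ⨾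
          assign .acc 0 ⨾
          forTo .c (lit m) (
            assign .acc ((var .acc + get .buf (var .i * (2 * var .pow) +
                (var .k + var .c * get .place (var .i) - var .dig * get .place (var .i))) *
              get .unit (var .c * var .dig % lit m)) % var .modulus)) ⨾
          store .buf ((var .i + 1) * (2 * var .pow) + var .k) (var .acc))))

/-- The convolution of the two languages, weighted by attribute `pass`. -/
def convolve : Cmd :=
  forTo .k (2 * var .pow) (store .buf (var .k) 0) ⨾
  forTo .k (var .cnt) (
    ite (get .common (get .code (var .k)))
      (store .buf (get .key (var .k)) ((get .buf (get .key (var .k)) +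
        get .unit (get .attr (var .k * (2 * var .n + 1) + var .pass))) % var .modulus))
      skip) ⨾
  transform m ⨾
  forTo .k (var .pow) (
    store .buf (var .k) (get .buf (var .n * (2 * var .pow) + var .k) *
      get .buf (var .n * (2 * var .pow) + (var .pow + var .k)) % var .modulus) ⨾
    store .buf (var .pow + var .k) 0) ⨾
  transform m

/-- Reads the attribute `pass` of all combinations off the convolution. -/
def decode : Cmd :=
  forTo .k (var .pow) (
    ite (var .pass) skip
      (store .base (var .k) (get .buf (var .n * (2 * var .pow) + var .k))) ⨾
    forTo .c (lit m) (
      assign .acc (get .base (var .k) * get .unit (var .c) % var .modulus) ⨾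
      -- With truncated subtraction both differences vanish exactly when the numbers are equal.
      ite ((get .buf (var .n * (2 * var .pow) + var .k) - var .acc) +
          (var .acc - get .buf (var .n * (2 * var .pow) + var .k)))
        skip (store .res (var .pass * var .pow + var .k) (var .c))))

/-- Writes the combinations. -/
def output : Cmd :=
  forTo .k (var .pow) (
    ite (get .base (var .k))
      (write 1 ⨾ forTo .j (2 * var .n) (write (get .res ((var .j + 1) * var .pow + var .k))))
      skip) ⨾
  write 0

/-- The whole program. -/
def joinProgram : Cmd :=
  setup m p g ⨾ readAll ⨾ branching ⨾ keys ⨾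
  forTo .pass (2 * var .n + 1) (convolve m ⨾ decode m) ⨾ output

end Program

/-! ### Size estimates and the initialisation -/

/-- The numerical parameters of a run. -/
structure Params (m p g n L : ℕ) : Prop where
  two_le : 2 ≤ m
  prime : p.Prime
  lt_prime : m < p
  root_lt : g < p
  le_bound : 16 * p ^ (3 * n + 2) ≤ L

namespace Params

variable {m p g n L : ℕ} (h : Params m p g n L)
include h

theorem two_mul_pow_le : 2 * m ^ n ≤ p ^ (3 * n + 2) := by
  have := h.lt_prime
  have := h.two_le
  calc 2 * m ^ n ≤ p ^ 2 * p ^ (3 * n) := by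
        gcongr
        · nlinarith
        · omega
        · omega
    _ = _ := by ring

theorem two_pow_le : 2 * 2 ^ n ≤ p ^ (3 * n + 2) :=
  le_trans (Nat.mul_le_mul_left 2 (Nat.pow_le_pow_left h.two_le n)) h.two_mul_pow_le

/-- The left side bounds the scaled number of pairs at one index, see `scale_mul_card_lt`. This is
the reason for the exponent `3 * n + 2`: the extra `p ^ 2` exceeds `4`. -/
theorem four_mul_lt : 4 * m ^ (3 * n) < p ^ (3 * n + 2) := by
  have := h.lt_prime
  have := h.two_le
  have h3 : m ^ (3 * n) ≤ p ^ (3 * n) := Nat.pow_le_pow_left (by omega) _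
  have h4 : 0 < p ^ (3 * n) := pow_pos (by omega) _
  have h5 : 4 < p ^ 2 := by nlinarith
  calc 4 * m ^ (3 * n) ≤ 4 * p ^ (3 * n) := by gcongr
    _ < p ^ 2 * p ^ (3 * n) := by gcongr
    _ = _ := by ring

theorem lt_modulus : 3 * n + 2 < p ^ (3 * n + 2) :=
  Nat.lt_pow_self (by have := h.lt_prime; have := h.two_le; omega)

theorem prime_le : p ≤ p ^ (3 * n + 2) := by
  have := h.prime
  exact Nat.le_self_pow (by omega) p

end Params

/-- The state after `setup`. -/
structure Ready (m p g n : ℕ) (s : St) : Prop where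
  dim : s.var .n = n
  pow : s.var .pow = m ^ n
  two : s.var .two = 2 ^ n
  modulus : s.var .modulus = p ^ (3 * n + 2)
  place : ∀ j < n, s.arr .place j = m ^ j
  unit_lt : ∀ e < m, s.arr .unit e < p ^ (3 * n + 2)
  unit : ∀ e < m, (s.arr .unit e : ZMod (p ^ (3 * n + 2))) =
    ((g : ZMod (p ^ (3 * n + 2))) ^ p ^ (3 * n + 2)) ^ e

theorem Ready.congr {m p g n : ℕ} {s s' : St} (h : Ready m p g n s)
    (hn : s'.var .n = s.var .n) (hp : s'.var .pow = s.var .pow) (ht : s'.var .two = s.var .two)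
    (hm : s'.var .modulus = s.var .modulus) (hq : s'.arr .place = s.arr .place)
    (hu : s'.arr .unit = s.arr .unit) : Ready m p g n s' := by
  constructor
  · rw [hn, h.dim]
  · rw [hp, h.pow]
  · rw [ht, h.two]
  · rw [hm, h.modulus]
  · rw [hq]; exact h.place
  · rw [hu]; exact h.unit_lt
  · rw [hu]; exact h.unit

end Imp

namespace Imp

open Imp.Expr Imp.Cmd Portal Finset

variable {m p g n L : ℕ}

/-- The number of steps of `setup`. -/
abbrev setupTime (m p n : ℕ) : ℕ :=
  n * (4 + 2) + 2 +
    ((3 * n + 2) * (p * (1 + 2) + 2 + 1 + 1 + 2) + 2 + (m * (2 + 2) + 2 + 1) + 1) + 4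

/-- Correctness and running time of `setup`. -/
theorem tri_setup (h : Params m p g n L) {rest : List ℕ} :
    Tri L (setup m p g) (.init (n :: rest)) (setupTime m p n) fun s =>
      Frame (setup m p g) (.init (n :: rest)) s ∧ s.inp = rest ∧ Ready m p g n s := by
  have hm := h.two_le
  have hmp := h.lt_prime
  have hg := h.root_lt
  have hL := h.le_bound
  have hM := h.two_mul_pow_le
  have h2 := h.two_pow_le
  have hn := h.lt_modulus
  have hp := h.prime_le
  have mono : ∀ {a b i : ℕ}, 0 < a → i ≤ b → a ^ i ≤ a ^ b := fun ha h =>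
    Nat.pow_le_pow_right ha h
  refine Tri.frame ?_
  unfold setup
  refine Tri.read_seq rfl <| Tri.assign_seq (by simp; omega) <|
    Tri.assign_seq (by simp; omega) <| Tri.assign_seq ?_ <|
    Tri.andThen
    (Tri.forTo (K := n) (T := 4) (fun i s => s.var .pow = m ^ i ∧ s.var .two = 2 ^ i ∧
      s.var .modulus = p ^ (3 * i + 2) ∧ ∀ j < i, s.arr .place j = m ^ j) rfl (by omega) ?_
      (by exact fun _ _ _ h => h) ?_ ?_) ?_
  · simp
    have := mono (a := p) (show 0 < p by omega) (show 2 ≤ 3 * n + 2 by omega)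
    omega
  · intro s' hf
    simp [hf.var .n rfl]
  · simp
  · rintro i hi s - hv ⟨h1, h2, h3, h4⟩
    have a1 := mono (a := m) (show 0 < m by omega) (show i ≤ n by omega)
    have a2 := mono (a := m) (show 0 < m by omega) (show i + 1 ≤ n by omega)
    have a3 := mono (a := 2) (show 0 < 2 by omega) (show i + 1 ≤ n by omega)
    have a4 := mono (a := p) (show 0 < p by omega) (show 3 * (i + 1) + 2 ≤ 3 * n + 2 by omega)
    have e1 : s.var .modulus * p ^ 3 = p ^ (3 * (i + 1) + 2) := by rw [h3]; ring
    refine Tri.store_seq ?_ <| Tri.assign_seq ?_ <| Tri.assign_seq ?_ <| Tri.assign ?_ ?_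
    · simp [h1]; omega
    · simp [h1, ← pow_succ]; omega
    · simp [h2, ← pow_succ]; omega
    · simp [e1]; omega
    · simp [h1, h2, e1, ← pow_succ, hv]
      intro j hj
      by_cases hji : j = i
      · simp [hji]
      · simp [hji, h4 j (by omega)]
  rintro s ⟨hf, e1, e2, e3, e4⟩
  have en : s.var .n = n := by rw [hf.var .n rfl]; simp [St.setVar]
  have einp : s.inp = rest := by rw [hf.inp rfl]; simp [St.setVar]
  clear hf
  have hN : 0 < p ^ (3 * n + 2) := by omega
  have hmod : ∀ a, a % p ^ (3 * n + 2) < p ^ (3 * n + 2) := fun a => Nat.mod_lt _ hN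
  -- Each round takes a `p`-th power, so `3 * n + 2` rounds reach the exponent `p ^ (3 * n + 2)`,
  -- which would be far too large for multiplying one factor at a time.
  refine Tri.assign_seq (by simp; omega) <| Tri.andThen
    (Tri.forTo (K := 3 * n + 2) (fun i s => (s.var .root : ZMod (p ^ (3 * n + 2))) = g ^ p ^ i ∧
      s.var .root < p ^ (3 * n + 2)) rfl (by omega) ?_ (by exact fun _ _ _ h => h) ?_ ?_) ?_
  · intro s' hf
    simp [hf.var .n rfl, en]
  · simp; omega
  · rintro i hi s1 hf - ⟨h1, h1'⟩
    have en1 : s1.var .modulus = p ^ (3 * n + 2) := by rw [hf.var .modulus rfl]; simp [e3]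
    clear hf
    refine Tri.assign_seq (by simp; omega) ?_
    refine Tri.andThen (T₂ := 1)
      (Tri.forTo (K := p) (T := 1) (fun i s => (s.var .acc : ZMod (p ^ (3 * n + 2))) =
        s1.var .root ^ i ∧ s.var .acc < p ^ (3 * n + 2)) rfl (by omega) ?_ (by exact fun _ _ _ h => h) ?_ ?_) ?_
    · intro s' hf
      simp
    · simp; omega
    · rintro i hi s2 hf - ⟨h2, h2'⟩
      have hf1 := hf.var .modulus rfl
      have hf2 := hf.var .root rfl
      simp [en1] at hf1 hf2
      have := hmod (s2.var .acc * s1.var .root)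
      refine Tri.assign (by simp [hf1, hf2]; omega) ?_
      simp [hf1, hf2, this, h2, pow_succ _ i]
    · rintro s2 ⟨-, h2, h2'⟩
      refine Tri.assign (T := 0) (by simp; omega) ?_
      simp [h2, h2', h1, pow_succ _ i, ← pow_mul]
  rintro s1 ⟨hf, h1, h1'⟩
  have fn := hf.var .n rfl
  have fp := hf.var .pow rfl
  have ft := hf.var .two rfl
  have fm := hf.var .modulus rfl
  have fq := hf.arr .place rfl
  have fi := hf.inp rfl
  simp [en, e1, e2, e3, einp] at fn fp ft fm fq fi
  clear hf
  refine Tri.assign_seq (by simp; omega) <| Tri.mono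
    (Tri.forTo (K := m) (T := 2) (fun i s => (s.var .acc : ZMod (p ^ (3 * n + 2))) =
      ((g : ZMod (p ^ (3 * n + 2))) ^ p ^ (3 * n + 2)) ^ i ∧ s.var .acc < p ^ (3 * n + 2) ∧
      (∀ e < i, s.arr .unit e < p ^ (3 * n + 2)) ∧ ∀ e < i,
        (s.arr .unit e : ZMod (p ^ (3 * n + 2))) =
          ((g : ZMod (p ^ (3 * n + 2))) ^ p ^ (3 * n + 2)) ^ e)
      rfl (by omega) ?_ (by exact fun _ _ _ h => h) ?_ ?_) le_rfl ?_
  · intro s' hf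
    simp
  · simp; omega
  · rintro i hi s2 hf hv ⟨h2, h3, h4, h5⟩
    have hf1 := hf.var .modulus rfl
    have hf2 := hf.var .root rfl
    simp [fm] at hf1 hf2
    have := hmod (s2.var .acc * s1.var .root)
    refine Tri.store_seq (by simp; omega) <| Tri.assign (T := 0) (by simp [hf1, hf2]; omega) ?_
    simp only [St.setVar_var, St.setArr_var, St.setVar_arr, St.setArr_arr, eval_mod, eval_mul,
      eval_var, hf1, hf2, hv, if_true, reduceCtorEq, if_false, ZMod.natCast_mod, Nat.cast_mul, h1,
      h2, pow_succ _ i, this, true_and]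
    constructor
    · intro e he
      by_cases hei : e = i
      · simp [hei, h3]
      · simp [hei]; exact h4 e (by omega)
    · intro e he
      by_cases hei : e = i
      · simp [hei, h2]
      · simp [hei]; exact h5 e (by omega)
  · rintro s2 ⟨hf, -, -, h4, h5⟩
    have gn := hf.var .n rfl
    have gp := hf.var .pow rfl
    have gt := hf.var .two rfl
    have gm := hf.var .modulus rfl
    have gq := hf.arr .place rfl
    have gi := hf.inp rfl
    simp [fn, fp, ft, fm, fq, fi] at gn gp gt gm gq gi
    exact ⟨gi, gn, gp, gt, gm, by rw [gq]; exact e4, h4, h5⟩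

end Imp

/-! ### Bit prefixes as nodes of a binary tree, and attributes of strings -/

namespace Portal

/-- The position in the binary tree of the first `i` bits of a string. -/
def heap {m n : ℕ} (x : StateString m n) : ℕ → ℕ
  | 0 => 1
  | i + 1 => heap x i * 2 + bit x i

variable {m n : ℕ}

theorem heap_mem (x : StateString m n) (i : ℕ) : 2 ^ i ≤ heap x i ∧ heap x i < 2 * 2 ^ i := by
  induction i with
  | zero => simp [heap]
  | succ i ih =>
    have := bit_le_one x i
    rw [heap, pow_succ]
    omega

theorem heap_eq_iff (x y : StateString m n) (i : ℕ) :
    heap x i = heap y i ↔ ∀ j < i, bit x j = bit y j := by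
  induction i with
  | zero => simp [heap]
  | succ i ih =>
    have := bit_le_one x i
    have := bit_le_one y i
    rw [heap, heap]
    constructor
    · intro h j hj
      by_cases hji : j = i
      · subst hji; omega
      · exact ih.1 (by omega) j (by omega)
    · intro h
      have h1 := ih.2 fun j hj => h j (by omega)
      have h2 := h i (by omega)
      omega

/-- Attribute `a` of a string of language number `sd`: `0` for `a = 0`, then alternately the
bits (`0` in the second language) and the weights. -/
def attrVal (sd : ℕ) (x : StateString m n) (a : ℕ) : ℕ :=
  if a = 0 then 0 else if a % 2 = 1 then bit x (a / 2) * (1 - sd) else wt x (a / 2 - 1)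

theorem attrVal_odd (sd : ℕ) (x : StateString m n) (j : ℕ) :
    attrVal sd x (2 * j + 1) = bit x j * (1 - sd) := by
  rw [attrVal, if_neg (by omega), if_pos (by omega)]
  congr 2; omega

theorem attrVal_even (sd : ℕ) (x : StateString m n) (j : ℕ) :
    attrVal sd x (2 * j + 2) = wt x j := by
  rw [attrVal, if_neg (by omega), if_neg (by omega)]
  congr 1; omega

theorem attrVal_lt (hm : 2 ≤ m) (sd : ℕ) (x : StateString m n) (a : ℕ) : attrVal sd x a < m := by
  have hb := bit_le_one x (a / 2)
  have hw := wt_lt (by omega) x (a / 2 - 1)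
  rw [attrVal]
  split_ifs
  · omega
  · exact (Nat.mul_le_mul hb (Nat.sub_le 1 sd)).trans_lt (by omega)
  · assumption

theorem encodeString_eq (x : StateString m n) :
    encodeString x = (List.range n).flatMap fun j => [bit x j, wt x j] := by
  have h : List.range n = (List.finRange n).map Fin.val := by simp
  rw [encodeString, List.ofFn_eq_map, h, List.flatMap_map, List.flatMap_map]
  congr 1
  funext i
  simp [bit, wt]

end Portal

/-! ### Reading the languages into tables -/

namespace Imp

open Imp.Expr Imp.Cmd Portal Finset

variable {m p g n L : ℕ}

open Classical in
/-- The tables hold the strings `its`, each with the number of its language. -/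
structure Loaded (its : List (ℕ × StateString m n)) (s : St) : Prop where
  cnt : s.var .cnt = its.length
  bits : ∀ k (hk : k < its.length), ∀ j < n, s.arr .bits (k * n + j) = bit its[k].2 j
  attr : ∀ k (hk : k < its.length), ∀ a < 2 * n + 1,
    s.arr .attr (k * (2 * n + 1) + a) = attrVal its[k].1 its[k].2 a
  attr_zero : ∀ i, its.length * (2 * n + 1) ≤ i → s.arr .attr i = 0
  side : ∀ k (hk : k < its.length), s.arr .side k = its[k].1
  code : ∀ k (hk : k < its.length), s.arr .code k = heap its[k].2 n
  seen : ∀ v sd, sd < 2 →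
    s.arr .seen (v * 2 + sd) = if ∃ it ∈ its, it.1 = sd ∧ heap it.2 n = v then 1 else 0

theorem Loaded.congr {its : List (ℕ × StateString m n)} {s s' : St} (h : Loaded its s)
    (hc : s'.var .cnt = s.var .cnt)
    (ha : ∀ a, a = .bits ∨ a = .attr ∨ a = .side ∨ a = .code ∨ a = .seen → s'.arr a = s.arr a) :
    Loaded its s' := by
  constructor
  · rw [hc, h.cnt]
  · rw [ha _ (by simp)]; exact h.bits
  · rw [ha _ (by simp)]; exact h.attr
  · rw [ha _ (by simp)]; exact h.attr_zero
  · rw [ha _ (by simp)]; exact h.side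
  · rw [ha _ (by simp)]; exact h.code
  · rw [ha _ (by simp)]; exact h.seen

/-- `readString` appends one string to the tables. -/
theorem tri_readString {its : List (ℕ × StateString m n)} {x : StateString m n} {s : St}
    {sd : ℕ} {rest : List ℕ} (h2 : 2 * 2 ^ n ≤ L) (hm : 2 ≤ m) (hmL : m ≤ L)
    (hn : n ≤ L) (hl : its.length < L)
    (hs : Loaded its s) (hdim : s.var .n = n) (hside : s.var .side = sd) (hsd : sd < 2)
    (hinp : s.inp = encodeString x ++ rest) :
    Tri L readString s (n * (6 + 2) + 2 + 4 + 1) fun s' => Loaded (its ++ [(sd, x)]) s' ∧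
      s'.inp = rest := by
  have hpow : ∀ i ≤ n, 2 ^ i ≤ 2 ^ n := fun i hi => Nat.pow_le_pow_right (by omega) hi
  unfold readString
  refine Tri.assign_seq (by simp; omega) <| Tri.andThen (T₂ := 4)
    (Tri.forTo (K := n) (T := 6) (fun j s' =>
      s'.inp = ((List.range n).drop j).flatMap (fun j => [bit x j, wt x j]) ++ rest ∧
      s'.var .code = heap x j ∧
      (∀ i, s'.arr .bits i = if its.length * n ≤ i ∧ i < its.length * n + j then
        bit x (i - its.length * n) else s.arr .bits i) ∧
      (∀ i, s'.arr .attr i = if its.length * (2 * n + 1) + 1 ≤ i ∧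
        i < its.length * (2 * n + 1) + 1 + 2 * j then
          attrVal sd x (i - its.length * (2 * n + 1)) else s.arr .attr i)) rfl (by omega) ?_
      (by exact fun _ _ _ h => h) ?_ ?_) ?_
  · intro s' hf
    simp [hf.var .n rfl, hdim]
  · refine ⟨by simp [hinp, encodeString_eq], by simp [heap], fun i => ?_, fun i => ?_⟩
    · rw [if_neg (by omega)]; rfl
    · rw [if_neg (by omega)]; rfl
  · rintro j hj s1 hf hv ⟨i1, i2, i3, i4⟩
    have fc := hf.var .cnt rfl
    have fn := hf.var .n rfl
    have fs := hf.var .side rfl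
    simp [hs.cnt, hdim, hside] at fc fn fs
    clear hf
    have hd : (List.range n).drop j = j :: (List.range n).drop (j + 1) := by
      rw [List.drop_eq_getElem_cons (by simpa using hj)]
      simp
    rw [hd, List.flatMap_cons, List.append_assoc, List.cons_append, List.cons_append,
      List.nil_append] at i1
    have hb := bit_le_one x j
    have hw := wt_lt (by omega) x j
    have hh := heap_mem x (j + 1)
    have hp := hpow (j + 1) (by omega)
    have e1 := attrVal_odd sd x j
    have e2 := attrVal_even sd x j
    refine Tri.read_seq i1 <| Tri.read_seq rfl <| Tri.store_seq ?_ <| Tri.store_seq ?_ <|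
      Tri.store_seq ?_ <| Tri.assign (T := 0) ?_ ?_
    · simp [St.setVar]; omega
    · simp [St.setVar, fs]
      exact (Nat.mul_le_mul hb (Nat.sub_le 1 sd)).trans (by omega)
    · simp [St.setVar]; omega
    · simp [St.setVar, i2]
      rw [heap] at hh
      omega
    · refine ⟨by simp, by simp [St.setVar, i2, heap], fun i => ?_, fun i => ?_⟩
      · simp [St.setVar, i3, fc, fn, hv, Function.update_apply]
        split_ifs with c1 c2 c3 c4 <;> first | rfl | omega | skip
        · congr 1; omega
      · simp [St.setVar, i4, fc, fn, fs, hv, Function.update_apply]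
        split_ifs with c1 c2 c3 c4 <;> first | rfl | omega | skip
        · rw [← e2]; congr 1; omega
        · rw [← e1]; congr 1; omega
  · rintro s1 ⟨hf, i1, i2, i3, i4⟩
    have fc := hf.var .cnt rfl
    have fs := hf.var .side rfl
    have g1 := hf.arr .side rfl
    have g2 := hf.arr .code rfl
    have g3 := hf.arr .seen rfl
    simp [hs.cnt, hdim, hside] at fc fs g1 g2 g3
    clear hf
    have hh := heap_mem x n
    refine Tri.store_seq (by simp; omega) <| Tri.store_seq (by simp; omega) <|
      Tri.store_seq (by simp; omega) <| Tri.assign (T := 0) (by simp; omega) ?_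
    refine ⟨⟨?_, ?_, ?_, ?_, ?_, ?_, ?_⟩, ?_⟩
    · simp [fc]
    · intro k hk j hj
      simp at hk
      simp only [St.setVar_arr, St.setArr_arr, reduceCtorEq, if_false, i3]
      by_cases hki : k = its.length
      · subst hki
        rw [if_pos (by omega)]
        simp
      · have hk' : k < its.length := by omega
        have : (k + 1) * n ≤ its.length * n := Nat.mul_le_mul_right _ (by omega)
        rw [add_mul, one_mul] at this
        rw [if_neg (by omega), hs.bits k hk' j hj, List.getElem_append_left hk']
    · intro k hk j hj
      simp at hk
      simp only [St.setVar_arr, St.setArr_arr, reduceCtorEq, if_false, i4]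
      by_cases hki : k = its.length
      · subst hki
        by_cases hj0 : j = 0
        · subst hj0
          -- Slot `0` of each block is never written; it has to be `0` in the counting pass and is
          -- so from the start.
          rw [if_neg (by omega), hs.attr_zero _ (by omega)]
          simp [attrVal]
        · rw [if_pos (by omega)]
          simp
      · have hk' : k < its.length := by omega
        have : (k + 1) * (2 * n + 1) ≤ its.length * (2 * n + 1) :=
          Nat.mul_le_mul_right _ (by omega)
        rw [add_mul, one_mul] at this
        rw [if_neg (by omega), hs.attr k hk' j hj, List.getElem_append_left hk']
    · intro i hi
      simp only [List.length_append, List.length_singleton, add_mul, one_mul] at hi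
      simp only [St.setVar_arr, St.setArr_arr, reduceCtorEq, if_false, i4]
      rw [if_neg (by omega), hs.attr_zero _ (by omega)]
    · intro k hk
      simp at hk
      by_cases hki : k = its.length
      · subst hki
        simp [fc, fs]
      · simp [fc, hki, g1, hs.side k (by omega), List.getElem_append_left (show k < its.length by omega)]
    · intro k hk
      simp at hk
      by_cases hki : k = its.length
      · subst hki
        simp [fc, i2]
      · simp [fc, hki, g2, hs.code k (by omega), List.getElem_append_left (show k < its.length by omega)]
    · intro v sd' hsd'
      simp only [St.setVar_arr, St.setArr_arr, reduceCtorEq, if_false, if_true, g3, i2, fs,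
        St.setArr_var, eval_add, eval_mul, eval_var, eval_ofNat, eval_one, Function.update_apply,
        hs.seen v sd' hsd', List.mem_append, List.mem_singleton]
      by_cases hc : v * 2 + sd' = heap x n * 2 + sd
      · rw [if_pos hc, if_pos]
        refine ⟨(sd, x), by simp, ?_, ?_⟩ <;> simp <;> omega
      · rw [if_neg hc]
        congr 1
        rw [eq_iff_iff]
        constructor
        · rintro ⟨it, h1, h2⟩
          exact ⟨it, List.mem_append_left _ h1, h2⟩
        · rintro ⟨it, h1, h2, h3⟩
          rcases List.mem_append.1 h1 with h1 | h1
          · exact ⟨it, h1, h2, h3⟩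
          · rw [List.mem_singleton] at h1
            subst h1
            exact absurd (by simp at h2 h3; omega) hc
    · rw [List.drop_of_length_le (by simp)] at i1
      simpa using i1

end Imp

namespace Imp

open Imp.Expr Imp.Cmd Portal Finset

variable {m p g n L : ℕ}

/-- The number of steps of `readString`. -/
abbrev readTime (n : ℕ) : ℕ := n * (6 + 2) + 2 + 4 + 1

/-- The flag in front of the next string has been read when the loop is tested, so the encoding
consists of the variable `flag` followed by the remaining input. -/
theorem tri_readList (h2 : 2 * 2 ^ n ≤ L) (hm : 2 ≤ m) (hmL : m ≤ L) (hn : n ≤ L) {sd : ℕ}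
    (hsd : sd < 2) {rest : List ℕ} (l : List (StateString m n)) :
    ∀ (its : List (ℕ × StateString m n)) (s : St), its.length + l.length ≤ L → Loaded its s →
      s.var .n = n → s.var .side = sd → s.var .flag :: s.inp = encodeStrings l ++ rest →
      Tri L (.loop (var .flag) (readString ⨾ read .flag)) s (l.length * (readTime n + 2) + 1)
        fun s' => Loaded (its ++ l.map (sd, ·)) s' ∧ s'.inp = rest := by
  induction l with
  | nil =>
    intro its s hl hs hdim hside hinp
    simp [encodeStrings] at hinp
    refine Tri.loopEnd (by simp [hinp.1]) ?_
    simpa [hinp.2] using hs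
  | cons x l ih =>
    intro its s hl hs hdim hside hinp
    simp [encodeStrings] at hinp hl
    refine (Tri.loopStep (T := readTime n + 1) (T' := l.length * (readTime n + 2) + 1)
      (by simp [hinp.1]) ?_).mono_time (by simp only [List.length_cons]; apply le_of_eq; ring)
    refine Tri.andThen (tri_readString h2 hm hmL hn (by omega) hs hdim hside hsd hinp.2).frame ?_
    rintro s1 ⟨hf, hs1, hi1⟩
    have f1 := hf.var .n rfl
    have f2 := hf.var .side rfl
    obtain ⟨v, r, hvr⟩ : ∃ v r, s1.inp = v :: r := by
      rcases h : s1.inp with _ | ⟨v, r⟩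
      · rw [h] at hi1
        have := congrArg List.length hi1
        simp [encodeStrings] at this
      · exact ⟨v, r, rfl⟩
    refine Tri.read (T := 0) hvr ?_
    refine (ih (its ++ [(sd, x)]) { s1.setVar .flag v with inp := r } (by simp; omega) (hs1.congr (by simp [St.setVar]) fun a _ => rfl)
      ?_ ?_ ?_).mono
      le_rfl ?_
    · simp [St.setVar, f1, hdim]
    · simp [St.setVar, f2, hside]
    · simp only [St.setVar, Function.update_self]
      rw [← hvr, hi1]
      simp [encodeStrings]
    · rintro s' ⟨h1, h3⟩
      simpa using And.intro h1 h3

/-- Correctness and running time of `readAll`. -/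
theorem tri_readAll (h2 : 2 * 2 ^ n ≤ L) (hm : 2 ≤ m) (hmL : m ≤ L) (hn : n ≤ L)
    (hM : 2 * m ^ n ≤ L)
    {l₁ l₂ : List (StateString m n)} (hl₁ : l₁.length ≤ m ^ n) (hl₂ : l₂.length ≤ m ^ n) {s : St}
    (hs : Loaded ([] : List (ℕ × StateString m n)) s) (hdim : s.var .n = n)
    (hinp : s.inp = encodeStrings l₁ ++ encodeStrings l₂) :
    Tri L readAll s (2 * (m ^ n * (readTime n + 2) + 1 + 1 + 2) + 2) fun s' =>
      Frame readAll s s' ∧ Loaded (l₁.map (0, ·) ++ l₂.map (1, ·)) s' := by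
  let ls : ℕ → List (StateString m n) := fun i => if i = 0 then l₁ else if i = 1 then l₂ else []
  let its : ℕ → List (ℕ × StateString m n) := fun i =>
    (List.range i).flatMap fun i => (ls i).map (i, ·)
  have hits : its 2 = l₁.map (0, ·) ++ l₂.map (1, ·) := by
    simp [its, ls, List.range_succ]
  rw [← hits]
  unfold readAll
  refine Tri.mono (Tri.forTo (K := 2) (fun i s' => Loaded (its i) s' ∧
    s'.inp = if i = 0 then encodeStrings l₁ ++ encodeStrings l₂ else
      if i = 1 then encodeStrings l₂ else []) rfl (by omega) (fun _ _ => by simp)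
    (by exact fun i s' v h => ⟨h.1.congr (by simp) (fun _ _ => rfl), h.2⟩) ?_ ?_) le_rfl ?_
  · exact ⟨by simpa [its] using hs, by simp [hinp]⟩
  · rintro i hi s1 hf hv ⟨h1, h3⟩
    have fn := hf.var .n rfl
    rw [hdim] at fn
    have hlen : (its i).length + (ls i).length ≤ 2 * m ^ n ∧ (ls i).length ≤ m ^ n := by
      interval_cases i <;> simp [its, ls] <;> omega
    have hnext : its (i + 1) = its i ++ (ls i).map (i, ·) := by
      simp [its, List.range_succ]
    obtain ⟨rest, hrest, hrest'⟩ : ∃ rest, s1.inp = encodeStrings (ls i) ++ rest ∧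
        rest = if i + 1 = 0 then encodeStrings l₁ ++ encodeStrings l₂ else
      if i + 1 = 1 then encodeStrings l₂ else [] := by
      interval_cases i <;> simp [h3, ls]
    obtain ⟨v, r, hvr⟩ : ∃ v r, s1.inp = v :: r := by
      rcases h : s1.inp with _ | ⟨v, r⟩
      · rw [h] at hrest
        have := congrArg List.length hrest
        simp [encodeStrings] at this
      · exact ⟨v, r, rfl⟩
    refine Tri.read_seq hvr ?_
    refine (tri_readList h2 hm hmL hn hi (rest := rest) (ls i) (its i)
      { s1.setVar .flag v with inp := r } (by omega)
      (h1.congr (by simp [St.setVar]) fun a _ => rfl) ?_ ?_ ?_).mono ?_ ?_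
    · simp [St.setVar, fn]
    · simp [St.setVar, hv]
    · simp only [St.setVar, Function.update_self]
      rw [← hvr, hrest]
    · gcongr; exact hlen.2
    · rintro s' ⟨h4, h5⟩
      rw [hnext]
      exact ⟨h4, h5.trans hrest'⟩
  · rintro s' ⟨h1, h3, -⟩
    exact ⟨h1, h3⟩

/-! ### Common σ-vectors and branching positions -/

open Classical in
/-- The specification of the tables of common vectors and of branching positions. -/
structure Branched (L₁ L₂ : Set (StateString m n)) (s : St) : Prop where
  common : ∀ x : StateString m n,
    s.arr .common (heap x n) = if ∃ y ∈ common L₁ L₂, heap y n = heap x n then 1 else 0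
  branch : ∀ j < n, s.arr .branch j = if Branch (Portal.common L₁ L₂) j then 1 else 0

/-- Correctness and running time of `branching`. -/
theorem tri_branching (h2 : 2 * 2 ^ n ≤ L) (hn : n ≤ L)
    {L₁ L₂ : Set (StateString m n)} {its : List (ℕ × StateString m n)}
    (h₁ : ∀ x, (0, x) ∈ its ↔ x ∈ L₁) (h₂ : ∀ x, (1, x) ∈ its ↔ x ∈ L₂) {s : St}
    (hs : Loaded its s) (hdim : s.var .n = n) (htwo : s.var .two = 2 ^ n)
    (hb : s.arr .branch = fun _ => 0) :
    Tri L branching s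
      (2 ^ n * (1 + 2) + 2 + (n * (2 ^ n * (5 + 2) + 2 + 1 + 2) + 2 + 1)) fun s' =>
      Frame branching s s' ∧ Branched L₁ L₂ s' := by
  classical
  have hpow : ∀ i ≤ n, 2 ^ i ≤ 2 ^ n := fun i hi => Nat.pow_le_pow_right (by omega) hi
  let A := common L₁ L₂
  -- The flag of a tree node: whether node `v` of level `i` lies on the path of a string in `A`.
  let good : ℕ → ℕ → ℕ := fun i v => if ∃ x ∈ A, heap x i = v then 1 else 0
  have hgood : ∀ i v, good i v ≤ 1 := fun i v => by simp only [good]; split_ifs <;> omega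
  have hchild : ∀ i v, good i v = good (i + 1) (v * 2) + good (i + 1) (v * 2 + 1) -
      good (i + 1) (v * 2) * good (i + 1) (v * 2 + 1) := by
    intro i v
    have : (∃ x ∈ A, heap x i = v) ↔ (∃ x ∈ A, heap x (i + 1) = v * 2) ∨
        ∃ x ∈ A, heap x (i + 1) = v * 2 + 1 := by
      constructor
      · rintro ⟨x, hx, rfl⟩
        have := bit_le_one x i
        by_cases h0 : bit x i = 0
        · exact Or.inl ⟨x, hx, by rw [heap]; omega⟩
        · exact Or.inr ⟨x, hx, by rw [heap]; omega⟩
      · rintro (⟨x, hx, h⟩ | ⟨x, hx, h⟩) <;>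
        · have := bit_le_one x i
          rw [heap] at h
          exact ⟨x, hx, by omega⟩
    simp only [good, this]
    by_cases a : ∃ x ∈ A, heap x (i + 1) = v * 2 <;>
      by_cases b : ∃ x ∈ A, heap x (i + 1) = v * 2 + 1 <;> simp only [a, b] <;> simp
  -- A position branches exactly when some node of its level has both children on paths of `A`.
  have hbranch : ∀ i, Branch A i ↔ ∃ v, good (i + 1) (v * 2) * good (i + 1) (v * 2 + 1) ≠ 0 := by
    intro i
    have e : ∀ v, good (i + 1) (v * 2) * good (i + 1) (v * 2 + 1) ≠ 0 ↔
        (∃ x ∈ A, heap x (i + 1) = v * 2) ∧ ∃ x ∈ A, heap x (i + 1) = v * 2 + 1 := by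
      intro v
      simp only [good]
      by_cases a : ∃ x ∈ A, heap x (i + 1) = v * 2 <;>
        by_cases b : ∃ x ∈ A, heap x (i + 1) = v * 2 + 1 <;> simp only [a, b] <;> simp
    simp only [e]
    constructor
    · rintro ⟨x, hx, y, hy, hlt, hx0, hy1⟩
      refine ⟨heap x i, ⟨x, hx, by rw [heap, hx0]; rfl⟩, y, hy, ?_⟩
      rw [heap, hy1, (heap_eq_iff x y i).2 hlt]
    · rintro ⟨v, ⟨x, hx, h⟩, y, hy, h'⟩
      have := bit_le_one x i
      have := bit_le_one y i
      rw [heap] at h h'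
      exact ⟨x, hx, y, hy, (heap_eq_iff x y i).1 (by omega), by omega, by omega⟩
  have hleaf : ∀ v, s.arr .seen (v * 2) * s.arr .seen (v * 2 + 1) = good n v := by
    intro v
    have e0 := hs.seen v 0 (by omega)
    have e1 := hs.seen v 1 (by omega)
    rw [add_zero] at e0
    rw [e0, e1]
    have i0 : (∃ it ∈ its, it.1 = 0 ∧ heap it.2 n = v) ↔ ∃ x ∈ L₁, heap x n = v :=
      ⟨by rintro ⟨⟨_, x⟩, h, rfl, h'⟩; exact ⟨x, (h₁ x).1 h, h'⟩,
        by rintro ⟨x, hx, h⟩; exact ⟨(0, x), (h₁ x).2 hx, rfl, h⟩⟩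
    have i1 : (∃ it ∈ its, it.1 = 1 ∧ heap it.2 n = v) ↔ ∃ x ∈ L₂, heap x n = v :=
      ⟨by rintro ⟨⟨_, x⟩, h, rfl, h'⟩; exact ⟨x, (h₂ x).1 h, h'⟩,
        by rintro ⟨x, hx, h⟩; exact ⟨(1, x), (h₂ x).2 hx, rfl, h⟩⟩
    have i2 : (∃ x ∈ A, heap x n = v) ↔ (∃ x ∈ L₁, heap x n = v) ∧ ∃ x ∈ L₂, heap x n = v := by
      constructor
      · rintro ⟨x, ⟨hx, y, hy, hxy⟩, rfl⟩
        exact ⟨⟨x, hx, rfl⟩, y, hy, ((heap_eq_iff x y n).2 hxy).symm⟩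
      · rintro ⟨⟨x, hx, rfl⟩, y, hy, hxy⟩
        exact ⟨x, ⟨hx, y, hy, (heap_eq_iff x y n).1 hxy.symm⟩, rfl⟩
    simp only [good, i0, i1, i2]
    by_cases a : ∃ x ∈ L₁, heap x n = v <;> by_cases b : ∃ x ∈ L₂, heap x n = v <;>
      simp only [a, b] <;> simp
  refine Tri.frame ?_
  unfold branching
  refine Tri.andThen (Tri.forTo (K := 2 ^ n) (T := 1) (fun k s' => ∀ v, 2 ^ n ≤ v →
    v < 2 ^ n + k → s'.arr .common v = good n v) rfl (by omega) ?_ (by exact fun _ _ _ h => h)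
    ?_ ?_) ?_
  · intro s' hf
    simp [hf.var .two rfl, htwo]
  · intro v h1 h3; omega
  · intro k hk s1 hf hv h1
    have f1 := hf.var .two rfl
    have f2 := hf.arr .seen rfl
    rw [htwo] at f1
    have h3 := hleaf (2 ^ n + k)
    refine Tri.store (T := 0) ?_ ?_
    · simp [f1, f2, hv, h3]
      have := hgood n (2 ^ n + k)
      have := hpow n le_rfl
      have := Nat.one_le_two_pow (n := n)
      omega
    · intro v hv1 hv2
      simp [f1, f2, hv, h3, Function.update_apply]
      split_ifs with hc
      · rw [hc]
      · exact h1 v hv1 (by omega)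
  rintro s1 ⟨hf, h1⟩
  have fn := hf.var .n rfl
  have ft := hf.var .two rfl
  have fb := hf.arr .branch rfl
  rw [hdim] at fn; rw [htwo] at ft; rw [hb] at fb
  clear hf
  refine Tri.assign_seq (by simp [ft]; omega) ?_
  -- The levels are processed from the leaves upwards: after `j` rounds they are complete from `n -
  -- j` on.
  refine Tri.mono (Tri.forTo (K := n) (fun j s' => s'.var .half = 2 ^ (n - j) ∧
    (∀ i, n - j ≤ i → i ≤ n → ∀ v, 2 ^ i ≤ v → v < 2 * 2 ^ i → s'.arr .common v = good i v) ∧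
    ∀ i < n, s'.arr .branch i = if n - j ≤ i ∧ Branch A i then 1 else 0) rfl hn ?_
    (by exact fun _ _ _ h => h) ?_ ?_) le_rfl ?_
  · intro s' hf
    simp [hf.var .n rfl, fn]
  · refine ⟨by simp [ft], fun i hi1 hi2 v hv1 hv2 => ?_, fun i hi => ?_⟩
    · obtain rfl : i = n := by omega
      exact h1 v hv1 (by omega)
    · rw [if_neg (by omega)]
      simp [fb]
  · rintro j hj s2 hf hvj ⟨i1, i2, i3⟩
    have fn2 := hf.var .n rfl
    simp [fn] at fn2
    clear hf
    obtain ⟨i, rfl⟩ : ∃ i, n = i + 1 + j := ⟨n - 1 - j, by omega⟩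
    have en : i + 1 + j - j = i + 1 := by omega
    have en' : i + 1 + j - (j + 1) = i := by omega
    rw [en] at i1 i2 i3
    rw [en']
    have hpi := hpow i (by omega)
    have half : s2.var .half / 2 = 2 ^ i := by rw [i1, pow_succ, Nat.mul_div_cancel _ (by omega)]
    refine Tri.assign_seq (by simp [half]; omega) ?_
    refine Tri.mono (Tri.forTo (K := 2 ^ i) (T := 5) (fun k s' =>
      (∀ i', i + 1 ≤ i' → i' ≤ i + 1 + j → ∀ v, 2 ^ i' ≤ v → v < 2 * 2 ^ i' →
        s'.arr .common v = good i' v) ∧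
      (∀ v, 2 ^ i ≤ v → v < 2 ^ i + k → s'.arr .common v = good i v) ∧
      (∀ i' < i + 1 + j, i' ≠ i → s'.arr .branch i' = s2.arr .branch i') ∧
      (s'.arr .branch i = if ∃ v, 2 ^ i ≤ v ∧ v < 2 ^ i + k ∧
        good (i + 1) (v * 2) * good (i + 1) (v * 2 + 1) ≠ 0 then 1 else 0)) rfl (by omega) ?_
      (by exact fun _ _ _ h => h) ?_ ?_) ?_ ?_
    · intro s' hf
      simp [hf.var .half rfl, half]
    · refine ⟨i2, fun v _ _ => by omega, fun _ _ _ => rfl, ?_⟩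
      simp only [St.setVar_arr]
      rw [i3 i (by omega), if_neg (by omega), if_neg]
      rintro ⟨v, hv1, hv2, -⟩
      omega
    · rintro k hk s3 hf hvk ⟨k1, k2, k3, k4⟩
      have f1 := hf.var .half rfl
      have f2 := hf.var .n rfl
      have f3 := hf.var .j rfl
      simp [half, fn2, hvj] at f1 f2 f3
      clear hf
      have c0 := k1 (i + 1) le_rfl (by omega) ((2 ^ i + k) * 2) (by rw [pow_succ]; omega)
        (by rw [pow_succ]; omega)
      have c1 := k1 (i + 1) le_rfl (by omega) ((2 ^ i + k) * 2 + 1) (by rw [pow_succ]; omega)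
        (by rw [pow_succ]; omega)
      have g0 := hgood (i + 1) ((2 ^ i + k) * 2)
      have g1 := hgood (i + 1) ((2 ^ i + k) * 2 + 1)
      have gi := hgood i (2 ^ i + k)
      have hc := hchild i (2 ^ i + k)
      have gL : 1 ≤ L := by omega
      have ei : i + 1 + j - 1 - j = i := by omega
      refine Tri.assign_seq (by simp [f1, hvk, c0]; omega) <|
        Tri.assign_seq (by simp [f1, hvk, c1]; omega) <|
        Tri.store_seq (by simp [f1, hvk, c0, c1, ← hc]; omega) <|
        Tri.ite (T := 1) (fun hne => Tri.store (T := 0) (by simp; omega) ?_)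
          (fun hne => Tri.skip ?_)
      all_goals
        simp [f1, hvk, c0, c1] at hne
        refine ⟨fun i' h3 h4 v h5 h6 => ?_, fun v h3 h4 => ?_, fun i' h3 h4 => ?_, ?_⟩
      · simp [f1, hvk]
        rw [Function.update_of_ne, k1 i' h3 h4 v h5 h6]
        have := Nat.pow_le_pow_right (show 0 < 2 by omega) h3
        rw [pow_succ] at this
        omega
      · simp [f1, hvk, c0, c1, ← hc, Function.update_apply]
        split_ifs with hvv
        · rw [hvv]
        · exact k2 v h3 (by omega)
      · simp [f2, f3, ei, h4, k3 i' h3 h4]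
      · simp [f2, f3, ei]
        exact ⟨2 ^ i + k, by omega, by omega, hne.1, hne.2⟩
      · simp [f1, hvk]
        rw [Function.update_of_ne, k1 i' h3 h4 v h5 h6]
        have := Nat.pow_le_pow_right (show 0 < 2 by omega) h3
        rw [pow_succ] at this
        omega
      · simp [f1, hvk, c0, c1, ← hc, Function.update_apply]
        split_ifs with hvv
        · rw [hvv]
        · exact k2 v h3 (by omega)
      · simp [k3 i' h3 h4]
      · simp only [St.setArr_arr, St.setVar_arr, reduceCtorEq, if_false, k4]
        congr 1
        rw [eq_iff_iff]
        constructor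
        · rintro ⟨v, a, b, c⟩
          exact ⟨v, a, by omega, c⟩
        · rintro ⟨v, a, b, c⟩
          refine ⟨v, a, ?_, c⟩
          by_contra hlt
          obtain rfl : v = 2 ^ i + k := by omega
          exact c (Nat.mul_eq_zero.2 (by tauto))
    · have : 2 ^ i ≤ 2 ^ (i + 1 + j) := hpi
      gcongr
    · rintro s3 ⟨hf, k1, k2, k3, k4⟩
      have f1 := hf.var .half rfl
      simp [half] at f1
      refine ⟨f1, fun i' h3 h4 v h5 h6 => ?_, fun i' hi' => ?_⟩
      · rcases Nat.eq_or_lt_of_le h3 with rfl | h3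
        · exact k2 v h5 (by omega)
        · exact k1 i' h3 h4 v h5 h6
      · by_cases hii : i' = i
        · subst hii
          rw [k4]
          congr 1
          rw [eq_iff_iff, hbranch]
          constructor
          · rintro ⟨v, -, -, h⟩
            exact ⟨le_rfl, v, h⟩
          · rintro ⟨-, v, h⟩
            -- A node with a child on a path lies in the range of its level, hence was visited by
            -- the loop.
            refine ⟨v, ?_, ?_, h⟩
            all_goals
              have : good (i' + 1) (v * 2) ≠ 0 := fun h0 => h (by rw [h0, zero_mul])
              simp only [good, ne_eq, ite_eq_right_iff, one_ne_zero, imp_false, not_not] at this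
              obtain ⟨x, -, hx⟩ := this
              have := heap_mem x (i' + 1)
              rw [pow_succ] at this
              omega
        · rw [k3 i' hi' hii, i3 i' hi']
          congr 1
          rw [eq_iff_iff]
          constructor
          · rintro ⟨h3, h4⟩; exact ⟨by omega, h4⟩
          · rintro ⟨h3, h4⟩; exact ⟨by omega, h4⟩
  · rintro s2 ⟨-, -, i2, i3⟩
    refine ⟨fun x => ?_, fun j hj => ?_⟩
    · have := heap_mem x n
      exact i2 n (by omega) le_rfl _ this.1 this.2
    · rw [i3 j hj]
      congr 1
      simp [A]

end Imp

/-! ### Keys and the pairs that share an index -/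

namespace Portal

open Finset

variable {m n : ℕ}

theorem ofDig_succ (m : ℕ) (e : ℕ → ℕ) (n : ℕ) :
    ofDig m e (n + 1) = ofDig m e n + m ^ n * e n := sum_range_succ _ _

theorem pow_mod_eq {R : Type*} [Monoid R] {ω : R} {m : ℕ} (h : ω ^ m = 1) (a : ℕ) :
    ω ^ (a % m) = ω ^ a := by
  conv_rhs => rw [← Nat.div_add_mod a m, pow_add, pow_mul, h, one_pow, one_mul]

/-- The key of a string of language number `it.1`. -/
noncomputable def key (A : Set (StateString m n)) (it : ℕ × StateString m n) : ℕ :=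
  ofDig m (keyDig A it.2) n + m ^ n * it.1

theorem dig_key (hm : 2 ≤ m) (A : Set (StateString m n)) (it : ℕ × StateString m n) {j : ℕ}
    (hj : j < n) : dig m (key A it) j = keyDig A it.2 j :=
  dig_ofDig_add (by omega) (fun j _ => keyDig_lt hm A it.2 j) it.1 hj

theorem key_div (hm : 2 ≤ m) (A : Set (StateString m n)) (it : ℕ × StateString m n) :
    key A it / m ^ n = it.1 := by
  rw [key, Nat.add_mul_div_left _ _ (pow_pos (by omega) n),
    Nat.div_eq_of_lt (ofDig_lt fun j _ => keyDig_lt hm A it.2 j), zero_add]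

theorem key_lt (hm : 2 ≤ m) (A : Set (StateString m n)) {it : ℕ × StateString m n}
    (h : it.1 < 2) : key A it < 2 * m ^ n := by
  rw [← Nat.div_lt_iff_lt_mul (pow_pos (by omega) n), key_div hm]
  exact h

-- The digits of the keys are the bits on branching positions and the weights elsewhere, so the
-- condition from the transform becomes one on strings.
open Classical in
theorem compat_key_iff (hm : 2 ≤ m) (A : Set (StateString m n)) (it it' : ℕ × StateString m n)
    (κ : ℕ) : Compat m n (Branch A) (key A it) (key A it') κ ↔ Joins (Branch A) κ it.2 it'.2 := by
  refine forall₂_congr fun j hj => ?_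
  rw [dig_key hm A it hj, dig_key hm A it' hj, keyDig, keyDig]
  by_cases hB : Branch A j <;> simp [hB]

variable (L₁ L₂ : Set (StateString m n)) (its : List (ℕ × StateString m n))

/-- The bits of `x` are common to both languages. -/
def Active (x : StateString m n) : Prop := ∃ y ∈ common L₁ L₂, heap y n = heap x n

-- Activity is a matter of bits alone and thus a lookup at a leaf; membership in the language then
-- puts the string itself into the common part.
variable {L₁ L₂} in
theorem Active.mem_common {x : StateString m n} (h : Active L₁ L₂ x) (hx : x ∈ L₁) :
    x ∈ common L₁ L₂ := by
  obtain ⟨y, ⟨-, w, hw, hb⟩, hy⟩ := h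
  rw [heap_eq_iff] at hy
  exact ⟨hx, w, hw, fun j hj => by rw [← hy j hj, hb j hj]⟩

variable {L₁ L₂} in
theorem Active.mem_common' {x : StateString m n} (h : Active L₁ L₂ x) (hx : x ∈ L₂) :
    x ∈ common L₂ L₁ := by
  obtain ⟨y, ⟨hy, -⟩, hy'⟩ := h
  rw [heap_eq_iff] at hy'
  exact ⟨hx, y, hy, fun j hj => (hy' j hj).symm⟩

open Classical in
/-- The pairs of strings whose combination has index `κ`. -/
noncomputable def pairs (κ : ℕ) : Finset (Fin its.length × Fin its.length) :=
  univ.filter fun t => its[t.1].1 = 0 ∧ its[t.2].1 = 1 ∧ Active L₁ L₂ its[t.1].2 ∧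
    Active L₁ L₂ its[t.2].2 ∧ Joins (Branch (common L₁ L₂)) κ its[t.1].2 its[t.2].2

/-- Attribute `a` of the combination of a pair. -/
def pairAttr (a : ℕ) (t : Fin its.length × Fin its.length) : ℕ :=
  attrVal 0 its[t.1].2 a + attrVal 1 its[t.2].2 a

open Classical in
/-- The factor by which the transforms multiply. -/
noncomputable def scale : ℕ := m ^ #{j ∈ range n | ¬ Branch (common L₁ L₂) j}

variable {L₁ L₂ its}

-- The language number is the digit of the key above the others, so the two halves of the buffer
-- hold the two languages and their product contains only mixed pairs. Weights `ω ^ attr` multiply,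
-- hence attributes add.
open Classical in
theorem transf_pairs (hm : 2 ≤ m) {R : Type*} [CommRing R] {ω : R}
    (hω : ∀ s, ∑ c ∈ range m, ω ^ (c * s) = if m ∣ s then (m : R) else 0) {a : ℕ} {f g : ℕ → R}
    (hf : ∀ κ, f κ = ∑ t : Fin its.length, if key (common L₁ L₂) its[t] = κ then
      (if Active L₁ L₂ its[t].2 then ω ^ attrVal its[t].1 its[t].2 a else 0) else 0)
    (hg : ∀ κ < m ^ n, g κ = transf m (Branch (common L₁ L₂)) ω f n κ *
      transf m (Branch (common L₁ L₂)) ω f n (m ^ n + κ))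
    (hg0 : ∀ κ, 2 * m ^ n ≤ κ → g κ = 0) {κ : ℕ} (hκ : κ < m ^ n) :
    transf m (Branch (common L₁ L₂)) ω g n κ =
      scale L₁ L₂ * ∑ t ∈ pairs L₁ L₂ its κ, ω ^ pairAttr its a t := by
  rw [transf_mul_transf (by omega) hω hf hg hg0 hκ, scale, Nat.cast_pow, pairs, sum_filter,
    Fintype.sum_prod_type]
  congr 1
  refine sum_congr rfl fun t _ => sum_congr rfl fun u _ => ?_
  simp only [compat_key_iff hm, key_div hm, pairAttr, pow_add]
  by_cases h1 : its[t].1 = 0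
  · by_cases h2 : its[u].1 = 1
    · by_cases h3 : Active L₁ L₂ its[t].2 <;> by_cases h4 : Active L₁ L₂ its[u].2 <;>
        by_cases h5 : Joins (Branch (common L₁ L₂)) κ its[t].2 its[u].2 <;>
        simp_all
    · simp_all
  · simp_all

theorem pairs_mem (h₁ : ∀ x, (0, x) ∈ its ↔ x ∈ L₁) (h₂ : ∀ x, (1, x) ∈ its ↔ x ∈ L₂) {κ : ℕ}
    {t : Fin its.length × Fin its.length} (ht : t ∈ pairs L₁ L₂ its κ) :
    its[t.1].2 ∈ common L₁ L₂ ∧ its[t.2].2 ∈ common L₂ L₁ ∧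
      Joins (Branch (common L₁ L₂)) κ its[t.1].2 its[t.2].2 := by
  simp only [pairs, mem_filter, mem_univ, true_and] at ht
  obtain ⟨a, b, c, d, e⟩ := ht
  have ha : (its[t.1].1, its[t.1].2) ∈ its := List.getElem_mem t.1.2
  have hb : (its[t.2].1, its[t.2].2) ∈ its := List.getElem_mem t.2.2
  rw [a, h₁] at ha
  rw [b, h₂] at hb
  exact ⟨c.mem_common ha, d.mem_common' hb, e⟩

theorem exists_mem_pairs (h₁ : ∀ x, (0, x) ∈ its ↔ x ∈ L₁) (h₂ : ∀ x, (1, x) ∈ its ↔ x ∈ L₂)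
    {x y : StateString m n} (hx : x ∈ L₁) (hy : y ∈ L₂) (hb : ∀ j < n, bit x j = bit y j) {κ : ℕ}
    (h : Joins (Branch (common L₁ L₂)) κ x y) :
    ∃ t ∈ pairs L₁ L₂ its κ, its[t.1].2 = x ∧ its[t.2].2 = y := by
  obtain ⟨i, hi, hi'⟩ := List.getElem_of_mem ((h₁ x).2 hx)
  obtain ⟨j, hj, hj'⟩ := List.getElem_of_mem ((h₂ y).2 hy)
  have hA : Active L₁ L₂ x := ⟨x, ⟨hx, y, hy, hb⟩, rfl⟩
  have hA' : Active L₁ L₂ y := ⟨x, ⟨hx, y, hy, hb⟩, (heap_eq_iff _ _ _).2 hb⟩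
  exact ⟨(⟨i, hi⟩, ⟨j, hj⟩), by simp [pairs, hi', hj', hA, hA', h], by simp [hi'], by simp [hj']⟩

/-- This is `Joins.unique` read for attributes. It makes all terms of the sum at one index equal, so
they cannot cancel beyond what their number causes. -/
theorem pairAttr_congr (hL₁ : IsSparse L₁) (hL₂ : IsSparse L₂)
    (h₁ : ∀ x, (0, x) ∈ its ↔ x ∈ L₁) (h₂ : ∀ x, (1, x) ∈ its ↔ x ∈ L₂) {κ : ℕ}
    {t t' : Fin its.length × Fin its.length} (ht : t ∈ pairs L₁ L₂ its κ)
    (ht' : t' ∈ pairs L₁ L₂ its κ) {a : ℕ} (ha : a < 2 * n + 1) :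
    pairAttr its a t % m = pairAttr its a t' % m := by
  obtain ⟨a1, a2, a3⟩ := pairs_mem h₁ h₂ ht
  obtain ⟨b1, b2, b3⟩ := pairs_mem h₁ h₂ ht'
  by_cases h0 : a = 0
  · simp [pairAttr, attrVal, h0]
  by_cases hodd : a % 2 = 1
  · obtain ⟨j, rfl⟩ : ∃ j, a = 2 * j + 1 := ⟨a / 2, by omega⟩
    simp only [pairAttr, attrVal_odd]
    rw [(a3.unique hL₁ hL₂ a1 a2 b3 b1 b2 (show j < n by omega)).1]
    simp
  · obtain ⟨j, rfl⟩ : ∃ j, a = 2 * j + 2 := ⟨a / 2 - 1, by omega⟩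
    simp only [pairAttr, attrVal_even]
    exact (a3.unique hL₁ hL₂ a1 a2 b3 b1 b2 (show j < n by omega)).2

/-- The transforms contribute at most `m ^ n`, the pairs at most `(2 * m ^ n) ^ 2`. -/
theorem scale_mul_card_lt (hm : 2 ≤ m) (hlen : its.length ≤ 2 * m ^ n) {N : ℕ}
    (hN : 4 * m ^ (3 * n) < N) (κ : ℕ) : scale L₁ L₂ * #(pairs L₁ L₂ its κ) < N := by
  classical
  have h1 : #(pairs L₁ L₂ its κ) ≤ its.length * its.length := by
    refine (card_le_univ _).trans ?_
    simp
  have h2 : scale L₁ L₂ ≤ m ^ n := by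
    refine Nat.pow_le_pow_right (by omega) ((card_filter_le _ _).trans ?_)
    simp
  calc _ ≤ m ^ n * ((2 * m ^ n) * (2 * m ^ n)) :=
        Nat.mul_le_mul h2 (h1.trans (Nat.mul_le_mul hlen hlen))
    _ = 4 * m ^ (3 * n) := by ring
    _ < N := hN

theorem scale_pos (hm : 2 ≤ m) : 0 < scale L₁ L₂ := pow_pos (by omega) _

end Portal

/-! ### Computing keys and the transform -/

namespace Imp

open Imp.Expr Imp.Cmd Portal Finset

variable {m p g n L : ℕ}

/-- Correctness and running time of `keys`. -/
theorem tri_keys (hP : Params m p g n L) {A : Set (StateString m n)}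
    {its : List (ℕ × StateString m n)} (hits : ∀ it ∈ its, it.1 < 2)
    (hlen : its.length ≤ 2 * m ^ n) {s : St} (hs : Loaded its s) (hr : Ready m p g n s)
    (hb : ∀ j < n, (s.arr .branch j ≠ 0 ↔ Branch A j)) :
    Tri L keys s (2 * m ^ n * (n * (2 + 2) + 2 + 1 + 1 + 2) + 2) fun s' =>
      Frame keys s s' ∧ ∀ k (hk : k < its.length), s'.arr .key k = key A its[k] := by
  have hm := hP.two_le
  have hL := hP.le_bound
  have hM := hP.two_mul_pow_le
  have hN := hP.lt_modulus
  refine Tri.frame ?_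
  unfold keys
  refine Tri.mono (Tri.forTo (K := its.length) (T := n * (2 + 2) + 2 + 1 + 1) (fun k s' =>
    ∀ i (hi : i < its.length), i < k → s'.arr .key i = key A its[i]) rfl (by omega) ?_
    (by exact fun _ _ _ h => h) ?_ ?_) (by gcongr) ?_
  · intro s' hf
    simp [hf.var .cnt rfl, hs.cnt]
  · intro i _ h; omega
  · rintro k hk s1 hf hv hkey
    have fn := hf.var .n rfl
    have fp := hf.var .pow rfl
    have f1 := hf.arr .branch rfl
    have f2 := hf.arr .bits rfl
    have f3 := hf.arr .attr rfl
    have f4 := hf.arr .side rfl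
    have f5 := hf.arr .place rfl
    rw [hr.dim] at fn
    rw [hr.pow] at fp
    clear hf
    have he : ∀ j, keyDig A its[k].2 j < m := keyDig_lt hm A its[k].2
    have hof : ∀ j ≤ n, ofDig m (keyDig A its[k].2) j < m ^ n := fun j hj =>
      (ofDig_lt fun j _ => he j).trans_le (Nat.pow_le_pow_right (by omega) hj)
    have hkl := key_lt hm A (hits its[k] (List.getElem_mem hk))
    refine Tri.assign_seq (by simp) ?_
    refine Tri.andThen (T₂ := 1) (Tri.forTo (K := n) (T := 2) (fun j s' =>
      s'.var .acc = ofDig m (keyDig A its[k].2) j) rfl (by omega) ?_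
      (by exact fun _ _ _ h => h) ?_ ?_) ?_
    · intro s' hf
      simp [hf.var .n rfl, fn]
    · simp [ofDig]
    · rintro j hj s2 hf hvj hacc
      have gn := hf.var .n rfl
      have gk := hf.var .k rfl
      have g1 := hf.arr .branch rfl
      have g2 := hf.arr .bits rfl
      have g3 := hf.arr .attr rfl
      have g5 := hf.arr .place rfl
      simp [fn, hv, f1, f2, f3, f5] at gn gk g1 g2 g3 g5
      clear hf
      have hsucc := ofDig_succ m (keyDig A its[k].2) j
      have hle := hof (j + 1) (by omega)
      have hat := hs.attr k hk (2 * j + 2) (by omega)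
      rw [attrVal_even] at hat
      refine Tri.ite (T := 1) (fun hne => ?_) (fun hne => ?_)
      · simp only [eval_get, eval_var, hvj, g1, hb j hj] at hne
        have : (var Var.acc + get .place (var .j) * get .bits (var .k * var .n + var .j)).eval s2
            = ofDig m (keyDig A its[k].2) (j + 1) := by
          rw [hsucc, keyDig, if_pos hne]
          simp [hacc, g5, g2, gk, gn, hvj, hr.place j hj, hs.bits k hk j hj]
        exact Tri.assign (T := 0) (by rw [this]; omega) (by simpa using this)
      · simp only [eval_get, eval_var, hvj, g1] at hne
        have hne : ¬ Branch A j := fun h => (hb j hj).2 h hne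
        have : (var Var.acc + get .place (var .j) *
            get .attr (var .k * (2 * var .n + 1) + (2 * var .j + 2))).eval s2
            = ofDig m (keyDig A its[k].2) (j + 1) := by
          rw [hsucc, keyDig, if_neg hne]
          simp [hacc, g5, g3, gk, gn, hvj, hr.place j hj, hat]
        exact Tri.assign (T := 0) (by rw [this]; omega) (by simpa using this)
    · rintro s2 ⟨hf, hacc⟩
      have gp := hf.var .pow rfl
      have gk := hf.var .k rfl
      have g4 := hf.arr .side rfl
      have g6 := hf.arr .key rfl
      simp [fp, hv, f4] at gp gk g4 g6
      clear hf
      have : (var Var.acc + var .pow * get .side (var .k)).eval s2 = key A its[k] := by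
        simp [hacc, gp, gk, g4, hs.side k hk, key]
      refine Tri.store (T := 0) (by rw [this]; omega) fun i hi hik => ?_
      rw [this]
      by_cases hi' : i = k
      · subst hi'
        simp [gk]
      · simp [gk, hi', g6]
        exact hkey i hi (by omega)
  · rintro s' ⟨-, h⟩ k hk
    exact h k hk hk

/-- The root of unity of the transform. -/
abbrev theRoot (p g n : ℕ) : ZMod (p ^ (3 * n + 2)) :=
  (g : ZMod (p ^ (3 * n + 2))) ^ p ^ (3 * n + 2)

/-- A number that represents an element of `ZMod N`. -/
def Repr (N v : ℕ) (a : ZMod N) : Prop := v < N ∧ (v : ZMod N) = a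

/-- The number of steps of `transform`. -/
abbrev transformTime (m n : ℕ) : ℕ :=
  n * (2 * m ^ n * (m * (1 + 2) + 2 + 1 + 2 + 1 + 2) + 2 + 2) + 2

/-- `transform` computes the transform of the values in the buffer. -/
theorem tri_transform (hP : Params m p g n L) (h1 : theRoot p g n ^ m = 1) {S : ℕ → Prop}
    [DecidablePred S] {f : ℕ → ZMod (p ^ (3 * n + 2))} {s : St} (hr : Ready m p g n s)
    (hb : ∀ j < n, (s.arr .branch j ≠ 0 ↔ S j))
    (hf : ∀ κ < 2 * m ^ n, Repr (p ^ (3 * n + 2)) (s.arr .buf κ) (f κ)) :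
    Tri L (transform m) s (transformTime m n) fun s' => Frame (transform m) s s' ∧
      ∀ κ < 2 * m ^ n, Repr (p ^ (3 * n + 2)) (s'.arr .buf (n * (2 * m ^ n) + κ))
        (transf m S (theRoot p g n) f n κ) := by
  have hm := hP.two_le
  have hmp := hP.lt_prime
  have hp := hP.prime_le
  have hL := hP.le_bound
  have hM := hP.two_mul_pow_le
  have hN := hP.lt_modulus
  have hmod : ∀ a, a % p ^ (3 * n + 2) < p ^ (3 * n + 2) := fun a => Nat.mod_lt _ (by omega)
  refine Tri.frame ?_
  unfold transform
  refine Tri.mono (Tri.forTo (K := n) (fun i s' => ∀ κ < 2 * m ^ n,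
    Repr (p ^ (3 * n + 2)) (s'.arr .buf (i * (2 * m ^ n) + κ))
      (transf m S (theRoot p g n) f i κ)) rfl (by omega) ?_ (by exact fun _ _ _ h => h) ?_ ?_)
    le_rfl fun s' h => h.2
  · intro s' hf
    simp [hf.var .n rfl, hr.dim]
  · simpa [transf] using hf
  clear hf
  rintro i hi s1 hf hv hcur
  have fp := hf.var .pow rfl
  have fm := hf.var .modulus rfl
  have f1 := hf.arr .branch rfl
  have f2 := hf.arr .place rfl
  have f3 := hf.arr .unit rfl
  rw [hr.pow] at fp
  rw [hr.modulus] at fm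
  clear hf
  have hlevel : (i + 1) * (2 * m ^ n) = i * (2 * m ^ n) + 2 * m ^ n := by ring
  refine Tri.mono (Tri.forTo (K := 2 * m ^ n) (T := m * (1 + 2) + 2 + 1 + 2 + 1) (fun k s' =>
    (∀ κ < 2 * m ^ n, Repr (p ^ (3 * n + 2)) (s'.arr .buf (i * (2 * m ^ n) + κ))
      (transf m S (theRoot p g n) f i κ)) ∧
    ∀ κ < k, Repr (p ^ (3 * n + 2)) (s'.arr .buf ((i + 1) * (2 * m ^ n) + κ))
      (transf m S (theRoot p g n) f (i + 1) κ)) rfl (by omega) ?_ (by exact fun _ _ _ h => h) ?_ ?_)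
    le_rfl fun s' h => h.2.2
  · intro s' hf
    simp [hf.var .pow rfl, fp]
  · exact ⟨hcur, fun κ h => by omega⟩
  clear hcur
  rintro k hk s2 hf hvk ⟨hcur, hnext⟩
  have gp := hf.var .pow rfl
  have gm := hf.var .modulus rfl
  have gi := hf.var .i rfl
  have g1 := hf.arr .branch rfl
  have g2 := hf.arr .place rfl
  have g3 := hf.arr .unit rfl
  simp only [fp, fm, hv, f1, f2, f3] at gp gm gi g1 g2 g3
  clear hf f1 f2 f3
  -- Both cases of the conditional write one cell of level `i + 1`; level `i`, which later cells
  -- still read, lies before it.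
  have hstep : ∀ (s3 : St) (v : ℕ), s3.arr .buf = s2.arr .buf →
      Repr (p ^ (3 * n + 2)) v (transf m S (theRoot p g n) f (i + 1) k) →
      (∀ κ < 2 * m ^ n, Repr (p ^ (3 * n + 2))
        ((s3.setArr .buf ((i + 1) * (2 * m ^ n) + k) v).arr .buf (i * (2 * m ^ n) + κ))
        (transf m S (theRoot p g n) f i κ)) ∧
      ∀ κ < k + 1, Repr (p ^ (3 * n + 2))
        ((s3.setArr .buf ((i + 1) * (2 * m ^ n) + k) v).arr .buf ((i + 1) * (2 * m ^ n) + κ))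
        (transf m S (theRoot p g n) f (i + 1) κ) := by
    intro s3 v h3 hrep
    refine ⟨fun κ hκ => ?_, fun κ hκ => ?_⟩
    · simp only [St.setArr_arr, if_true, h3]
      rw [Function.update_of_ne (by omega)]
      exact hcur κ hκ
    · simp only [St.setArr_arr, if_true, h3]
      by_cases hκk : κ = k
      · subst hκk
        rwa [Function.update_self]
      · rw [Function.update_of_ne (by omega)]
        exact hnext κ (by omega)
  refine Tri.ite (fun hne => ?_) (fun hne => ?_)
  · simp only [eval_get, eval_var, g1, gi, hb i hi] at hne
    have hrep := hcur k hk
    refine Tri.store ?_ ?_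
    · simp [gi, gp, hvk]
      exact hrep.1.le.trans (by omega)
    · simp only [eval_add, eval_mul, eval_var, eval_get, eval_one, eval_ofNat, gi, gp, hvk]
      refine hstep s2 _ rfl ?_
      rwa [transf, if_pos hne]
  · simp only [eval_get, eval_var, g1, gi] at hne
    have hne : ¬ S i := fun h => (hb i hi).2 h hne
    have hd := dig_lt (show 0 < m by omega) k i
    have hdig : (var Var.k / get .place (var .i) % lit m : Expr).eval s2 = dig m k i := by
      simp [hvk, g2, gi, hr.place i hi, dig]
    refine Tri.assign_seq (by rw [hdig]; omega) <| Tri.assign_seq (by simp) ?_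
    rw [hdig]
    refine Tri.andThen (T₂ := 1) (Tri.forTo (K := m) (T := 1) (fun c s' =>
      Repr (p ^ (3 * n + 2)) (s'.var .acc) (∑ c ∈ range c, transf m S (theRoot p g n) f i
        (setDig m k i c) * theRoot p g n ^ (c * dig m k i))) rfl (by omega) ?_
        (by exact fun _ _ _ h => h) ?_ ?_) ?_
    · intro s' hf
      simp
    · simp [Repr]; omega
    · rintro c hc s3 hf hvc hacc
      have e1 := hf.var .pow rfl
      have e2 := hf.var .modulus rfl
      have e3 := hf.var .i rfl
      have e4 := hf.var .k rfl
      have e5 := hf.var .dig rfl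
      have e6 := hf.arr .place rfl
      have e7 := hf.arr .unit rfl
      have e8 := hf.arr .buf rfl
      simp [gp, gm, gi, hvk, g2, g3] at e1 e2 e3 e4 e5 e6 e7 e8
      clear hf
      have hsd := setDig_lt (show 0 < m by omega) hi hc hk
      have hrep := hcur _ hsd
      have hmodm := Nat.mod_lt (c * dig m k i) (show 0 < m by omega)
      have hu := hr.unit _ hmodm
      -- The table holds powers with exponent below `m` only; reducing the exponent does not change
      -- the power.
      rw [pow_mod_eq h1] at hu
      have hval : ((var Var.acc + get .buf (var .i * (2 * var .pow) +
          (var .k + var .c * get .place (var .i) - var .dig * get .place (var .i))) *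
          get .unit (var .c * var .dig % lit m)) % var .modulus : Expr).eval s3 =
          (s3.var .acc + s2.arr .buf (i * (2 * m ^ n) + setDig m k i c) *
            s.arr .unit (c * dig m k i % m)) % p ^ (3 * n + 2) := by
        simp [e1, e2, e3, e4, e5, e6, e7, e8, hvc, hr.place i hi, setDig]
      have := hmod (s3.var .acc + s2.arr .buf (i * (2 * m ^ n) + setDig m k i c) *
            s.arr .unit (c * dig m k i % m))
      refine Tri.assign (T := 0) (by rw [hval]; omega) ?_
      rw [hval]
      simp only [St.setVar_var, if_true]
      refine ⟨this, ?_⟩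
      rw [ZMod.natCast_mod, sum_range_succ, Nat.cast_add, Nat.cast_mul, hacc.2, hrep.2, hu]
    · rintro s3 ⟨hf, hacc⟩
      have e1 := hf.var .pow rfl
      have e3 := hf.var .i rfl
      have e4 := hf.var .k rfl
      have e8 := hf.arr .buf rfl
      simp [gp, gi, hvk] at e1 e3 e4 e8
      clear hf
      refine Tri.store (T := 0) (by simp; have := hacc.1; omega) ?_
      simp only [eval_add, eval_mul, eval_var, eval_one, eval_ofNat, e3, e1, e4]
      refine hstep s3 _ e8 ?_
      rwa [transf, if_neg hne]

end Imp

/-! ### One weighted convolution -/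

namespace Imp

open Imp.Expr Imp.Cmd Portal Finset

variable {m p g n L : ℕ}

/-- All tables are ready for the passes. -/
structure Prepared (p g : ℕ) (L₁ L₂ : Set (StateString m n)) (its : List (ℕ × StateString m n))
    (s : St) : Prop where
  ready : Ready m p g n s
  loaded : Loaded its s
  branch : ∀ j < n, (s.arr .branch j ≠ 0 ↔ Branch (common L₁ L₂) j)
  active : ∀ k (hk : k < its.length), s.arr .common (s.arr .code k) ≠ 0 ↔ Active L₁ L₂ its[k].2
  key : ∀ k (hk : k < its.length), s.arr .key k = key (common L₁ L₂) its[k]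

/-- The only arrays that the passes write are `buf`, `base` and `res`, so the tables serve all of
them. -/
theorem Prepared.congr {L₁ L₂ : Set (StateString m n)} {its : List (ℕ × StateString m n)}
    {s s' : St} (h : Prepared p g L₁ L₂ its s)
    (hv : ∀ x, x = .n ∨ x = .pow ∨ x = .two ∨ x = .modulus ∨ x = .cnt → s'.var x = s.var x)
    (ha : ∀ a, a ≠ .buf → a ≠ .base → a ≠ .res → s'.arr a = s.arr a) :
    Prepared p g L₁ L₂ its s' := by
  constructor
  · exact h.ready.congr (hv _ (by simp)) (hv _ (by simp)) (hv _ (by simp)) (hv _ (by simp))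
      (ha _ (by simp) (by simp) (by simp)) (ha _ (by simp) (by simp) (by simp))
  · exact h.loaded.congr (hv _ (by simp)) fun a h => by
      rcases h with rfl | rfl | rfl | rfl | rfl <;> exact ha _ (by simp) (by simp) (by simp)
  · rw [ha _ (by simp) (by simp) (by simp)]; exact h.branch
  · rw [ha .common (by simp) (by simp) (by simp), ha .code (by simp) (by simp) (by simp)]
    exact h.active
  · rw [ha _ (by simp) (by simp) (by simp)]; exact h.key

/-- The outcome of pass `a` at index `κ`. -/
noncomputable def passValue (p g : ℕ) (L₁ L₂ : Set (StateString m n))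
    (its : List (ℕ × StateString m n)) (a κ : ℕ) : ZMod (p ^ (3 * n + 2)) :=
  scale L₁ L₂ * ∑ t ∈ pairs L₁ L₂ its κ, theRoot p g n ^ pairAttr its a t

/-- The number of steps of `convolve`. -/
abbrev convolveTime (m n : ℕ) : ℕ :=
  2 * m ^ n * (1 + 2) + 2 + (2 * m ^ n * (1 + 1 + 2) + 2 +
    (transformTime m n + (m ^ n * (2 + 2) + 2 + transformTime m n)))

/-- Correctness and running time of `convolve`. -/
theorem tri_convolve (hP : Params m p g n L) (h1 : theRoot p g n ^ m = 1)
    (hu : ∀ s, ¬ m ∣ s → IsUnit (theRoot p g n ^ s - 1))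
    {L₁ L₂ : Set (StateString m n)} {its : List (ℕ × StateString m n)}
    (hlen : its.length ≤ 2 * m ^ n) {s : St}
    (hs : Prepared p g L₁ L₂ its s) {a : ℕ} (ha : a < 2 * n + 1) (hpass : s.var .pass = a) :
    Tri L (convolve m) s (convolveTime m n) fun s' => Frame (convolve m) s s' ∧
      ∀ κ < m ^ n, Repr (p ^ (3 * n + 2)) (s'.arr .buf (n * (2 * m ^ n) + κ))
        (passValue p g L₁ L₂ its a κ) := by
  classical
  have hm := hP.two_le
  have hL := hP.le_bound
  have hM := hP.two_mul_pow_le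
  have hN := hP.lt_modulus
  have hmod : ∀ a, a % p ^ (3 * n + 2) < p ^ (3 * n + 2) := fun a => Nat.mod_lt _ (by omega)
  let v : Fin its.length → ZMod (p ^ (3 * n + 2)) := fun t =>
    if Active L₁ L₂ its[t].2 then theRoot p g n ^ attrVal its[t].1 its[t].2 a else 0
  let f : ℕ → ZMod (p ^ (3 * n + 2)) := fun κ =>
    ∑ t : Fin its.length, if key (common L₁ L₂) its[t] = κ then v t else 0
  let F := transf m (Branch (common L₁ L₂)) (theRoot p g n) f n
  let G : ℕ → ZMod (p ^ (3 * n + 2)) := fun κ => if κ < m ^ n then F κ * F (m ^ n + κ) else 0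
  refine Tri.frame ?_
  unfold convolve
  refine Tri.andThen (T₁ := 2 * m ^ n * (1 + 2) + 2) (Tri.forTo (K := 2 * m ^ n) (T := 1)
    (fun k s' => ∀ κ < k, s'.arr .buf κ = 0) rfl (by omega) ?_ (by exact fun _ _ _ h => h) ?_ ?_) ?_
  · intro s' hf
    simp [hf.var .pow rfl, hs.ready.pow]
  · intro κ h; omega
  · rintro k hk s1 - hv h
    refine Tri.store (T := 0) (by simp) fun κ hκ => ?_
    simp only [St.setArr_arr, if_true, eval_var, hv, eval_zero, Function.update_apply]
    split_ifs with hκk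
    · rfl
    · exact h κ (by omega)
  rintro s1 ⟨hf1, hzero⟩
  have hs1 : Prepared p g L₁ L₂ its s1 := hs.congr
    (fun x hx => by rcases hx with rfl | rfl | rfl | rfl | rfl <;> exact hf1.var _ rfl)
    (fun x h1 _ _ => hf1.arr x (by cases x <;> first | rfl | exact absurd rfl h1))
  have hpass1 : s1.var .pass = a := (hf1.var .pass rfl).trans hpass
  clear hf1 hs hpass
  refine Tri.andThen (T₁ := 2 * m ^ n * (1 + 1 + 2) + 2) (Tri.mono_time (Tri.forTo
    (K := its.length) (T := 1 + 1) (fun k s' => ∀ κ < 2 * m ^ n, Repr (p ^ (3 * n + 2))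
      (s'.arr .buf κ) (∑ t : Fin its.length,
        if (t : ℕ) < k ∧ key (common L₁ L₂) its[t] = κ then v t else 0))
    rfl (by omega) ?_ (by exact fun _ _ _ h => h) ?_ ?_) (by gcongr)) ?_
  · intro s' hf
    simp [hf.var .cnt rfl, hs1.loaded.cnt]
  · intro κ hκ
    simp [hzero κ hκ, Repr]
    omega
  · rintro k hk s2 hf hv hbuf
    have hs2 : Prepared p g L₁ L₂ its s2 := hs1.congr
      (fun x hx => by rcases hx with rfl | rfl | rfl | rfl | rfl <;> exact hf.var _ rfl)
      (fun x h1 _ _ => hf.arr x (by cases x <;> first | rfl | exact absurd rfl h1))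
    have hpass2 : s2.var .pass = a := (hf.var .pass rfl).trans hpass1
    clear hf
    have hsum : ∀ κ, (∑ t : Fin its.length,
        if (t : ℕ) < k + 1 ∧ key (common L₁ L₂) its[t] = κ then v t else 0) =
        (∑ t : Fin its.length, if (t : ℕ) < k ∧ key (common L₁ L₂) its[t] = κ then v t else 0) +
        if key (common L₁ L₂) its[k] = κ then v ⟨k, hk⟩ else 0 := by
      intro κ
      have : (if key (common L₁ L₂) its[k] = κ then v ⟨k, hk⟩ else 0) =
          ∑ t : Fin its.length, if t = ⟨k, hk⟩ then
            (if key (common L₁ L₂) its[t] = κ then v t else 0) else 0 := by simp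
      rw [this, ← sum_add_distrib]
      refine sum_congr rfl fun t _ => ?_
      by_cases htk : t = ⟨k, hk⟩
      · subst htk; simp
      · have : (t : ℕ) ≠ k := fun h => htk (Fin.ext h)
        have : (t : ℕ) < k + 1 ↔ (t : ℕ) < k := by omega
        simp [htk, this]
    refine Tri.ite (T := 1) (fun hne => ?_) (fun hne => ?_)
    · simp only [eval_get, eval_var, hv, hs2.active k hk] at hne
      have hat := hs2.loaded.attr k hk a ha
      have hlt := attrVal_lt hm its[k].1 its[k].2 a
      have hval : ((get .buf (get .key (var .k)) +
          get .unit (get .attr (var .k * (2 * var .n + 1) + var .pass))) % var .modulus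
            : Expr).eval s2 = (s2.arr .buf (key (common L₁ L₂) its[k]) +
              s2.arr .unit (attrVal its[k].1 its[k].2 a)) % p ^ (3 * n + 2) := by
        simp [hv, hs2.key k hk, hs2.ready.dim, hpass2, hat, hs2.ready.modulus]
      have hlt' := hmod (s2.arr .buf (key (common L₁ L₂) its[k]) +
              s2.arr .unit (attrVal its[k].1 its[k].2 a))
      refine Tri.store (T := 0) (by rw [hval]; omega) fun κ hκ => ?_
      rw [hval, hsum]
      simp only [eval_get, eval_var, hv, hs2.key k hk, St.setArr_arr, if_true,
        Function.update_apply]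
      by_cases hκk : key (common L₁ L₂) its[k] = κ
      · subst hκk
        rw [if_pos rfl, if_pos rfl]
        refine ⟨hlt', ?_⟩
        rw [ZMod.natCast_mod, Nat.cast_add, (hbuf _ hκ).2, hs2.ready.unit _ hlt]
        simp [v, hne]
      · rw [if_neg (Ne.symm hκk), if_neg hκk, add_zero]
        exact hbuf κ hκ
    · simp only [eval_get, eval_var, hv] at hne
      have hne : ¬ Active L₁ L₂ its[k].2 := fun h => (hs2.active k hk).2 h hne
      refine Tri.skip fun κ hκ => ?_
      rw [hsum]
      have : v ⟨k, hk⟩ = 0 := by simp [v, hne]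
      rw [this, ite_self, add_zero]
      exact hbuf κ hκ
  rintro s2 ⟨hf2, hbuf⟩
  have hs2 : Prepared p g L₁ L₂ its s2 := hs1.congr
    (fun x hx => by rcases hx with rfl | rfl | rfl | rfl | rfl <;> exact hf2.var _ rfl)
    (fun x h1 _ _ => hf2.arr x (by cases x <;> first | rfl | exact absurd rfl h1))
  clear hf2 hs1 hpass1
  have hbuf' : ∀ κ < 2 * m ^ n, Repr (p ^ (3 * n + 2)) (s2.arr .buf κ) (f κ) := by
    intro κ hκ
    simpa [f] using hbuf κ hκ
  refine Tri.andThen (tri_transform hP h1 hs2.ready hs2.branch hbuf') ?_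
  rintro s3 ⟨hf3, hF⟩
  have hs3 : Prepared p g L₁ L₂ its s3 := hs2.congr
    (fun x hx => by rcases hx with rfl | rfl | rfl | rfl | rfl <;> exact hf3.var _ rfl)
    (fun x h1 _ _ => hf3.arr x (by cases x <;> first | rfl | exact absurd rfl h1))
  clear hf3 hs2 hbuf hbuf' hzero
  refine Tri.andThen (T₁ := m ^ n * (2 + 2) + 2) (Tri.forTo (K := m ^ n) (T := 2)
    (fun k s' => (∀ κ < k, Repr (p ^ (3 * n + 2)) (s'.arr .buf κ) (G κ) ∧
      s'.arr .buf (m ^ n + κ) = 0) ∧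
      ∀ i, k ≤ i → (i < m ^ n ∨ m ^ n + k ≤ i) → s'.arr .buf i = s3.arr .buf i)
    rfl (by omega) ?_ (by exact fun _ _ _ h => h) ?_ ?_) ?_
  · intro s' hf
    simp [hf.var .pow rfl, hs3.ready.pow]
  · exact ⟨fun κ h => by omega, fun i _ _ => rfl⟩
  · rintro k hk s4 hf hv ⟨hdone, hrest⟩
    have fn := hf.var .n rfl
    have fp := hf.var .pow rfl
    have fm := hf.var .modulus rfl
    rw [hs3.ready.dim] at fn
    rw [hs3.ready.pow] at fp
    rw [hs3.ready.modulus] at fm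
    clear hf
    have hn0 : 0 ≤ n * (2 * m ^ n) := Nat.zero_le _
    -- For `n = 0` the last level is the first one and the product overwrites its own factors. The
    -- invariant therefore protects only cells that are still to be read.
    have hn1 : n * (2 * m ^ n) = 0 ∨ 2 * m ^ n ≤ n * (2 * m ^ n) := by
      rcases Nat.eq_zero_or_pos n with h | h
      · left; rw [h, zero_mul]
      · right; exact Nat.le_mul_of_pos_left _ h
    have hA := hrest (n * (2 * m ^ n) + k) (by omega) (by omega)
    have hB := hrest (n * (2 * m ^ n) + (m ^ n + k)) (by omega) (by omega)
    have rA := hF k (by omega)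
    have rB := hF (m ^ n + k) (by omega)
    have hval : (get .buf (var .n * (2 * var .pow) + var .k) *
      get .buf (var .n * (2 * var .pow) + (var .pow + var .k)) % var .modulus : Expr).eval s4 =
        (s3.arr .buf (n * (2 * m ^ n) + k) * s3.arr .buf (n * (2 * m ^ n) + (m ^ n + k))) %
          p ^ (3 * n + 2) := by
      simp [fn, fp, fm, hv, hA, hB]
    have hlt := hmod (s3.arr .buf (n * (2 * m ^ n) + k) *
      s3.arr .buf (n * (2 * m ^ n) + (m ^ n + k)))
    refine Tri.store_seq (by rw [hval]; omega) <| Tri.store (T := 0) (by simp) ?_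
    rw [hval]
    simp only [St.setArr_arr, if_true, eval_add, eval_var, St.setArr_var, fp, hv, eval_zero,
      Function.update_apply]
    refine ⟨fun κ hκ => ⟨?_, ?_⟩, fun i hi hi' => ?_⟩
    · rw [if_neg (by omega)]
      by_cases hκk : κ = k
      · subst hκk
        rw [if_pos rfl]
        refine ⟨hlt, ?_⟩
        rw [ZMod.natCast_mod, Nat.cast_mul, rA.2, rB.2]
        simp [G, hk, F]
      · rw [if_neg hκk]
        exact (hdone κ (by omega)).1
    · by_cases hκk : κ = k
      · subst hκk
        rw [if_pos rfl]
      · rw [if_neg (by omega), if_neg (by omega)]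
        exact (hdone κ (by omega)).2
    · rw [if_neg (by omega), if_neg (by omega)]
      exact hrest i (by omega) (by omega)
  rintro s4 ⟨hf4, hdone, -⟩
  have hs4 : Prepared p g L₁ L₂ its s4 := hs3.congr
    (fun x hx => by rcases hx with rfl | rfl | rfl | rfl | rfl <;> exact hf4.var _ rfl)
    (fun x h1 _ _ => hf4.arr x (by cases x <;> first | rfl | exact absurd rfl h1))
  clear hf4
  have hG : ∀ κ < 2 * m ^ n, Repr (p ^ (3 * n + 2)) (s4.arr .buf κ) (G κ) := by
    intro κ hκ
    by_cases h : κ < m ^ n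
    · exact (hdone κ h).1
    · have := (hdone (κ - m ^ n) (by omega)).2
      rw [Nat.add_sub_cancel' (by omega)] at this
      rw [this]
      simp [Repr, G, h]
      omega
  refine (tri_transform hP h1 hs4.ready hs4.branch hG).mono le_rfl ?_
  rintro s5 ⟨-, h5⟩ κ hκ
  have := transf_pairs (its := its) (L₁ := L₁) (L₂ := L₂) (a := a) hm (sum_root_pow h1 hu)
    (f := f) (g := G) (fun κ => rfl)
    (fun κ h => by simp [G, h, F]) (fun κ h => by simp [G, show ¬ κ < m ^ n by omega]) hκ
  rw [passValue, ← this]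
  exact h5 κ (by omega)

end Imp

/-! ### Reading attributes off the convolutions -/

namespace Imp

open Imp.Expr Imp.Cmd Portal Finset

variable {m p g n L : ℕ} {L₁ L₂ : Set (StateString m n)} {its : List (ℕ × StateString m n)}

/-- Attribute `0` is constantly zero, so this pass counts pairs and serves as reference for the
others. -/
theorem passValue_zero (κ : ℕ) :
    passValue p g L₁ L₂ its 0 κ = (scale L₁ L₂ * #(pairs L₁ L₂ its κ) : ℕ) := by
  simp [passValue, pairAttr, attrVal]

theorem passValue_zero_ne_zero (hP : Params m p g n L) (hlen : its.length ≤ 2 * m ^ n) {κ : ℕ}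
    (h : (pairs L₁ L₂ its κ).Nonempty) : passValue p g L₁ L₂ its 0 κ ≠ 0 := by
  rw [passValue_zero, Ne, ZMod.natCast_eq_zero_iff]
  intro hd
  have h1 := scale_mul_card_lt (L₁ := L₁) (L₂ := L₂) hP.two_le hlen hP.four_mul_lt κ
  have h2 := Nat.eq_zero_of_dvd_of_lt hd h1
  have h3 := scale_pos (L₁ := L₁) (L₂ := L₂) hP.two_le
  have h4 := h.card_pos
  have := Nat.mul_pos h3 h4
  omega

/-- All pairs contribute the same power of the root, so the value is the reference times that power.
Different powers give different values: otherwise the reference would be annihilated by a unit `ω ^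
(j - i) - 1`, but it is nonzero. -/
theorem passValue_eq_iff (hP : Params m p g n L) (h1 : theRoot p g n ^ m = 1)
    (hu : ∀ s, ¬ m ∣ s → IsUnit (theRoot p g n ^ s - 1)) (hlen : its.length ≤ 2 * m ^ n)
    (hL₁ : IsSparse L₁) (hL₂ : IsSparse L₂)
    (h₁ : ∀ x, (0, x) ∈ its ↔ x ∈ L₁) (h₂ : ∀ x, (1, x) ∈ its ↔ x ∈ L₂) {κ : ℕ}
    {t : Fin its.length × Fin its.length} (ht : t ∈ pairs L₁ L₂ its κ) {a c : ℕ}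
    (ha : a < 2 * n + 1) (hc : c < m) :
    passValue p g L₁ L₂ its a κ = passValue p g L₁ L₂ its 0 κ * theRoot p g n ^ c ↔
      pairAttr its a t % m = c := by
  have hm := hP.two_le
  have e : passValue p g L₁ L₂ its a κ =
      passValue p g L₁ L₂ its 0 κ * theRoot p g n ^ (pairAttr its a t % m) := by
    rw [passValue_zero, passValue, sum_congr rfl fun t' ht' => show _ =
      theRoot p g n ^ (pairAttr its a t % m) by
        rw [pairAttr_congr hL₁ hL₂ h₁ h₂ ht ht' ha, pow_mod_eq h1]]
    simp
    ring
  rw [e]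
  have hne := passValue_zero_ne_zero hP hlen (p := p) (g := g) ⟨t, ht⟩
  have hlt := Nat.mod_lt (pairAttr its a t) (show 0 < m by omega)
  have hroot : IsUnit (theRoot p g n) := IsUnit.of_pow_eq_one h1 (by omega)
  have key : ∀ i j, i < j → j < m → passValue p g L₁ L₂ its 0 κ * theRoot p g n ^ i ≠
      passValue p g L₁ L₂ its 0 κ * theRoot p g n ^ j := by
    intro i j hij hj h
    have hd : ¬ m ∣ j - i := fun hd => by
      have := Nat.le_of_dvd (by omega) hd
      omega
    have h0 : passValue p g L₁ L₂ its 0 κ * theRoot p g n ^ i *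
        (theRoot p g n ^ (j - i) - 1) = 0 := by
      rw [mul_sub, mul_assoc, ← pow_add, Nat.add_sub_cancel' hij.le, h, mul_one, sub_self]
    rw [(hu _ hd).mul_left_eq_zero, (hroot.pow i).mul_left_eq_zero] at h0
    exact hne h0
  constructor
  · intro h
    rcases lt_trichotomy (pairAttr its a t % m) c with hlt' | heq | hgt
    · exact absurd h (key _ _ hlt' hc)
    · exact heq
    · exact absurd h.symm (key _ _ hgt hlt)
  · intro h
    rw [h]

/-- The number of steps of `decode`. -/
abbrev decodeTime (m n : ℕ) : ℕ := m ^ n * (m * (3 + 2) + 2 + 2 + 2) + 2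

/-- Correctness and running time of `decode`. -/
theorem tri_decode (hP : Params m p g n L) (h1 : theRoot p g n ^ m = 1)
    (hu : ∀ s, ¬ m ∣ s → IsUnit (theRoot p g n ^ s - 1)) (hlen : its.length ≤ 2 * m ^ n)
    (hL₁ : IsSparse L₁) (hL₂ : IsSparse L₂)
    (h₁ : ∀ x, (0, x) ∈ its ↔ x ∈ L₁) (h₂ : ∀ x, (1, x) ∈ its ↔ x ∈ L₂) {s : St}
    (hs : Prepared p g L₁ L₂ its s) {a : ℕ} (ha : a < 2 * n + 1) (hpass : s.var .pass = a)
    (hbuf : ∀ κ < m ^ n, Repr (p ^ (3 * n + 2)) (s.arr .buf (n * (2 * m ^ n) + κ))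
      (passValue p g L₁ L₂ its a κ))
    (hbase : a ≠ 0 → ∀ κ < m ^ n, Repr (p ^ (3 * n + 2)) (s.arr .base κ)
      (passValue p g L₁ L₂ its 0 κ)) :
    Tri L (decode m) s (decodeTime m n) fun s' => Frame (decode m) s s' ∧
      (∀ κ < m ^ n, Repr (p ^ (3 * n + 2)) (s'.arr .base κ) (passValue p g L₁ L₂ its 0 κ)) ∧
      (∀ κ < m ^ n, ∀ t ∈ pairs L₁ L₂ its κ,
        s'.arr .res (a * m ^ n + κ) = pairAttr its a t % m) ∧
      ∀ i < a * m ^ n, s'.arr .res i = s.arr .res i := by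
  have hm := hP.two_le
  have hmp := hP.lt_prime
  have hp := hP.prime_le
  have hL := hP.le_bound
  have hM := hP.two_mul_pow_le
  have hN := hP.lt_modulus
  have hmod : ∀ a, a % p ^ (3 * n + 2) < p ^ (3 * n + 2) := fun a => Nat.mod_lt _ (by omega)
  refine Tri.frame ?_
  unfold decode
  refine Tri.mono (Tri.forTo (K := m ^ n) (T := m * (3 + 2) + 2 + 2) (fun k s' =>
    -- The reference values are filled in during pass `0` and are complete in all later passes.
    (∀ κ < m ^ n, a ≠ 0 ∨ κ < k →
      Repr (p ^ (3 * n + 2)) (s'.arr .base κ) (passValue p g L₁ L₂ its 0 κ)) ∧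
    (∀ κ < k, ∀ t ∈ pairs L₁ L₂ its κ, s'.arr .res (a * m ^ n + κ) = pairAttr its a t % m) ∧
    ∀ i < a * m ^ n, s'.arr .res i = s.arr .res i) rfl (by omega) ?_ (by exact fun _ _ _ h => h)
    ?_ ?_) le_rfl ?_
  · intro s' hf
    simp [hf.var .pow rfl, hs.ready.pow]
  · refine ⟨fun κ hκ h => hbase (by omega) κ hκ, fun κ h => by omega, fun i _ => rfl⟩
  · rintro k hk s1 hf hv ⟨i1, i2, i3⟩
    have fp := hf.var .pow rfl
    have fn := hf.var .n rfl
    have fm := hf.var .modulus rfl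
    have fa := hf.var .pass rfl
    have f1 := hf.arr .buf rfl
    have f2 := hf.arr .unit rfl
    rw [hs.ready.pow] at fp
    rw [hs.ready.dim] at fn
    rw [hs.ready.modulus] at fm
    rw [hpass] at fa
    clear hf
    have hbk := hbuf k hk
    refine Tri.mono_time (Tri.andThen (T₁ := 2) (T₂ := m * (3 + 2) + 2)
      (Q' := fun s' => Frame (.ite (var .pass) .skip
        (.store .base (var .k) (get .buf (var .n * (2 * var .pow) + var .k)))) s1 s' ∧
        ∀ κ < m ^ n, a ≠ 0 ∨ κ < k + 1 →
          Repr (p ^ (3 * n + 2)) (s'.arr .base κ) (passValue p g L₁ L₂ its 0 κ)) ?_ ?_) (by omega)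
    · refine Tri.frame (Tri.ite (T := 1) (fun hne => Tri.skip ?_)
        fun hne => Tri.store (T := 0) ?_ ?_)
      · simp [fa] at hne
        exact fun κ hκ _ => i1 κ hκ (Or.inl hne)
      · simp [fn, fp, hv, f1]
        have := hbk.1
        omega
      · simp [fa] at hne
        subst hne
        intro κ hκ h
        simp [fn, fp, hv, f1, Function.update_apply]
        split_ifs with hκk
        · subst hκk; exact hbk
        · exact i1 κ hκ (Or.inr (by omega))
    rintro s2 ⟨hf, j1⟩
    have gp := hf.var .pow rfl
    have gn := hf.var .n rfl
    have gm := hf.var .modulus rfl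
    have ga := hf.var .pass rfl
    have gk := hf.var .k rfl
    have g1 := hf.arr .buf rfl
    have g2 := hf.arr .unit rfl
    have g3 := hf.arr .res rfl
    rw [fp] at gp
    rw [fn] at gn
    rw [fm] at gm
    rw [fa] at ga
    rw [hv] at gk
    rw [f1] at g1
    rw [f2] at g2
    clear hf fp fn fm fa f1 f2
    refine Tri.mono (Tri.forTo (K := m) (T := 3) (fun c s' =>
      (∀ t ∈ pairs L₁ L₂ its k, pairAttr its a t % m < c →
        s'.arr .res (a * m ^ n + k) = pairAttr its a t % m) ∧
      ∀ i ≠ a * m ^ n + k, s'.arr .res i = s1.arr .res i) rfl (by omega) ?_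
      (by exact fun _ _ _ h => h) ?_ ?_) le_rfl ?_
    · intro s' hf
      simp
    · exact ⟨fun t _ h => by omega, fun i _ => by rw [g3]⟩
    · rintro c hc s3 hf hvc ⟨k1, k2⟩
      have e1 := hf.var .pow rfl
      have e2 := hf.var .n rfl
      have e3 := hf.var .modulus rfl
      have e4 := hf.var .pass rfl
      have e5 := hf.var .k rfl
      have e6 := hf.arr .buf rfl
      have e7 := hf.arr .unit rfl
      have e8 := hf.arr .base rfl
      rw [gp] at e1
      rw [gn] at e2
      rw [gm] at e3
      rw [ga] at e4
      rw [gk] at e5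
      rw [g1] at e6
      rw [g2] at e7
      clear hf
      have hbs := j1 k hk (Or.inr (by omega))
      have hval : (get .base (var .k) * get .unit (var .c) % var .modulus : Expr).eval s3 =
          s2.arr .base k * s.arr .unit c % p ^ (3 * n + 2) := by
        simp [e3, e5, e7, e8, hvc]
      have hlt := hmod (s2.arr .base k * s.arr .unit c)
      have hcast : ((s2.arr .base k * s.arr .unit c % p ^ (3 * n + 2) : ℕ) :
          ZMod (p ^ (3 * n + 2))) = passValue p g L₁ L₂ its 0 k * theRoot p g n ^ c := by
        rw [ZMod.natCast_mod, Nat.cast_mul, hbs.2, hs.ready.unit c hc]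
      have htest : s.arr .buf (n * (2 * m ^ n) + k) =
          s2.arr .base k * s.arr .unit c % p ^ (3 * n + 2) ↔
          passValue p g L₁ L₂ its a k = passValue p g L₁ L₂ its 0 k * theRoot p g n ^ c := by
        rw [← hcast, ← hbk.2, ZMod.natCast_eq_natCast_iff]
        exact ⟨fun h => by rw [h], fun h => h.eq_of_lt_of_lt hbk.1 hlt⟩
      refine Tri.assign_seq (by rw [hval]; omega) <| Tri.ite (T := 1) (fun hne => Tri.skip ?_)
        fun hne => Tri.store (T := 0) (by simp [hvc]; omega) ?_
      all_goals
        rw [hval] at hne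
        simp [e1, e2, e5, e6] at hne
      · refine ⟨fun t ht h => ?_, k2⟩
        refine k1 t ht ?_
        have := (passValue_eq_iff hP h1 hu hlen hL₁ hL₂ h₁ h₂ ht ha hc).not.1
          (htest.not.1 (by omega))
        omega
      · simp only [St.setArr_arr, St.setVar_arr, St.setVar_var, Expr.eval_var, Expr.eval_add,
          Expr.eval_mul, reduceIte, reduceCtorEq, e1, e4, e5, hvc, Function.update_self]
        refine ⟨fun t ht h => ?_, fun i hi => ?_⟩
        · exact ((passValue_eq_iff hP h1 hu hlen hL₁ hL₂ h₁ h₂ ht ha hc).1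
            (htest.1 (by omega))).symm
        · rw [Function.update_of_ne hi, k2 i hi]
    · rintro s3 ⟨hf, k1, k2⟩
      have e8 := hf.arr .base rfl
      refine ⟨by rw [e8]; exact j1, fun κ hκ t ht => ?_, fun i hi => ?_⟩
      · by_cases hκk : κ = k
        · subst hκk
          exact k1 t ht (Nat.mod_lt _ (by omega))
        · rw [k2 _ (by omega)]
          exact i2 κ (by omega) t ht
      · rw [k2 i (by omega)]
        exact i3 i hi
  · rintro s' ⟨-, k1, k2, k3⟩
    exact ⟨fun κ hκ => k1 κ hκ (Or.inr hκ), k2, k3⟩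

/-- The number of steps of `output`. -/
abbrev outputTime (m n : ℕ) : ℕ := m ^ n * (2 * n * (1 + 2) + 2 + 1 + 1 + 2) + 2 + 1

/-- Correctness and running time of `output`. -/
theorem tri_output (hP : Params m p g n L) {s : St} (hdim : s.var .n = n)
    (hpow : s.var .pow = m ^ n) :
    Tri L output s (outputTime m n) fun s' => s'.out = s.out ++
      ((List.range (m ^ n)).flatMap fun κ => if s.arr .base κ = 0 then [] else
        1 :: (List.range (2 * n)).map fun j => s.arr .res ((j + 1) * m ^ n + κ)) ++ [0] := by
  have hL := hP.le_bound
  have hM := hP.two_mul_pow_le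
  have hN := hP.lt_modulus
  unfold output
  refine Tri.andThen (T₂ := 1) (Tri.forTo (K := m ^ n) (T := 2 * n * (1 + 2) + 2 + 1 + 1)
    (fun k s' => s'.out = s.out ++ ((List.range k).flatMap fun κ =>
      if s.arr .base κ = 0 then [] else
        1 :: (List.range (2 * n)).map fun j => s.arr .res ((j + 1) * m ^ n + κ)))
    rfl (by omega) ?_ (by exact fun _ _ _ h => h) ?_ ?_) ?_
  · intro s' hf
    simp [hf.var .pow rfl, hpow]
  · simp
  · rintro k hk s1 hf hv hout
    have fp := hf.var .pow rfl
    have fn := hf.var .n rfl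
    have f1 := hf.arr .base rfl
    have f2 := hf.arr .res rfl
    rw [hpow] at fp
    rw [hdim] at fn
    clear hf
    rw [List.range_succ, List.flatMap_append, ← List.append_assoc]
    refine Tri.ite (fun hne => ?_) (fun hne => Tri.skip ?_)
    · simp [hv, f1] at hne
      refine Tri.write_seq ?_
      refine Tri.mono (Tri.forTo (K := 2 * n) (T := 1) (fun i s' => s'.out = s1.out ++
        1 :: (List.range i).map fun j => s.arr .res ((j + 1) * m ^ n + k)) rfl (by omega) ?_
        (by exact fun _ _ _ h => h) ?_ ?_) le_rfl ?_
      · intro s' hf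
        simp [hf.var .n rfl, fn]
      · simp
      · rintro i hi s2 hf hvi h
        have e1 := hf.var .pow rfl
        have e2 := hf.var .k rfl
        have e3 := hf.arr .res rfl
        simp [fp, hv, f2] at e1 e2 e3
        refine Tri.write (T := 0) ?_
        simp [h, e1, e2, e3, hvi, List.range_succ]
      · rintro s2 ⟨-, h⟩
        rw [h, hout]
        simp [hne]
    · simp [hv, f1] at hne
      simp [hout, hne]
  · rintro s1 ⟨-, h⟩
    refine Tri.write (T := 0) ?_
    simp [h]

end Imp

/-! ### From the tables to the combined language -/

namespace Imp

open Imp.Expr Imp.Cmd Portal Finset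

variable {m p g n L : ℕ} {L₁ L₂ : Set (StateString m n)} {its : List (ℕ × StateString m n)}

theorem flatMap_filter_ne_zero {α : Type*} (b : ℕ → ℕ) (f : ℕ → List α) (l : List ℕ) :
    (l.filter fun k => b k ≠ 0).flatMap f = l.flatMap fun k => if b k = 0 then [] else f k := by
  induction l with
  | nil => rfl
  | cons k l ih => by_cases h : b k = 0 <;> simp_all

theorem map_range_two_mul {α : Type*} (f : ℕ → α) (n : ℕ) :
    (List.range (2 * n)).map f = (List.range n).flatMap fun j => [f (2 * j), f (2 * j + 1)] := by
  induction n with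
  | zero => rfl
  | succ n ih =>
    rw [show 2 * (n + 1) = 2 * n + 1 + 1 by ring, List.range_succ, List.range_succ,
      List.range_succ, List.map_append, List.map_append, ih]
    simp

/-- The tables of the results describe an enumeration of the combined language. -/
theorem exists_enumerates_combineLang (hm : 2 ≤ m) (hL₁ : IsSparse L₁) (hL₂ : IsSparse L₂)
    (h₁ : ∀ x, (0, x) ∈ its ↔ x ∈ L₁) (h₂ : ∀ x, (1, x) ∈ its ↔ x ∈ L₂) {base res : ℕ → ℕ}
    (hbase : ∀ κ < m ^ n, base κ ≠ 0 ↔ (pairs L₁ L₂ its κ).Nonempty)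
    (hres : ∀ a < 2 * n + 1, ∀ κ < m ^ n, ∀ t ∈ pairs L₁ L₂ its κ,
      res (a * m ^ n + κ) = pairAttr its a t % m) :
    ∃ l : List (StateString m n), Enumerates l (combineLang L₁ L₂) ∧
      encodeStrings l = ((List.range (m ^ n)).flatMap fun κ => if base κ = 0 then [] else
        1 :: (List.range (2 * n)).map fun j => res ((j + 1) * m ^ n + κ)) ++ [0] := by
  have hz : ∀ κ, ∃ z : StateString m n, (pairs L₁ L₂ its κ).Nonempty →
      ∃ t ∈ pairs L₁ L₂ its κ, its[t.1].2.combine its[t.2].2 = fun i => some (z i) := by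
    intro κ
    by_cases h : (pairs L₁ L₂ its κ).Nonempty
    · obtain ⟨t, ht⟩ := h
      obtain ⟨a, b, c⟩ := pairs_mem h₁ h₂ ht
      obtain ⟨z, hz⟩ := exists_combine (c.bit_eq a b)
      exact ⟨z, fun _ => ⟨t, ht, hz⟩⟩
    · exact ⟨fun _ => .rho ⟨0, by omega⟩, fun h' => absurd h' h⟩
  choose z hz using hz
  -- One string for each occupied index, in increasing order of the indices, as the program writes
  -- them.
  refine ⟨((List.range (m ^ n)).filter fun κ => base κ ≠ 0).map z, ⟨?_, fun w => ?_⟩, ?_⟩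
  · refine List.Nodup.map_on ?_ (List.nodup_range.filter _)
    intro κ hκ κ' hκ' he
    simp only [List.mem_filter, List.mem_range, decide_eq_true_eq] at hκ hκ'
    obtain ⟨t, ht, e⟩ := hz κ ((hbase κ hκ.1).1 hκ.2)
    obtain ⟨t', ht', e'⟩ := hz κ' ((hbase κ' hκ'.1).1 hκ'.2)
    rw [combine_eq_some_iff] at e e'
    rw [← he] at e'
    refine Joins.index_unique (by omega) hκ.1 hκ'.1 (pairs_mem h₁ h₂ ht).2.2
      (pairs_mem h₁ h₂ ht').2.2 (fun j hj => ?_) fun j hj => ?_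
    · rw [← (e j hj).2.1, ← (e' j hj).2.1]
    · rw [← (e j hj).2.2, ← (e' j hj).2.2]
  · simp only [List.mem_map, List.mem_filter, List.mem_range, decide_eq_true_eq]
    constructor
    · rintro ⟨κ, ⟨hκ, hb⟩, rfl⟩
      obtain ⟨t, ht, e⟩ := hz κ ((hbase κ hκ).1 hb)
      obtain ⟨a, b, -⟩ := pairs_mem h₁ h₂ ht
      exact ⟨_, a.1, _, b.1, e⟩
    · rintro ⟨x, hx, y, hy, e⟩
      rw [combine_eq_some_iff] at e
      have hb : ∀ j < n, bit x j = bit y j := fun j hj => (e j hj).1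
      obtain ⟨κ, hκ, hJ⟩ := exists_joins hm (Branch (common L₁ L₂)) hb
      obtain ⟨t, ht, rfl, rfl⟩ := exists_mem_pairs h₁ h₂ hx hy hb hJ
      obtain ⟨t', ht', e'⟩ := hz κ ⟨t, ht⟩
      rw [combine_eq_some_iff] at e'
      obtain ⟨a1, a2, a3⟩ := pairs_mem h₁ h₂ ht
      obtain ⟨b1, b2, b3⟩ := pairs_mem h₁ h₂ ht'
      -- The string `z κ` may come from another pair than the given one; uniqueness identifies the
      -- combinations.
      have hu : ∀ j < n, _ := fun j hj => a3.unique hL₁ hL₂ a1 a2 b3 b1 b2 hj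
      refine ⟨κ, ⟨hκ, (hbase κ hκ).2 ⟨t, ht⟩⟩, ext_of_bit_wt (fun j hj => ?_) fun j hj => ?_⟩
      · rw [(e j hj).2.1, (e' j hj).2.1, (hu j hj).1]
      · rw [(e j hj).2.2, (e' j hj).2.2, (hu j hj).2]
  · rw [encodeStrings, List.flatMap_map, flatMap_filter_ne_zero]
    congr 1
    refine List.flatMap_congr fun κ hκ => ?_
    rw [List.mem_range] at hκ
    split_ifs with h0
    · rfl
    obtain ⟨t, ht, e⟩ := hz κ ((hbase κ hκ).1 h0)
    rw [combine_eq_some_iff] at e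
    rw [encodeString_eq, map_range_two_mul]
    congr 1
    refine List.flatMap_congr fun j hj => ?_
    rw [List.mem_range] at hj
    obtain ⟨e1, e2, e3⟩ := e j hj
    rw [hres _ (by omega) κ hκ t ht, hres _ (by omega) κ hκ t ht, pairAttr, pairAttr,
      attrVal_odd, attrVal_odd, attrVal_even, attrVal_even, e2, e3]
    -- The second language contributes no bit, and a single bit is below `m`, so reduction does not
    -- alter it.
    rw [Nat.mod_eq_of_lt (a := _ + _ * (1 - 1)) (by
      simpa using (bit_le_one _ j).trans_lt hm)]
    simp

/-- The program tests the stored residue, and because it is reduced, it is zero only if the scaled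
count is zero in the ring. -/
theorem repr_ne_zero_iff (hP : Params m p g n L) (hlen : its.length ≤ 2 * m ^ n) {κ v : ℕ}
    (h : Repr (p ^ (3 * n + 2)) v (passValue p g L₁ L₂ its 0 κ)) :
    v ≠ 0 ↔ (pairs L₁ L₂ its κ).Nonempty := by
  constructor
  · intro hv
    by_contra hne
    rw [not_nonempty_iff_eq_empty] at hne
    have := h.2
    rw [passValue_zero, hne, card_empty, mul_zero, ZMod.natCast_eq_natCast_iff] at this
    exact hv (this.eq_of_lt_of_lt h.1 (by have := h.1; omega))
  · rintro hne rfl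
    exact passValue_zero_ne_zero hP hlen hne (by rw [← h.2, Nat.cast_zero])

/-- The number of steps of `convolve` and `decode` for all attributes. -/
abbrev passesTime (m n : ℕ) : ℕ := (2 * n + 1) * (convolveTime m n + decodeTime m n + 2) + 2

/-- All passes together compute every attribute of all combinations. -/
theorem tri_passes (hP : Params m p g n L) (h1 : theRoot p g n ^ m = 1)
    (hu : ∀ s, ¬ m ∣ s → IsUnit (theRoot p g n ^ s - 1)) (hlen : its.length ≤ 2 * m ^ n)
    (hL₁ : IsSparse L₁) (hL₂ : IsSparse L₂)
    (h₁ : ∀ x, (0, x) ∈ its ↔ x ∈ L₁) (h₂ : ∀ x, (1, x) ∈ its ↔ x ∈ L₂) {s : St}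
    (hs : Prepared p g L₁ L₂ its s) :
    Tri L (forTo .pass (2 * var .n + 1) (convolve m ⨾ decode m)) s (passesTime m n) fun s' =>
      Frame (forTo .pass (2 * var .n + 1) (convolve m ⨾ decode m)) s s' ∧
      (∀ κ < m ^ n, Repr (p ^ (3 * n + 2)) (s'.arr .base κ) (passValue p g L₁ L₂ its 0 κ)) ∧
      ∀ a < 2 * n + 1, ∀ κ < m ^ n, ∀ t ∈ pairs L₁ L₂ its κ,
        s'.arr .res (a * m ^ n + κ) = pairAttr its a t % m := by
  have hL := hP.le_bound
  have hN := hP.lt_modulus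
  refine Tri.mono (Tri.forTo (K := 2 * n + 1) (T := convolveTime m n + decodeTime m n)
    (fun a s => (a ≠ 0 → ∀ κ < m ^ n, Repr (p ^ (3 * n + 2)) (s.arr .base κ)
      (passValue p g L₁ L₂ its 0 κ)) ∧ ∀ b < a, ∀ κ < m ^ n, ∀ t ∈ pairs L₁ L₂ its κ,
        s.arr .res (b * m ^ n + κ) = pairAttr its b t % m)
    rfl (by omega) ?_ (by exact fun _ _ _ h => h) (by simp) ?_) le_rfl
    fun s' ⟨hf, j1, j2⟩ => ⟨hf, j1 (by omega), j2⟩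
  · intro s' hf
    simp [hf.var .n rfl, hs.ready.dim]
  · rintro a ha s1 hf hv ⟨i1, i2⟩
    have hs1 : Prepared p g L₁ L₂ its s1 :=
      hs.congr (fun x hx => by rcases hx with rfl | rfl | rfl | rfl | rfl <;> exact hf.var _ rfl)
        fun x a1 a2 a3 => hf.arr x (by
          cases x <;> first | rfl | exact absurd rfl a1 | exact absurd rfl a2 | exact absurd rfl a3)
    clear hf
    refine Tri.andThen (T₁ := convolveTime m n) (T₂ := decodeTime m n)
      (tri_convolve hP h1 hu hlen hs1 ha hv) ?_
    rintro s2 ⟨hf, hbuf⟩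
    have hs2 : Prepared p g L₁ L₂ its s2 :=
      hs1.congr (fun x hx => by rcases hx with rfl | rfl | rfl | rfl | rfl <;> exact hf.var _ rfl)
        fun x a1 _ _ => hf.arr x (by cases x <;> first | rfl | exact absurd rfl a1)
    have e1 := hf.arr .base rfl
    have e2 := hf.arr .res rfl
    have e3 := (hf.var .pass rfl).trans hv
    clear hf
    refine Tri.mono (tri_decode hP h1 hu hlen hL₁ hL₂ h₁ h₂ hs2 ha e3 hbuf
      (by rw [e1]; exact i1)) le_rfl ?_
    rintro s3 ⟨-, k1, k2, k3⟩
    refine ⟨fun _ => k1, fun b hb κ hκ t ht => ?_⟩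
    rcases (Nat.lt_succ_iff_lt_or_eq.1 hb) with hb | rfl
    · have : (b + 1) * m ^ n ≤ a * m ^ n := Nat.mul_le_mul_right _ hb
      rw [k3 _ (by rw [add_mul] at this; omega), e2]
      exact i2 b hb κ hκ t ht
    · exact k2 κ hκ t ht

/-- The number of steps of the whole program. -/
abbrev joinTime (m p n : ℕ) : ℕ :=
  setupTime m p n + (2 * (m ^ n * (readTime n + 2) + 1 + 1 + 2) + 2 +
    (2 ^ n * (1 + 2) + 2 + (n * (2 ^ n * (5 + 2) + 2 + 1 + 2) + 2 + 1) +
      (2 * m ^ n * (n * (2 + 2) + 2 + 1 + 1 + 2) + 2 + (passesTime m n + outputTime m n))))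

/-- The whole program writes an enumeration of the combined language. -/
theorem tri_joinProgram (hP : Params m p g n L) (h1 : theRoot p g n ^ m = 1)
    (hu : ∀ s, ¬ m ∣ s → IsUnit (theRoot p g n ^ s - 1))
    (hL₁ : IsSparse L₁) (hL₂ : IsSparse L₂) {l₁ l₂ : List (StateString m n)}
    (hl₁ : Enumerates l₁ L₁) (hl₂ : Enumerates l₂ L₂) :
    Tri L (joinProgram m p g) (.init (n :: (encodeStrings l₁ ++ encodeStrings l₂)))
      (joinTime m p n) fun s => ∃ l : List (StateString m n),
        Enumerates l (combineLang L₁ L₂) ∧ s.out = encodeStrings l := by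
  have hm := hP.two_le
  have hL := hP.le_bound
  have hM := hP.two_mul_pow_le
  have hT := hP.two_pow_le
  have hN := hP.lt_modulus
  have hp := hP.prime_le
  have hmp := hP.lt_prime
  have c₁ := hL₁.length_le hm hl₁
  have c₂ := hL₂.length_le hm hl₂
  let its : List (ℕ × StateString m n) := l₁.map (0, ·) ++ l₂.map (1, ·)
  have h₁ : ∀ x, (0, x) ∈ its ↔ x ∈ L₁ := by simp [its, hl₁.2]
  have h₂ : ∀ x, (1, x) ∈ its ↔ x ∈ L₂ := by simp [its, hl₂.2]
  have hits : ∀ it ∈ its, it.1 < 2 := by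
    intro it hit
    simp only [its, List.mem_append, List.mem_map] at hit
    rcases hit with ⟨x, -, rfl⟩ | ⟨x, -, rfl⟩ <;> simp
  have hlen : its.length ≤ 2 * m ^ n := by simp [its]; omega
  refine Tri.andThen (tri_setup hP) ?_
  rintro s1 ⟨f1, inp1, r1⟩
  have hl1 : Loaded ([] : List (ℕ × StateString m n)) s1 :=
    ⟨by rw [f1.var .cnt rfl]; rfl, by simp, by simp, fun i _ => by rw [f1.arr .attr rfl]; rfl,
      by simp, by simp, fun v sd _ => by rw [f1.arr .seen rfl]; simp [St.init]⟩
  have b1 : s1.arr .branch = fun _ => 0 := by rw [f1.arr .branch rfl]; rfl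
  have o1 : s1.out = [] := f1.out rfl
  clear f1
  refine Tri.andThen (tri_readAll (by omega) hm (by omega) (by omega) (by omega) c₁ c₂ hl1 r1.dim
    inp1) ?_
  rintro s2 ⟨f2, hl2⟩
  have r2 : Ready m p g n s2 := r1.congr (f2.var _ rfl) (f2.var _ rfl) (f2.var _ rfl)
    (f2.var _ rfl) (f2.arr _ rfl) (f2.arr _ rfl)
  have b2 := (f2.arr .branch rfl).trans b1
  have o2 := (f2.out rfl).trans o1
  clear f2
  refine Tri.andThen (tri_branching (by omega) (by omega) h₁ h₂ hl2 r2.dim r2.two b2) ?_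
  rintro s3 ⟨f3, br⟩
  have r3 : Ready m p g n s3 := r2.congr (f3.var _ rfl) (f3.var _ rfl) (f3.var _ rfl)
    (f3.var _ rfl) (f3.arr _ rfl) (f3.arr _ rfl)
  have hl3 : Loaded its s3 := hl2.congr (f3.var _ rfl) fun a h => by
    rcases h with rfl | rfl | rfl | rfl | rfl <;> exact f3.arr _ rfl
  have o3 := (f3.out rfl).trans o2
  have hb3 : ∀ j < n, (s3.arr .branch j ≠ 0 ↔ Branch (common L₁ L₂) j) := fun j hj => by
    rw [br.branch j hj]
    simp
  clear f3
  refine Tri.andThen (tri_keys hP hits hlen hl3 r3 hb3) ?_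
  rintro s4 ⟨f4, hk⟩
  have hl4 : Loaded its s4 := hl3.congr (f4.var _ rfl) fun a h => by
    rcases h with rfl | rfl | rfl | rfl | rfl <;> exact f4.arr _ rfl
  have hs4 : Prepared p g L₁ L₂ its s4 := {
    ready := r3.congr (f4.var _ rfl) (f4.var _ rfl) (f4.var _ rfl) (f4.var _ rfl)
      (f4.arr _ rfl) (f4.arr _ rfl)
    loaded := hl4
    branch := by rw [f4.arr .branch rfl]; exact hb3
    active := fun k hk => by
      rw [hl4.code k hk, f4.arr .common rfl, br.common]
      simp [Active]
    key := hk }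
  have o4 := (f4.out rfl).trans o3
  clear f4
  refine Tri.andThen (tri_passes hP h1 hu hlen hL₁ hL₂ h₁ h₂ hs4) ?_
  rintro s5 ⟨f5, hbase, hres⟩
  obtain ⟨l, hl, he⟩ := exists_enumerates_combineLang hm hL₁ hL₂ h₁ h₂
    (fun κ hκ => repr_ne_zero_iff hP hlen (hbase κ hκ)) hres
  refine Tri.mono (tri_output hP ((f5.var .n rfl).trans hs4.ready.dim)
    ((f5.var .pow rfl).trans hs4.ready.pow)) le_rfl fun s' h => ⟨l, hl, ?_⟩
  rw [h, he, f5.out rfl, o4, List.nil_append]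

/-! ## Running time -/

/-- `f n` is bounded by a constant times `(m ^ n) ^ e * (n + 1) ^ k`. -/
def Bounded (m e k : ℕ) (f : ℕ → ℕ) : Prop := ∃ C, ∀ n, f n ≤ C * (m ^ n) ^ e * (n + 1) ^ k

namespace Bounded

variable {e e' k k' : ℕ} {f f' : ℕ → ℕ}

theorem const (c : ℕ) : Bounded m 0 0 fun _ => c := ⟨c, by simp⟩

theorem id : Bounded m 0 1 fun n => n := ⟨1, by simp⟩

theorem pow : Bounded m 1 0 fun n => m ^ n := ⟨1, by simp⟩

theorem two_pow (hm : 2 ≤ m) : Bounded m 1 0 fun n => 2 ^ n :=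
  ⟨1, fun n => by simpa using Nat.pow_le_pow_left hm n⟩

theorem mul (h : Bounded m e k f) (h' : Bounded m e' k' f') :
    Bounded m (e + e') (k + k') fun n => f n * f' n := by
  obtain ⟨C, h⟩ := h
  obtain ⟨C', h'⟩ := h'
  exact ⟨C * C', fun n => (Nat.mul_le_mul (h n) (h' n)).trans_eq (by ring)⟩

theorem mono (hm : 0 < m) (h : Bounded m e k f) (he : e ≤ e') (hk : k ≤ k') :
    Bounded m e' k' f := by
  obtain ⟨C, h⟩ := h
  refine ⟨C, fun n => (h n).trans ?_⟩
  have : 0 < m ^ n := pow_pos hm n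
  gcongr
  omega

theorem add (hm : 0 < m) (h : Bounded m e k f) (h' : Bounded m e' k' f') :
    Bounded m (max e e') (max k k') fun n => f n + f' n := by
  obtain ⟨C, h⟩ := h.mono hm (le_max_left e e') (le_max_left k k')
  obtain ⟨C', h'⟩ := h'.mono hm (le_max_right e e') (le_max_right k k')
  exact ⟨C + C', fun n => (Nat.add_le_add (h n) (h' n)).trans_eq (by ring)⟩

end Bounded

/-- The leading term comes from `2 * n + 1` passes over `n` digits of a buffer of size `2 * m ^ n`;
`m ^ n` and `2 ^ n` are never multiplied with each other or themselves. -/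
theorem bounded_joinTime (hm : 2 ≤ m) (p : ℕ) : Bounded m 1 2 (joinTime m p) := by
  have hm0 : 0 < m := by omega
  apply Bounded.mono hm0
  · unfold joinTime
    repeat' first
      | exact Bounded.const _
      | exact Bounded.id
      | exact Bounded.pow
      | exact Bounded.two_pow hm
      | apply Bounded.add hm0
      | apply Bounded.mul
  all_goals decide

/-- For fixed `p`, `A` and `d` the numbers have `O(n)` bits, and an instruction costs at most about
the square of that. -/
theorem bounded_unitCost (hm : 2 ≤ m) (p A d : ℕ) :
    Bounded m 0 2 fun n => unitCost ((p ^ (3 * n + 2) * A) ^ d) := by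
  have hm0 : 0 < m := by omega
  have h : Bounded m 0 1 fun n => 1 + ((p * (3 * n + 2) + A) * d + 1) := by
    apply Bounded.mono hm0
    · repeat' first
        | exact Bounded.const _
        | exact Bounded.id
        | apply Bounded.add hm0
        | apply Bounded.mul
    all_goals decide
  have hs : ∀ n, ((p ^ (3 * n + 2) * A) ^ d).size ≤ (p * (3 * n + 2) + A) * d + 1 := by
    intro n
    rw [Nat.size_le]
    calc (p ^ (3 * n + 2) * A) ^ d ≤ ((2 ^ p) ^ (3 * n + 2) * 2 ^ A) ^ d := by
          gcongr <;> exact Nat.lt_two_pow_self.le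
      _ = 2 ^ ((p * (3 * n + 2) + A) * d) := by ring
      _ < _ := Nat.pow_lt_pow_right (by omega) (by omega)
  obtain ⟨C, hC⟩ := h.mul h
  exact ⟨C, fun n => (Nat.mul_le_mul (Nat.add_le_add_left (hs n) 1)
    (Nat.add_le_add_left (hs n) 1)).trans (hC n)⟩

theorem le_of_mem_encodeStrings (hm : 2 ≤ m) (l : List (StateString m n)) :
    ∀ v ∈ encodeStrings l, v ≤ m := by
  intro v hv
  simp only [encodeStrings, encodeString_eq, List.mem_append, List.mem_flatMap, List.mem_cons,
    List.not_mem_nil, or_false] at hv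
  rcases hv with ⟨x, -, rfl | ⟨j, -, rfl | rfl⟩⟩ | rfl
  · omega
  · exact (bit_le_one x j).trans (by omega)
  · exact (wt_lt (by omega) x j).le
  · omega

end Imp

/-! ### The theorem: choice of the constants -/

open Imp in
theorem mainTheorem8 :
    ∃ c : ℕ, ∀ m : ℕ, 2 ≤ m → ∃ (C : ℕ) (P : RAM.Program),
      ∀ (n : ℕ) (L₁ L₂ : Set (StateString m n)),
        IsSparse L₁ → IsSparse L₂ → IsSparse (combineLang L₁ L₂) →
        ∀ l₁ l₂ : List (StateString m n), Enumerates l₁ L₁ → Enumerates l₂ L₂ →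
          ∃ l : List (StateString m n), Enumerates l (combineLang L₁ L₂) ∧
            RAM.OutputsInTime P (n :: (encodeStrings l₁ ++ encodeStrings l₂))
              (encodeStrings l) (C * m ^ n * (n + 1) ^ c) := by
  -- Two factors `n + 1` come from the number of unit steps and two from the cost of a step.
  refine ⟨4, fun m hm => ?_⟩
  obtain ⟨p, g, hp, hmp, hgp, hroot⟩ := Portal.exists_prime_root hm
  let P := joinProgram m p g
  obtain ⟨C, hC⟩ := ((bounded_joinTime hm p).mul
    ((Bounded.const P.len).mul (bounded_unitCost hm p (16 + P.litBound) P.deg)))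
  refine ⟨C, P.comp 0, fun n L₁ L₂ hL₁ hL₂ _ l₁ l₂ hl₁ hl₂ => ?_⟩
  have hpos : 0 < p ^ (3 * n + 2) := pow_pos hp.pos _
  -- The bound on stored values has to cover `16` times the modulus and the literals of the program.
  have hP : Params m p g n (p ^ (3 * n + 2) * (16 + P.litBound)) :=
    ⟨hm, hp, hmp, hgp, by rw [mul_comm]; gcongr; omega⟩
  have hN := hP.lt_modulus
  have hle := hP.le_bound
  have hpl := hP.prime_le
  obtain ⟨h1, hu⟩ := hroot (3 * n + 2)
  obtain ⟨t, ht, s, hev, l, hl, hout⟩ := tri_joinProgram hP h1 hu hL₁ hL₂ hl₁ hl₂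
  refine ⟨l, hl, hout ▸ outputsInTime_of_ev (by omega) hev ?_ ?_ ?_⟩
  · intro v hv
    rw [List.mem_cons, List.mem_append] at hv
    rcases hv with rfl | hv | hv
    · omega
    · have := le_of_mem_encodeStrings hm l₁ v hv
      omega
    · have := le_of_mem_encodeStrings hm l₂ v hv
      omega
  · exact le_trans (by omega) (Nat.le_mul_of_pos_left (16 + P.litBound) hpos)
  · refine (Nat.mul_le_mul_right _ ht).trans ((hC n).trans_eq ?_)
    simp
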